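/- Let $\alpha\in(0,\infty)$ and let $\mathcal M\subset\mathbb R^{n+1}$ be a smooth, closed (compact, without boundary), connected, $n$-dimensional hypersurface with unit normal field $\mu$, and let $h$ be the metric on $\mathcal M$ induced by the Euclidean metric $\mathfrak e$ of $\mathbb R^{n+1}$, with volume form $do_h$. Let $x:\mathcal M\times[0,T)\to\mathbb R^{n+1}$ be a time-dependent embedding (each $x(\cdot,t)$ of class $C^2$; $x$ continuous on $\mathcal M\times[0,T)$ and of class $C^1$ on $\mathcal M\times(0,T)$) which solves the mean curvature flow $\partial_t x=-(H\nu)\circ x$, $x(\cdot,0)=x_0$, where $\nu$ is a unit normal field to $\Gamma(t)=x(\mathcal M,t)$ and $H$ is the corresponding mean curvature (the sum of the principal curvatures, positive for a round sphere with outer normal). Let $\psi_\alpha(t):\mathcal M\to\mathcal M$, $t\in[0,T)$, be $C^2$-diffeomorphisms (continuous on $\mathcal M\times[0,T)$ and of class $C^1$ on $\mathcal M\times(0,T)$ jointly) which solve the harmonic map heat flow $\partial_t\psi_\alpha=\frac1\alpha\Delta_{g(t),h}\psi_\alpha$, $\psi_\alpha(\cdot,0)=id$, where $g(t)=x(t)^*\mathfrak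 e$ and $\Delta_{g,h}$ is the map Laplacian. Let $\hat x_\alpha(t)=x(t)\circ\psi_\alpha(t)^{-1}$ be the mean curvature–DeTurck flow, $\hat g_\alpha(t)=\hat x_\alpha(t)^*\mathfrak e$ the induced metric, $v_\alpha=\Delta_{\hat g_\alpha}id$ the Laplacian, with respect to $\hat g_\alpha(t)$, of the inclusion $id:\mathcal M\to\mathbb R^{n+1}$, and $$\hat G_\alpha=(\nabla_{\mathcal M}\hat x_\alpha)^T\nabla_{\mathcal M}\hat x_\alpha+\mu\otimes\mu .$$ Here $\nabla_{\mathcal M}$ is the tangential gradient on $\mathcal M$ with components $D_\beta$, $\beta=1,\dots,n+1$; for a map $f$ into $\mathbb R^{n+1}$, $\nabla_{\mathcal M}f$ is the matrix with entries $(\nabla_{\mathcal M}f)_{\kappa\beta}=D_\beta f_\kappa$, and $\hat G_\alpha^{-1}\nabla_{\mathcal M}f:\nabla_{\mathcal M}w=\sum_{\beta,\gamma}(\hat G_\alpha^{-1})^{\beta\gamma}D_\beta f\cdot D_\gamma w$. Then for every $t\in(0,T)$ the derivative $\hat x_{\alpha t}=\partial_t\hat x_\alpha$ exists, $\det\hat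 G_\alpha>0$ on $\mathcal M$, and for all $\chi,\xi\in H^{1,2}(\mathcal M,\mathbb R^{n+1})$ all the integrals below converge absolutely and $$0=\alpha\int_{\mathcal M}\hat x_{\alpha t}\cdot\chi\sqrt{\det\hat G_\alpha}\,do_h+(1-\alpha)\int_{\mathcal M}\big(\hat x_{\alpha t}\cdot(\nu\circ\hat x_\alpha)\big)\big((\nu\circ\hat x_\alpha)\cdot\chi\big)\sqrt{\det\hat G_\alpha}\,do_h$$ $$\quad+\int_{\mathcal M}\hat G_\alpha^{-1}\nabla_{\mathcal M}\hat x_\alpha:\nabla_{\mathcal M}\chi\,\sqrt{\det\hat G_\alpha}\,do_h+\int_{\mathcal M}\big((\nabla_{\mathcal M}\hat x_\alpha)v_\alpha\big)\cdot\chi\,\sqrt{\det\hat G_\alpha}\,do_h,$$ $$0=\int_{\mathcal M}v_\alpha\cdot\xi\,\sqrt{\det\hat G_\alpha}\,do_h+\int_{\mathcal M}\hat G_\alpha^{-1}\nabla_{\mathcal M}id:\nabla_{\mathcal M}\xi\,\sqrt{\det\hat G_\alpha}\,do_h .$$ -/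

import Mathlib

open scoped Manifold ContDiff Matrix
open MeasureTheory Set

namespace DeTurck

noncomputable section

/-- Euclidean space `ℝᵈ`. -/
abbrev Euc (d : ℕ) : Type := EuclideanSpace ℝ (Fin d)

/-! ### Calculus in a coordinate domain of `ℝⁿ` -/

/-- The partial derivative `∂F/∂θⁱ`. -/
def pd {n : ℕ} {V : Type*} [NormedAddCommGroup V] [NormedSpace ℝ V]
    (i : Fin n) (F : Euc n → V) (θ : Euc n) : V :=
  fderiv ℝ F θ (EuclideanSpace.single i 1)

/-- The Christoffel symbol
`Γ(g)ᵏᵢⱼ = ½ gᵏˡ (∂ᵢ gₗⱼ + ∂ⱼ gₗᵢ - ∂ₗ gᵢⱼ)` of a metric given by its components. -/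
def christoffel {n : ℕ} (g : Euc n → Matrix (Fin n) (Fin n) ℝ) (θ : Euc n) (k i j : Fin n) : ℝ :=
  (1 / 2 : ℝ) * ∑ l, (g θ)⁻¹ k l *
    (pd i (fun ϑ => g ϑ l j) θ + pd j (fun ϑ => g ϑ l i) θ - pd l (fun ϑ => g ϑ i j) θ)

/-- The Laplace operator in coordinates, `gⁱʲ (∂ᵢ∂ⱼ F - Γ(g)ᵏᵢⱼ ∂ₖ F)`. -/
def coordLaplacian {n : ℕ} {V : Type*} [NormedAddCommGroup V] [NormedSpace ℝ V]
    (g : Euc n → Matrix (Fin n) (Fin n) ℝ) (F : Euc n → V) (θ : Euc n) : V :=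
  ∑ i, ∑ j, (g θ)⁻¹ i j • (pd i (pd j F) θ - ∑ k, christoffel g θ k i j • pd k F θ)

/-- The map Laplacian in coordinates: the component `q` is
`gⁱʲ (∂ᵢ∂ⱼ Ψ^q - Γ(g)ᵏᵢⱼ ∂ₖ Ψ^q + (Γ(h)^q_{mr} ∘ Ψ) ∂ᵢ Ψ^m ∂ⱼ Ψ^r)`. -/
def coordMapLaplacian {n : ℕ} (g h : Euc n → Matrix (Fin n) (Fin n) ℝ) (Ψ : Euc n → Euc n)
    (θ : Euc n) : Euc n :=
  WithLp.toLp 2 fun q => ∑ i, ∑ j, (g θ)⁻¹ i j *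
    (pd i (pd j fun ϑ => Ψ ϑ q) θ - ∑ k, christoffel g θ k i j * pd k (fun ϑ => Ψ ϑ q) θ
      + ∑ m, ∑ r, christoffel h (Ψ θ) q m r *
          pd i (fun ϑ => Ψ ϑ m) θ * pd j (fun ϑ => Ψ ϑ r) θ)

/-- `W` is the weak partial derivative `∂F/∂θⁱ` of `F` on the open set `Ω`. -/
def IsWeakPartial {n : ℕ} (Ω : Set (Euc n)) (i : Fin n) (F W : Euc n → ℝ) : Prop :=
  LocallyIntegrableOn F Ω ∧ LocallyIntegrableOn W Ω ∧
    ∀ φ : Euc n → ℝ, ContDiff ℝ ∞ φ → HasCompactSupport φ → tsupport φ ⊆ Ω →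
      ∫ θ in Ω, F θ * pd i φ θ = - ∫ θ in Ω, W θ * φ θ

/-! ### Hypersurfaces and maps defined on them

The reference manifold is a subset `M` of `ℝⁿ⁺¹` (so it carries the subspace topology), together
with a smooth `n`-dimensional atlas. -/

/-- `y : M → ℝⁿ⁺¹` is an embedding of class `C^k`: a `C^k` immersion that is a homeomorphism
onto its image. -/
structure IsEmbeddingOfClass {n : ℕ} {M : Set (Euc (n + 1))} [ChartedSpace (Euc n) M]
    (k : WithTop ℕ∞) (y : M → Euc (n + 1)) : Prop where
  contMDiff : ContMDiff (𝓡 n) 𝓘(ℝ, Euc (n + 1)) k y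
  immersion : ∀ p, Function.Injective (mfderiv (𝓡 n) 𝓘(ℝ, Euc (n + 1)) y p)
  isEmbedding : Topology.IsEmbedding y

/-- The inclusion `id : M → ℝⁿ⁺¹`. -/
def incl {n : ℕ} (M : Set (Euc (n + 1))) : M → Euc (n + 1) := fun p => (p : Euc (n + 1))

/-- `ν` is a unit normal at the point `y p` to the hypersurface parametrized by `y`. -/
def IsUnitNormalAt {n : ℕ} {M : Set (Euc (n + 1))} [ChartedSpace (Euc n) M]
    (y : M → Euc (n + 1)) (p : M) (ν : Euc (n + 1)) : Prop :=
  ‖ν‖ = 1 ∧ ∀ w : TangentSpace (𝓡 n) p,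
    inner ℝ ν (show Euc (n + 1) from mfderiv (𝓡 n) 𝓘(ℝ, Euc (n + 1)) y p w) = 0

/-- The components `∂ᵢ Y · ∂ⱼ Y`, `Y = y ∘ e⁻¹`, of the pull-back metric `y^* 𝔢` of the Euclidean
metric in the chart `e`. -/
def pullbackMetric {n : ℕ} {M : Set (Euc (n + 1))}
    (y : M → Euc (n + 1)) (e : OpenPartialHomeomorph M (Euc n)) (θ : Euc n) :
    Matrix (Fin n) (Fin n) ℝ :=
  Matrix.of fun i j => inner ℝ (pd i (y ∘ e.symm) θ) (pd j (y ∘ e.symm) θ)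

/-- The Laplace operator `Δ_g f` on `M` for the metric `g = y^* 𝔢`. -/
def laplacian {n : ℕ} {M : Set (Euc (n + 1))} [ChartedSpace (Euc n) M]
    {V : Type*} [NormedAddCommGroup V] [NormedSpace ℝ V]
    (y : M → Euc (n + 1)) (f : M → V) (p : M) : V :=
  coordLaplacian (pullbackMetric y (chartAt (Euc n) p)) (f ∘ (chartAt (Euc n) p).symm)
    (chartAt (Euc n) p p)

/-- The map Laplacian `Δ_{g,h} ψ` at `p` of `ψ : M → M`, for `g = y^* 𝔢` and `h` the metric
induced on `M` by `ℝⁿ⁺¹`, as a vector in the coordinates of the chart at `ψ p`. -/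
def mapLaplacian {n : ℕ} {M : Set (Euc (n + 1))} [ChartedSpace (Euc n) M]
    (y : M → Euc (n + 1)) (ψ : M → M) (p : M) : Euc n :=
  coordMapLaplacian (pullbackMetric y (chartAt (Euc n) p))
    (pullbackMetric (incl M) (chartAt (Euc n) (ψ p)))
    (chartAt (Euc n) (ψ p) ∘ ψ ∘ (chartAt (Euc n) p).symm) (chartAt (Euc n) p p)

/-- The scalar `H = -gⁱʲ ∂ᵢ∂ⱼ Y · ν`, the mean curvature of the hypersurface parametrized by `y`
with respect to the unit normal `ν` at `y p`. -/
def meanCurvature {n : ℕ} {M : Set (Euc (n + 1))} [ChartedSpace (Euc n) M]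
    (y : M → Euc (n + 1)) (ν : Euc (n + 1)) (p : M) : ℝ :=
  - ∑ i, ∑ j, (pullbackMetric y (chartAt (Euc n) p) (chartAt (Euc n) p p))⁻¹ i j *
      inner ℝ (pd i (pd j (y ∘ (chartAt (Euc n) p).symm)) (chartAt (Euc n) p p)) ν

/-! ### The tangential gradient on `M` -/

/-- The vector `hⁱʲ Wᵢ ∂ⱼ(e⁻¹)` of `ℝⁿ⁺¹`, tangential to `M`, where `h` is the induced metric. -/
def coordGradient {n : ℕ} {M : Set (Euc (n + 1))}
    (e : OpenPartialHomeomorph M (Euc n)) (W : Fin n → ℝ) (θ : Euc n) : Euc (n + 1) :=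
  ∑ i, ∑ j, ((pullbackMetric (incl M) e θ)⁻¹ i j * W i) • pd j (incl M ∘ e.symm) θ

/-- The tangential gradient `∇_M f` of `f : M → ℝ`. -/
def tangGrad {n : ℕ} {M : Set (Euc (n + 1))} [ChartedSpace (Euc n) M]
    (f : M → ℝ) (p : M) : Euc (n + 1) :=
  coordGradient (chartAt (Euc n) p)
    (fun i => pd i (f ∘ (chartAt (Euc n) p).symm) (chartAt (Euc n) p p)) (chartAt (Euc n) p p)

/-- The differential of `y` at `p` in the chart at `p`. -/
theorem mfderiv_eq {n : ℕ} {M : Set (Euc (n + 1))} [ChartedSpace (Euc n) M]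
    {y : M → Euc (n + 1)} {p : M} (hy : MDifferentiableAt (𝓡 n) 𝓘(ℝ, Euc (n + 1)) y p)
    (w : Euc n) :
    (show Euc (n + 1) from mfderiv (𝓡 n) 𝓘(ℝ, Euc (n + 1)) y p w) =
      fderiv ℝ (y ∘ (chartAt (Euc n) p).symm) (chartAt (Euc n) p p) w := by
  have h := hy.hasMFDerivAt.2
  have h1 : range (𝓡 n) = univ := by simp
  rw [h1] at h
  replace h : HasFDerivAt (y ∘ (chartAt (Euc n) p).symm)
      (show Euc n →L[ℝ] Euc (n + 1) from mfderiv (𝓡 n) 𝓘(ℝ, Euc (n + 1)) y p)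
      (chartAt (Euc n) p p) := hasFDerivWithinAt_univ.1 h
  have h2 : fderiv ℝ (y ∘ (chartAt (Euc n) p).symm) (chartAt (Euc n) p p) =
    mfderiv (𝓡 n) 𝓘(ℝ, Euc (n + 1)) y p := h.fderiv
  exact (congrArg (fun A : Euc n →L[ℝ] Euc (n + 1) => A w) h2).symm

/-- Agreement with the definition through the ambient space: `∇_M f = ∇F - (μ · ∇F) μ` for every
differentiable extension `F` of `f` near `p`. -/
theorem tangGrad_eq_of_extension {n : ℕ} {M : Set (Euc (n + 1))} [ChartedSpace (Euc n) M]
    [IsManifold (𝓡 n) ∞ M] (hM : IsEmbeddingOfClass ∞ (incl M)) {p : M} {μ : Euc (n + 1)}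
    (hμ : IsUnitNormalAt (incl M) p μ) {f : M → ℝ} {F : Euc (n + 1) → ℝ}
    (hF : DifferentiableAt ℝ F p) (hf : ∀ᶠ q : M in nhds p, F q = f q) :
    tangGrad f p = gradient F p - inner ℝ μ (gradient F p) • μ := by
  have hmd : MDifferentiableAt (𝓡 n) 𝓘(ℝ, Euc (n + 1)) (incl M) p :=
    (hM.contMDiff p).mdifferentiableAt (by simp)
  set e := chartAt (Euc n) p with he
  have hp : p ∈ e.source := mem_chart_source _ p
  set θ := e p with hθ
  have hsymm : e.symm θ = p := e.left_inv hp
  have hφd : DifferentiableAt ℝ (incl M ∘ e.symm) θ := by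
    have := hmd.differentiableWithinAt_writtenInExtChartAt
    have h1 : range (𝓡 n) = univ := by simp
    rw [h1, differentiableWithinAt_univ] at this
    exact this
  set b : Fin n → Euc (n + 1) := fun j => pd j (incl M ∘ e.symm) θ with hb
  set L := fderiv ℝ (incl M ∘ e.symm) θ with hL
  have hLinj : Function.Injective L := by
    intro v w hvw
    refine hM.immersion p ?_
    have h1 := mfderiv_eq hmd v
    have h2 := mfderiv_eq hmd w
    exact h1.trans (hvw.trans h2.symm)
  have hbL : ∀ j, b j = L (EuclideanSpace.single j 1) := fun j => rfl
  have hli : LinearIndependent ℝ b := by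
    have h0 := (EuclideanSpace.basisFun (Fin n) ℝ).toBasis.linearIndependent
    have h1 := h0.map' (L : Euc n →ₗ[ℝ] Euc (n + 1)) (LinearMap.ker_eq_bot.2 hLinj)
    have h2 : b = (L : Euc n →ₗ[ℝ] Euc (n + 1)) ∘
        (EuclideanSpace.basisFun (Fin n) ℝ).toBasis := by
      funext j
      simp [hbL]
    rw [h2]
    exact h1
  have hμb : ∀ j, inner ℝ μ (b j) = 0 := by
    intro j
    have h1 := hμ.2 (EuclideanSpace.single j 1)
    rw [mfderiv_eq hmd] at h1
    exact h1
  have hμμ : inner ℝ μ μ = 1 := by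
    rw [real_inner_self_eq_norm_sq, hμ.1]; norm_num
  -- derivatives of the function
  have hdf : ∀ i, pd i (f ∘ e.symm) θ = inner ℝ (b i) (gradient F p) := by
    intro i
    have hev : (f ∘ e.symm) =ᶠ[nhds θ] F ∘ (incl M ∘ e.symm) := by
      have hc : Filter.Tendsto e.symm (nhds θ) (nhds p) := by
        have := e.continuousAt_symm (e.map_source hp)
        rw [ContinuousAt, hsymm] at this
        exact this
      filter_upwards [hc.eventually hf] with ϑ h
      exact h.symm
    have hFd : DifferentiableAt ℝ F ((incl M ∘ e.symm) θ) := by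
      simpa [incl, hsymm] using hF
    rw [pd, hev.fderiv_eq, fderiv_comp θ hFd hφd, hbL, real_inner_comm]
    simp only [gradient, InnerProductSpace.toDual_symm_apply, ContinuousLinearMap.comp_apply]
    simp [incl, hsymm, hL]
  set w := gradient F p with hw
  set g := pullbackMetric (incl M) e θ with hg
  have hgb : ∀ i j, g i j = inner ℝ (b i) (b j) := fun i j => rfl
  have hgram : g = Matrix.gram ℝ b := by ext i j; simp [hgb, Matrix.gram]
  have hpd : g.PosDef := by
    rw [hgram]; exact Matrix.posDef_gram_iff_linearIndependent.2 hli
  have hinv : g⁻¹ * g = 1 := Matrix.nonsing_inv_mul _ (Matrix.isUnit_iff_isUnit_det _ |>.1 hpd.isUnit)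
  have htg : tangGrad f p = ∑ i, ∑ j, (g⁻¹ i j * inner ℝ (b i) w) • b j := by
    simp only [tangGrad, coordGradient]
    simp only [← he, ← hθ, hdf]
    rfl
  have hgT : (g⁻¹)ᵀ = g⁻¹ := by
    have : gᵀ = g := by ext i j; simp [hgb, real_inner_comm]
    rw [Matrix.transpose_nonsing_inv, this]
  -- orthogonality
  set u := w - inner ℝ μ w • μ - tangGrad f p with hu
  have htμ : inner ℝ μ (tangGrad f p) = 0 := by
    rw [htg]; simp [inner_sum, inner_smul_right, hμb]
  have huμ : inner ℝ μ u = 0 := by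
    rw [hu, inner_sub_right, inner_sub_right, inner_smul_right, htμ, hμμ]
    ring
  have hub : ∀ k, inner ℝ (b k) u = 0 := by
    intro k
    have h1 : inner ℝ (b k) (tangGrad f p) = inner ℝ (b k) w := by
      rw [htg]
      simp only [inner_sum, inner_smul_right, ← hgb]
      have h2 : ∀ i, ∑ j, g⁻¹ i j * inner ℝ (b i) w * g k j =
          (1 : Matrix (Fin n) (Fin n) ℝ) i k * inner ℝ (b i) w := by
        intro i
        rw [← hinv, Matrix.mul_apply, Finset.sum_mul]
        refine Finset.sum_congr rfl fun j _ => ?_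
        rw [hgb k j, hgb j k, real_inner_comm (b j) (b k)]; ring
      simp [h2, Matrix.one_apply]
    rw [hu, inner_sub_right, inner_sub_right, inner_smul_right, h1, real_inner_comm μ (b k), hμb]
    simp
  -- the vectors `b` and `μ` span
  have hli' : LinearIndependent ℝ (Fin.cons μ b : Fin (n + 1) → Euc (n + 1)) := by
    rw [linearIndependent_finCons]
    refine ⟨hli, fun hmem => ?_⟩
    have : inner ℝ μ μ = 0 := by
      refine Submodule.span_induction (p := fun z _ => inner ℝ μ z = 0) ?_ ?_ ?_ ?_ hmem
      · rintro _ ⟨j, rfl⟩; exact hμb j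
      · simp
      · intro a c _ _ ha hc; rw [inner_add_right, ha, hc, add_zero]
      · intro r a _ ha; rw [inner_smul_right, ha, mul_zero]
    rw [hμμ] at this
    exact one_ne_zero this
  have hspan := hli'.span_eq_top_of_card_eq_finrank' (by simp)
  have hu0 : inner ℝ u u = 0 := by
    have hmem : u ∈ Submodule.span ℝ (Set.range (Fin.cons μ b : Fin (n + 1) → Euc (n + 1))) := by
      rw [hspan]; trivial
    refine Submodule.span_induction (p := fun z _ => inner ℝ z u = 0) ?_ ?_ ?_ ?_ hmem
    · rintro _ ⟨j, rfl⟩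
      refine Fin.cases ?_ (fun k => ?_) j
      · simpa using huμ
      · simpa using hub k
    · simp
    · intro a c _ _ ha hc; rw [inner_add_left, ha, hc, add_zero]
    · intro r a _ ha; rw [inner_smul_left, ha, mul_zero]
  have : u = 0 := inner_self_eq_zero.1 hu0
  exact (sub_eq_zero.1 this).symm

/-- The matrix `∇_M f` of a map `f : M → ℝⁿ⁺¹`; the row `κ` is the tangential gradient of the
component `f_κ`, so that the entry `(κ, β)` is `D_β f_κ`. -/
def tangJac {n : ℕ} {M : Set (Euc (n + 1))} [ChartedSpace (Euc n) M]
    (f : M → Euc (n + 1)) (p : M) : Matrix (Fin (n + 1)) (Fin (n + 1)) ℝ :=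
  Matrix.of fun κ β => tangGrad (fun q => f q κ) p β

/-- `Ĝ = (∇_M y)ᵀ ∇_M y + μ ⊗ μ`. -/
def metricRep {n : ℕ} {M : Set (Euc (n + 1))} [ChartedSpace (Euc n) M]
    (μ y : M → Euc (n + 1)) (p : M) : Matrix (Fin (n + 1)) (Fin (n + 1)) ℝ :=
  (tangJac y p)ᵀ * tangJac y p + Matrix.vecMulVec (μ p).ofLp (μ p).ofLp

/-- `A J : K`, that is `A^{βγ} D_β f · D_γ w` for `J = ∇_M f` and `K = ∇_M w`. -/
def contract {d : ℕ} (A J K : Matrix (Fin d) (Fin d) ℝ) : ℝ :=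
  ∑ β, ∑ γ, A β γ * ∑ κ, J κ β * K κ γ

/-! ### Integration over `M` and the Sobolev space `H^{1,2}(M, ℝⁿ⁺¹)` -/

/-- A smooth partition of unity subordinate to the family of charts `chartAt p`, `p ∈ M`. -/
def chartPartition {n : ℕ} (M : Set (Euc (n + 1))) [ChartedSpace (Euc n) M]
    [IsManifold (𝓡 n) ∞ M] [CompactSpace M] : SmoothPartitionOfUnity M (𝓡 n) M univ :=
  (SmoothPartitionOfUnity.exists_isSubordinate_chartAt_source (𝓡 n) M).choose

/-- The Riemannian measure `do_g` of `g = y^* 𝔢` on `M`: in a chart it is `√det(gᵢⱼ) dθ`, and these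
local measures are put together by a partition of unity. -/
def riemannianMeasure {n : ℕ} {M : Set (Euc (n + 1))} [ChartedSpace (Euc n) M]
    [IsManifold (𝓡 n) ∞ M] [CompactSpace M] (y : M → Euc (n + 1)) : Measure M :=
  Measure.sum fun a : M =>
    (((volume : Measure (Euc n)).restrict (chartAt (Euc n) a).target).withDensity fun θ =>
      ENNReal.ofReal (chartPartition M a ((chartAt (Euc n) a).symm θ) *
        √(pullbackMetric y (chartAt (Euc n) a) θ).det)).map (chartAt (Euc n) a).symm

/-- The measure `do_h` of the metric `h` induced on `M` by `ℝⁿ⁺¹`. -/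
def surfaceMeasure {n : ℕ} (M : Set (Euc (n + 1))) [ChartedSpace (Euc n) M]
    [IsManifold (𝓡 n) ∞ M] [CompactSpace M] : Measure M :=
  riemannianMeasure (incl M)

/-- `χ ∈ H^{1,2}(M, ℝⁿ⁺¹)` with weak tangential gradient `∇_M χ = Dχ`: both are square integrable,
and in every chart `D χ_κ = hⁱʲ (∂ᵢ χ_κ) ∂ⱼ(e⁻¹)` holds with weak partial derivatives. -/
structure IsSobolevH12 {n : ℕ} {M : Set (Euc (n + 1))} [ChartedSpace (Euc n) M]
    [IsManifold (𝓡 n) ∞ M] [CompactSpace M] (χ : M → Euc (n + 1))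
    (Dχ : M → Matrix (Fin (n + 1)) (Fin (n + 1)) ℝ) : Prop where
  memLp : MemLp χ 2 (surfaceMeasure M)
  memLp_grad : ∀ κ β, MemLp (fun p => Dχ p κ β) 2 (surfaceMeasure M)
  weak : ∀ e ∈ atlas (Euc n) M, ∀ κ, ∃ W : Fin n → Euc n → ℝ,
    (∀ i, IsWeakPartial e.target i (fun θ => χ (e.symm θ) κ) (W i)) ∧
    ∀ᵐ θ ∂(volume : Measure (Euc n)).restrict e.target, ∀ β,
      Dχ (e.symm θ) κ β = coordGradient e (fun i => W i θ) θ β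

/-! ### The flows -/

/-- `x : M × [0,T) → ℝⁿ⁺¹` is a time-dependent embedding that evolves by mean curvature,
`∂ₜ x = -(H ν) ∘ x` with `x(·,0) = x₀`. Here `ν t` is a unit normal field to `Γ(t) = x(M,t)`; the
product `H ν` does not depend on its choice. -/
structure IsMeanCurvatureFlow {n : ℕ} {M : Set (Euc (n + 1))} [ChartedSpace (Euc n) M] (T : ℝ)
    (x₀ : M → Euc (n + 1)) (x : ℝ → M → Euc (n + 1)) (ν : ℝ → Euc (n + 1) → Euc (n + 1)) :
    Prop where
  embedding : ∀ t ∈ Ico 0 T, IsEmbeddingOfClass 2 (x t)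
  continuousOn : ContinuousOn (fun z : ℝ × M => x z.1 z.2) (Ico 0 T ×ˢ univ)
  contMDiffOn : ContMDiffOn (𝓘(ℝ, ℝ).prod (𝓡 n)) 𝓘(ℝ, Euc (n + 1)) 1
    (fun z : ℝ × M => x z.1 z.2) (Ioo 0 T ×ˢ univ)
  normal : ∀ t ∈ Ico 0 T, ∀ p, IsUnitNormalAt (x t) p (ν t (x t p))
  initial : x 0 = x₀
  evolution : ∀ t ∈ Ioo 0 T, ∀ p,
    HasDerivAt (fun s => x s p)
      (-(meanCurvature (x t) (ν t (x t p)) p • ν t (x t p))) t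

/-- The diffeomorphisms `ψ(t) : M → M`, `t ∈ [0,T)`, evolve by the harmonic map heat flow
`∂ₜ ψ = (1/α) Δ_{g(t),h} ψ` with `ψ(·,0) = id`, where `g(t) = x(t)^* 𝔢` and `h` is the metric
induced on `M` by `ℝⁿ⁺¹`. The equation at `(p,t)` is written in the charts at `p` and `ψ(p,t)`. -/
structure IsHarmonicMapHeatFlow {n : ℕ} {M : Set (Euc (n + 1))} [ChartedSpace (Euc n) M] (T α : ℝ)
    (x : ℝ → M → Euc (n + 1)) (ψ : ℝ → Diffeomorph (𝓡 n) (𝓡 n) M M 2) : Prop where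
  continuousOn : ContinuousOn (fun z : ℝ × M => ψ z.1 z.2) (Ico 0 T ×ˢ univ)
  contMDiffOn : ContMDiffOn (𝓘(ℝ, ℝ).prod (𝓡 n)) (𝓡 n) 1
    (fun z : ℝ × M => ψ z.1 z.2) (Ioo 0 T ×ˢ univ)
  initial : ∀ p, ψ 0 p = p
  evolution : ∀ t ∈ Ioo 0 T, ∀ p,
    HasDerivAt (fun s => chartAt (Euc n) (ψ t p) (ψ s p))
      ((1 / α) • mapLaplacian (x t) (ψ t) p) t

/-- The mean curvature-DeTurck flow `x̂(t) = x(t) ∘ ψ(t)⁻¹`. -/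
def deTurckFlow {n : ℕ} {M : Set (Euc (n + 1))} [ChartedSpace (Euc n) M]
    (x : ℝ → M → Euc (n + 1)) (ψ : ℝ → Diffeomorph (𝓡 n) (𝓡 n) M M 2) (t : ℝ) :
    M → Euc (n + 1) :=
  fun p => x t ((ψ t).symm p)

end

end DeTurck

open DeTurck

section

open Filter Topology

namespace DeTurck

noncomputable section

/-! ### Partial derivatives -/

section Calculus

variable {n m : ℕ} {V : Type*} [NormedAddCommGroup V] [NormedSpace ℝ V]

theorem pd_congr {F G : Euc n → V} {θ : Euc n} (h : F =ᶠ[𝓝 θ] G) (i : Fin n) :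
    pd i F θ = pd i G θ := by
  rw [pd, pd, h.fderiv_eq]

theorem pd_eventuallyEq {F G : Euc n → V} {θ : Euc n} (h : F =ᶠ[𝓝 θ] G) (i : Fin n) :
    pd i F =ᶠ[𝓝 θ] pd i G := by
  filter_upwards [h.eventuallyEq_nhds] with ϑ hϑ using pd_congr hϑ i

theorem ContDiffAt.pd {k l : WithTop ℕ∞} {F : Euc n → V} {θ : Euc n} (h : ContDiffAt ℝ l F θ)
    (hk : k + 1 ≤ l) (i : Fin n) : ContDiffAt ℝ k (pd i F) θ :=
  (h.fderiv_right hk).clm_apply contDiffAt_const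

theorem ContDiffOn.pd {k l : WithTop ℕ∞} {F : Euc n → V} {s : Set (Euc n)} (hs : IsOpen s)
    (h : ContDiffOn ℝ l F s) (hk : k + 1 ≤ l) (i : Fin n) : ContDiffOn ℝ k (pd i F) s :=
  fun _ hθ => (ContDiffAt.pd (h.contDiffAt (hs.mem_nhds hθ)) hk i).contDiffWithinAt

theorem sum_smul_single (w : Euc n) :
    ∑ i, w i • (EuclideanSpace.single i 1 : Euc n) = w := by
  ext j
  simp [Finset.sum_apply, Pi.single_apply]

theorem fderiv_eq_sum_pd (F : Euc n → V) (θ w : Euc n) :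
    fderiv ℝ F θ w = ∑ i, w i • pd i F θ := by
  conv_lhs => rw [← sum_smul_single w]
  simp [pd]

theorem pd_apply {F : Euc n → Euc m} {θ : Euc n} (hF : DifferentiableAt ℝ F θ) (i : Fin n)
    (a : Fin m) : pd i (fun ϑ => F ϑ a) θ = pd i F θ a := by
  have h : HasFDerivAt (fun ϑ => F ϑ a)
      ((EuclideanSpace.proj a : Euc m →L[ℝ] ℝ).comp (fderiv ℝ F θ)) θ :=
    (EuclideanSpace.proj a : Euc m →L[ℝ] ℝ).hasFDerivAt.comp θ hF.hasFDerivAt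
  rw [pd, h.fderiv]
  rfl

theorem pd_sum {ι : Type*} (s : Finset ι) {F : ι → Euc n → V} {θ : Euc n}
    (hF : ∀ a ∈ s, DifferentiableAt ℝ (F a) θ) (i : Fin n) :
    pd i (fun ϑ => ∑ a ∈ s, F a ϑ) θ = ∑ a ∈ s, pd i (F a) θ := by
  rw [pd, fderiv_fun_sum hF]
  simp [pd]

theorem pd_smul {c : Euc n → ℝ} {F : Euc n → V} {θ : Euc n} (hc : DifferentiableAt ℝ c θ)
    (hF : DifferentiableAt ℝ F θ) (i : Fin n) :
    pd i (fun ϑ => c ϑ • F ϑ) θ = c θ • pd i F θ + pd i c θ • F θ := by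
  rw [pd, fderiv_fun_smul hc hF]
  simp [pd]

theorem pd_mul {c d : Euc n → ℝ} {θ : Euc n} (hc : DifferentiableAt ℝ c θ)
    (hd : DifferentiableAt ℝ d θ) (i : Fin n) :
    pd i (fun ϑ => c ϑ * d ϑ) θ = c θ * pd i d θ + pd i c θ * d θ := by
  rw [pd, fderiv_fun_mul hc hd]
  simp [pd, mul_comm]

theorem pd_inner {F G : Euc n → Euc m} {θ : Euc n} (hF : DifferentiableAt ℝ F θ)
    (hG : DifferentiableAt ℝ G θ) (i : Fin n) :
    pd i (fun ϑ => inner ℝ (F ϑ) (G ϑ)) θ =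
      inner ℝ (F θ) (pd i G θ) + inner ℝ (pd i F θ) (G θ) := by
  rw [pd, fderiv_inner_apply ℝ hF hG]
  rfl

theorem pd_comp {F : Euc m → V} {Ψ : Euc n → Euc m} {θ : Euc n}
    (hF : DifferentiableAt ℝ F (Ψ θ)) (hΨ : DifferentiableAt ℝ Ψ θ) (i : Fin n) :
    pd i (F ∘ Ψ) θ = ∑ a, pd i Ψ θ a • pd a F (Ψ θ) := by
  rw [pd, fderiv_comp θ hF hΨ, ContinuousLinearMap.comp_apply, fderiv_eq_sum_pd]
  rfl

theorem pd_comm {F : Euc n → V} {θ : Euc n} (hF : ContDiffAt ℝ 2 F θ) (i j : Fin n) :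
    pd i (pd j F) θ = pd j (pd i F) θ := by
  have hd : DifferentiableAt ℝ (fderiv ℝ F) θ :=
    (hF.fderiv_right (m := 1) (by norm_num)).differentiableAt (by simp)
  have h : ∀ a b : Fin n, pd a (pd b F) θ =
      fderiv ℝ (fderiv ℝ F) θ (EuclideanSpace.single a 1) (EuclideanSpace.single b 1) := by
    intro a b
    have : pd b F = fun ϑ => fderiv ℝ F ϑ (EuclideanSpace.single b 1) := rfl
    rw [pd, this, fderiv_clm_apply hd (differentiableAt_const _)]
    simp
  rw [h, h]
  exact (hF.isSymmSndFDerivAt (by simp)).eq _ _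

theorem pd_pd_comp {F : Euc m → V} {Ψ : Euc n → Euc m} {θ : Euc n}
    (hF : ContDiffAt ℝ 2 F (Ψ θ)) (hΨ : ContDiffAt ℝ 2 Ψ θ) (i j : Fin n) :
    pd i (pd j (F ∘ Ψ)) θ =
      ∑ a, ∑ b, (pd i Ψ θ a * pd j Ψ θ b) • pd a (pd b F) (Ψ θ) +
        ∑ a, pd i (pd j Ψ) θ a • pd a F (Ψ θ) := by
  have h1 : pd j (F ∘ Ψ) =ᶠ[𝓝 θ] fun ϑ => ∑ b, pd j Ψ ϑ b • (pd b F ∘ Ψ) ϑ := by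
    filter_upwards [hΨ.eventually (by simp),
      hΨ.continuousAt.eventually (hF.eventually (by simp))] with ϑ h1 h2
    exact pd_comp (h2.differentiableAt (by simp)) (h1.differentiableAt (by simp)) j
  have hpΨ : DifferentiableAt ℝ (pd j Ψ) θ :=
    (ContDiffAt.pd (k := 1) hΨ (by norm_num) j).differentiableAt (by simp)
  have hpF : ∀ b, DifferentiableAt ℝ (pd b F) (Ψ θ) := fun b =>
    (ContDiffAt.pd (k := 1) hF (by norm_num) b).differentiableAt (by simp)
  have hΨd : DifferentiableAt ℝ Ψ θ := hΨ.differentiableAt (by simp)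
  have hc : ∀ b, DifferentiableAt ℝ (fun ϑ => pd j Ψ ϑ b) θ := fun b =>
    (EuclideanSpace.proj b : Euc m →L[ℝ] ℝ).differentiableAt.comp θ hpΨ
  rw [pd_congr h1, pd_sum (F := fun b ϑ => pd j Ψ ϑ b • (pd b F ∘ Ψ) ϑ) _
    (fun b _ => (hc b).smul ((hpF b).comp θ hΨd))]
  have h2 : ∀ b, pd i (fun ϑ => pd j Ψ ϑ b • (pd b F ∘ Ψ) ϑ) θ =
      (∑ a, (pd i Ψ θ a * pd j Ψ θ b) • pd a (pd b F) (Ψ θ)) +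
        pd i (pd j Ψ) θ b • pd b F (Ψ θ) := by
    intro b
    rw [pd_smul (hc b) ((hpF b).comp θ hΨd) i, pd_comp (hpF b) hΨd, pd_apply hpΨ,
      Finset.smul_sum]
    simp only [smul_smul, mul_comm (pd j Ψ θ b), Function.comp]
  rw [Finset.sum_congr rfl fun b _ => h2 b, Finset.sum_add_distrib, Finset.sum_comm]

end Calculus

/-! ### The metric induced by an immersion of a coordinate domain -/

section Gram

variable {n m : ℕ} {V : Type*} [NormedAddCommGroup V] [NormedSpace ℝ V]

/-- The components `∂ᵢ Y · ∂ⱼ Y` of the metric induced by `Y`. -/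
def gramMetric (Y : Euc n → Euc m) (θ : Euc n) : Matrix (Fin n) (Fin n) ℝ :=
  Matrix.of fun i j => inner ℝ (pd i Y θ) (pd j Y θ)

theorem gramMetric_apply (Y : Euc n → Euc m) (θ : Euc n) (i j : Fin n) :
    gramMetric Y θ i j = inner ℝ (pd i Y θ) (pd j Y θ) := rfl

theorem gramMetric_comm (Y : Euc n → Euc m) (θ : Euc n) (i j : Fin n) :
    gramMetric Y θ i j = gramMetric Y θ j i := by
  rw [gramMetric_apply, gramMetric_apply, real_inner_comm]

theorem gramMetric_transpose (Y : Euc n → Euc m) (θ : Euc n) :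
    (gramMetric Y θ)ᵀ = gramMetric Y θ := by
  ext i j; exact gramMetric_comm Y θ j i

theorem gramMetric_inv_comm (Y : Euc n → Euc m) (θ : Euc n) (i j : Fin n) :
    (gramMetric Y θ)⁻¹ i j = (gramMetric Y θ)⁻¹ j i := by
  conv_lhs => rw [← gramMetric_transpose, ← Matrix.transpose_nonsing_inv, Matrix.transpose_apply]

theorem linearIndependent_pd {Y : Euc n → V} {θ : Euc n}
    (hY : Function.Injective (fderiv ℝ Y θ)) : LinearIndependent ℝ fun i => pd i Y θ := by
  have h1 := (EuclideanSpace.basisFun (Fin n) ℝ).toBasis.linearIndependent.map'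
    (fderiv ℝ Y θ : Euc n →ₗ[ℝ] V) (LinearMap.ker_eq_bot.2 hY)
  have h2 : (fun i => pd i Y θ) = (fderiv ℝ Y θ : Euc n →ₗ[ℝ] V) ∘
      (EuclideanSpace.basisFun (Fin n) ℝ).toBasis := by
    funext j
    simp [pd]
  rw [h2]
  exact h1

theorem posDef_gramMetric {Y : Euc n → Euc m} {θ : Euc n}
    (hY : Function.Injective (fderiv ℝ Y θ)) : (gramMetric Y θ).PosDef :=
  Matrix.posDef_gram_iff_linearIndependent.2 (linearIndependent_pd hY)

theorem isUnit_det_gramMetric {Y : Euc n → Euc m} {θ : Euc n}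
    (hY : Function.Injective (fderiv ℝ Y θ)) : IsUnit (gramMetric Y θ).det :=
  (posDef_gramMetric hY).det_pos.ne'.isUnit

theorem ContDiffAt.gramMetric {k l : WithTop ℕ∞} {Y : Euc n → Euc m} {θ : Euc n}
    (hY : ContDiffAt ℝ l Y θ) (hk : k + 1 ≤ l) (i j : Fin n) :
    ContDiffAt ℝ k (fun ϑ => gramMetric Y ϑ i j) θ :=
  (ContDiffAt.pd hY hk i).inner ℝ (ContDiffAt.pd hY hk j)

/-- Each of the three metric derivatives splits into two terms. By symmetry of second derivatives
four of the six cancel and the other two coincide, absorbing the factor ½. The Christoffel symbols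
thus become the tangential components of ∂ᵢ∂ⱼY, so that their properties follow by projecting the
chain rule. -/
theorem christoffel_gramMetric {Y : Euc n → Euc m} {θ : Euc n} (hY : ContDiffAt ℝ 2 Y θ)
    (k i j : Fin n) :
    christoffel (gramMetric Y) θ k i j =
      ∑ l, (gramMetric Y θ)⁻¹ k l * inner ℝ (pd i (pd j Y) θ) (pd l Y θ) := by
  have hd : ∀ a, DifferentiableAt ℝ (pd a Y) θ := fun a =>
    (ContDiffAt.pd (k := 1) hY (by norm_num) a).differentiableAt (by simp)
  rw [christoffel, Finset.mul_sum]
  refine Finset.sum_congr rfl fun l _ => ?_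
  simp only [gramMetric_apply]
  rw [pd_inner (hd l) (hd j), pd_inner (hd l) (hd i), pd_inner (hd i) (hd j),
    pd_comm hY i l, pd_comm hY j l, pd_comm hY j i, real_inner_comm (pd l Y θ),
    real_inner_comm (pd i Y θ) (pd l (pd j Y) θ)]
  ring

/-- The Jacobian matrix of `Ψ`. -/
def jacobian (Ψ : Euc n → Euc m) (θ : Euc n) : Matrix (Fin m) (Fin n) ℝ :=
  Matrix.of fun a i => pd i Ψ θ a

theorem jacobian_apply (Ψ : Euc n → Euc m) (θ : Euc n) (a : Fin m) (i : Fin n) :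
    jacobian Ψ θ a i = pd i Ψ θ a := rfl

theorem gramMetric_comp {k : ℕ} {Y : Euc n → Euc m} {Z : Euc k → Euc m} {Ψ : Euc n → Euc k}
    {θ : Euc n} (h : Y =ᶠ[𝓝 θ] Z ∘ Ψ) (hZ : DifferentiableAt ℝ Z (Ψ θ))
    (hΨ : DifferentiableAt ℝ Ψ θ) :
    gramMetric Y θ = (jacobian Ψ θ)ᵀ * gramMetric Z (Ψ θ) * jacobian Ψ θ := by
  ext i j
  rw [gramMetric_apply, pd_congr h, pd_congr h, pd_comp hZ hΨ, pd_comp hZ hΨ]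
  simp only [Matrix.mul_apply, Matrix.transpose_apply, jacobian_apply, gramMetric_apply,
    sum_inner, inner_sum, inner_smul_left, inner_smul_right, Finset.sum_mul, Finset.mul_sum]
  refine Finset.sum_congr rfl fun a _ => Finset.sum_congr rfl fun b _ => ?_
  simp only [conj_trivial]
  ring

/-- A kernel vector of DΨ would also be a kernel vector of DY = DZ ∘ DΨ. -/
theorem isUnit_det_jacobian {Y : Euc n → V} {Z : Euc n → V} {Ψ : Euc n → Euc n}
    {θ : Euc n} (h : Y =ᶠ[𝓝 θ] Z ∘ Ψ) (hZ : DifferentiableAt ℝ Z (Ψ θ))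
    (hΨ : DifferentiableAt ℝ Ψ θ) (hY : Function.Injective (fderiv ℝ Y θ)) :
    IsUnit (jacobian Ψ θ).det := by
  rw [isUnit_iff_ne_zero]
  intro h0
  obtain ⟨w, hw, hw0⟩ := Matrix.exists_mulVec_eq_zero_iff.2 h0
  have h1 : fderiv ℝ Ψ θ (WithLp.toLp 2 w) = 0 := by
    rw [fderiv_eq_sum_pd]
    ext a
    have := congrFun hw0 a
    simp only [Matrix.mulVec, dotProduct, jacobian_apply] at this
    simpa [Finset.sum_apply, mul_comm] using this
  have h2 : fderiv ℝ Y θ (WithLp.toLp 2 w) = 0 := by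
    rw [h.fderiv_eq, fderiv_comp θ hZ hΨ, ContinuousLinearMap.comp_apply, h1, map_zero]
  have h3 := hY (h2.trans (map_zero _).symm)
  exact hw (by simpa using congrArg WithLp.ofLp h3)

end Gram
end

end DeTurck

namespace DeTurck

noncomputable section

/-! ### Behaviour of the Laplace operators under a change of the parametrization -/

section Transformation

variable {n m : ℕ} {V : Type*} [NormedAddCommGroup V] [NormedSpace ℝ V]

theorem inv_conj_transpose {B g : Matrix (Fin n) (Fin n) ℝ} (hB : IsUnit B.det) :
    B * (Bᵀ * g * B)⁻¹ * Bᵀ = g⁻¹ := by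
  have hBT : IsUnit Bᵀ.det := by rwa [Matrix.det_transpose]
  rw [Matrix.mul_inv_rev, Matrix.mul_inv_rev, ← Matrix.mul_assoc B, Matrix.mul_nonsing_inv _ hB,
    Matrix.one_mul, Matrix.mul_assoc, Matrix.nonsing_inv_mul _ hBT, Matrix.mul_one]

/-- The trace of a bilinear form with respect to a metric does not depend on the coordinates. It
serves for the Laplacian, the map Laplacian and the tangential gradient alike. -/
theorem sum_inv_smul_conj {B g : Matrix (Fin n) (Fin n) ℝ} (hB : IsUnit B.det)
    (S : Fin n → Fin n → V) :
    ∑ i, ∑ j, (Bᵀ * g * B)⁻¹ i j • ∑ a, ∑ b, (B a i * B b j) • S a b =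
      ∑ a, ∑ b, g⁻¹ a b • S a b := by
  have h : ∀ a b, g⁻¹ a b = ∑ i, ∑ j, (Bᵀ * g * B)⁻¹ i j * (B a i * B b j) := by
    intro a b
    conv_lhs => rw [← inv_conj_transpose (g := g) hB]
    simp only [Matrix.mul_apply (M := B * _), Matrix.mul_apply (M := B), Matrix.transpose_apply,
      Finset.sum_mul]
    rw [Finset.sum_comm]
    refine Finset.sum_congr rfl fun i _ => Finset.sum_congr rfl fun j _ => by ring
  simp only [h, Finset.smul_sum, Finset.sum_smul, smul_smul]
  have e1 : ∀ i, ∑ j, ∑ a, ∑ b, ((Bᵀ * g * B)⁻¹ i j * (B a i * B b j)) • S a b =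
      ∑ a, ∑ b, ∑ j, ((Bᵀ * g * B)⁻¹ i j * (B a i * B b j)) • S a b := fun i => by
    rw [Finset.sum_comm]
    exact Finset.sum_congr rfl fun a _ => Finset.sum_comm
  rw [Finset.sum_congr rfl fun i _ => e1 i, Finset.sum_comm]
  exact Finset.sum_congr rfl fun a _ => Finset.sum_comm

/-- The transformation law of the Christoffel symbols. -/
theorem sum_jacobian_mul_christoffel {Y Z : Euc n → Euc m} {Ψ : Euc n → Euc n}
    {θ : Euc n} (h : Y =ᶠ[𝓝 θ] Z ∘ Ψ) (hZ : ContDiffAt ℝ 2 Z (Ψ θ)) (hΨ : ContDiffAt ℝ 2 Ψ θ)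
    (hY : Function.Injective (fderiv ℝ Y θ)) (hZ' : Function.Injective (fderiv ℝ Z (Ψ θ)))
    (c i j : Fin n) :
    ∑ k, jacobian Ψ θ c k * christoffel (gramMetric Y) θ k i j =
      ∑ a, ∑ b, jacobian Ψ θ a i * jacobian Ψ θ b j * christoffel (gramMetric Z) (Ψ θ) c a b +
        pd i (pd j Ψ) θ c := by
  have hZd : DifferentiableAt ℝ Z (Ψ θ) := hZ.differentiableAt (by simp)
  have hΨd : DifferentiableAt ℝ Ψ θ := hΨ.differentiableAt (by simp)
  have hYc : ContDiffAt ℝ 2 Y θ := (hZ.comp θ hΨ).congr_of_eventuallyEq h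
  have hB := isUnit_det_jacobian h hZd hΨd hY
  have hg := gramMetric_comp h hZd hΨd
  set B := jacobian Ψ θ with hBdef
  set g := gramMetric Y θ with hgdef
  set k := gramMetric Z (Ψ θ) with hkdef
  have hinv : B * g⁻¹ * Bᵀ = k⁻¹ := by rw [hg]; exact inv_conj_transpose hB
  have hkk : k⁻¹ * k = 1 := Matrix.nonsing_inv_mul _ (isUnit_det_gramMetric hZ')
  have h1 : ∀ l, pd l Y θ = ∑ d, B d l • pd d Z (Ψ θ) := fun l => by
    rw [pd_congr h, pd_comp hZd hΨd]; rfl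
  have h2 : pd i (pd j Y) θ = ∑ a, ∑ b, (B a i * B b j) • pd a (pd b Z) (Ψ θ) +
        ∑ a, pd i (pd j Ψ) θ a • pd a Z (Ψ θ) := by
    rw [pd_congr (pd_eventuallyEq h j), pd_pd_comp hZ hΨ]; rfl
  -- By B g⁻¹ Bᵀ = k⁻¹ the left side is the component of ∂ᵢ∂ⱼY along ∂_c Z. Inserting the
  -- second-order chain rule then yields the two terms of the law: ∂ₐ∂_b Z projects to its
  -- Christoffel symbol and ∂ₐZ to a Kronecker delta.
  have h3 : ∑ k, B c k * christoffel (gramMetric Y) θ k i j =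
      ∑ d, k⁻¹ c d * inner ℝ (pd i (pd j Y) θ) (pd d Z (Ψ θ)) := by
    simp only [christoffel_gramMetric hYc, ← hgdef]
    rw [← hinv]
    simp only [Matrix.mul_apply (M := B * _), Matrix.mul_apply (M := B), Matrix.transpose_apply,
      h1, inner_sum, inner_smul_right, Finset.mul_sum, Finset.sum_mul]
    calc _ = ∑ l, ∑ x, ∑ d, B c x * (g⁻¹ x l * (B d l * inner ℝ (pd i (pd j Y) θ) (pd d Z (Ψ θ)))) :=
          Finset.sum_comm
      _ = ∑ l, ∑ d, ∑ x, B c x * (g⁻¹ x l * (B d l * inner ℝ (pd i (pd j Y) θ) (pd d Z (Ψ θ)))) :=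
          Finset.sum_congr rfl fun l _ => Finset.sum_comm
      _ = ∑ d, ∑ l, ∑ x, B c x * (g⁻¹ x l * (B d l * inner ℝ (pd i (pd j Y) θ) (pd d Z (Ψ θ)))) :=
          Finset.sum_comm
      _ = _ := Finset.sum_congr rfl fun d _ => Finset.sum_congr rfl fun l _ =>
          Finset.sum_congr rfl fun x _ => by ring
  rw [h3]
  have h4 : ∀ e, ∑ d, k⁻¹ c d * inner ℝ (pd e Z (Ψ θ)) (pd d Z (Ψ θ)) =
      (1 : Matrix (Fin n) (Fin n) ℝ) c e := by
    intro e
    rw [← hkk, Matrix.mul_apply]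
    refine Finset.sum_congr rfl fun d _ => ?_
    rw [hkdef, gramMetric_comm, gramMetric_apply]
  simp only [h2, inner_add_left, mul_add, Finset.sum_add_distrib]
  congr 1
  · simp only [christoffel_gramMetric hZ, ← hkdef, sum_inner, inner_smul_left, Finset.mul_sum,
      conj_trivial]
    rw [Finset.sum_comm]
    refine Finset.sum_congr rfl fun a _ => ?_
    rw [Finset.sum_comm]
    refine Finset.sum_congr rfl fun b _ => Finset.sum_congr rfl fun d _ => by ring
  · simp only [sum_inner, inner_smul_left, Finset.mul_sum, conj_trivial]
    rw [Finset.sum_comm]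
    have : ∀ e, ∑ d, k⁻¹ c d * (pd i (pd j Ψ) θ e * inner ℝ (pd e Z (Ψ θ)) (pd d Z (Ψ θ))) =
        pd i (pd j Ψ) θ e * (1 : Matrix (Fin n) (Fin n) ℝ) c e := fun e => by
      rw [← h4, Finset.mul_sum]
      exact Finset.sum_congr rfl fun d _ => by ring
    simp [this, Matrix.one_apply]

/-- The covariant Hessian is a tensor: the second derivatives of Ψ produced by the chain rule cancel
those in the transformation law of the Christoffel symbols. Its trace is then invariant by
`sum_inv_smul_conj`. -/
theorem coordLaplacian_comp {Y Z : Euc n → Euc m} {Ψ : Euc n → Euc n} {F K : Euc n → V}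
    {θ : Euc n} (h : Y =ᶠ[𝓝 θ] Z ∘ Ψ) (hF : F =ᶠ[𝓝 θ] K ∘ Ψ)
    (hZ : ContDiffAt ℝ 2 Z (Ψ θ)) (hK : ContDiffAt ℝ 2 K (Ψ θ)) (hΨ : ContDiffAt ℝ 2 Ψ θ)
    (hY : Function.Injective (fderiv ℝ Y θ)) (hZ' : Function.Injective (fderiv ℝ Z (Ψ θ))) :
    coordLaplacian (gramMetric Y) F θ = coordLaplacian (gramMetric Z) K (Ψ θ) := by
  have hZd : DifferentiableAt ℝ Z (Ψ θ) := hZ.differentiableAt (by simp)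
  have hΨd : DifferentiableAt ℝ Ψ θ := hΨ.differentiableAt (by simp)
  have hB := isUnit_det_jacobian h hZd hΨd hY
  have hg := gramMetric_comp h hZd hΨd
  have key : ∀ i j, pd i (pd j F) θ - ∑ k, christoffel (gramMetric Y) θ k i j • pd k F θ =
      ∑ a, ∑ b, (jacobian Ψ θ a i * jacobian Ψ θ b j) •
        (pd a (pd b K) (Ψ θ) - ∑ c, christoffel (gramMetric Z) (Ψ θ) c a b • pd c K (Ψ θ)) := by
    intro i j
    have h1 : ∑ k, christoffel (gramMetric Y) θ k i j • pd k F θ =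
        ∑ c, (∑ k, jacobian Ψ θ c k * christoffel (gramMetric Y) θ k i j) • pd c K (Ψ θ) := by
      simp only [pd_congr hF, pd_comp (hK.differentiableAt (by simp)) hΨd, Finset.smul_sum,
        Finset.sum_smul, smul_smul]
      rw [Finset.sum_comm]
      refine Finset.sum_congr rfl fun c _ => Finset.sum_congr rfl fun k _ => ?_
      rw [mul_comm]; rfl
    rw [h1]
    simp only [sum_jacobian_mul_christoffel h hZ hΨ hY hZ', add_smul, Finset.sum_add_distrib]
    rw [pd_congr (pd_eventuallyEq hF j), pd_pd_comp hK hΨ, add_sub_add_right_eq_sub]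
    simp only [smul_sub, Finset.sum_sub_distrib, Finset.sum_smul, Finset.smul_sum, smul_smul]
    congr 1
    rw [Finset.sum_comm]
    exact Finset.sum_congr rfl fun a _ => Finset.sum_comm
  simp only [coordLaplacian, key]
  rw [hg]
  exact sum_inv_smul_conj hB _

/-- The map Laplacian of a reparametrization `Ψ` from the metric of `Z ∘ Ψ` to the metric of `I`
consists of the tangential components of the Laplacian of `I` for the metric of `Z`. -/
theorem coordMapLaplacian_apply {Y Z I : Euc n → Euc m} {Ψ : Euc n → Euc n}
    {θ : Euc n} (h : Y =ᶠ[𝓝 θ] Z ∘ Ψ) (hZ : ContDiffAt ℝ 2 Z (Ψ θ)) (hΨ : ContDiffAt ℝ 2 Ψ θ)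
    (hY : Function.Injective (fderiv ℝ Y θ)) (hZ' : Function.Injective (fderiv ℝ Z (Ψ θ)))
    (hI : ContDiffAt ℝ 2 I (Ψ θ)) (hI' : Function.Injective (fderiv ℝ I (Ψ θ))) (q : Fin n) :
    coordMapLaplacian (gramMetric Y) (gramMetric I) Ψ θ q =
      ∑ l, (gramMetric I (Ψ θ))⁻¹ q l *
        inner ℝ (coordLaplacian (gramMetric Z) I (Ψ θ)) (pd l I (Ψ θ)) := by
  have hZd : DifferentiableAt ℝ Z (Ψ θ) := hZ.differentiableAt (by simp)
  have hΨd : DifferentiableAt ℝ Ψ θ := hΨ.differentiableAt (by simp)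
  have hB := isUnit_det_jacobian h hZd hΨd hY
  have hg := gramMetric_comp h hZd hΨd
  have hcd : ∀ j, DifferentiableAt ℝ (pd j Ψ) θ := fun j =>
    (ContDiffAt.pd (k := 1) hΨ (by norm_num) j).differentiableAt (by simp)
  have hp1 : ∀ i q, pd i (fun ϑ => Ψ ϑ q) θ = jacobian Ψ θ q i := fun i q => pd_apply hΨd i q
  have hp2 : ∀ i j q, pd i (pd j fun ϑ => Ψ ϑ q) θ = pd i (pd j Ψ) θ q := fun i j q => by
    rw [← pd_apply (hcd j)]
    refine pd_congr ?_ i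
    filter_upwards [hΨ.eventually (by simp)] with ϑ hϑ
    exact pd_apply (hϑ.differentiableAt (by simp)) j q
  have hII : (gramMetric I (Ψ θ))⁻¹ * gramMetric I (Ψ θ) = 1 :=
    Matrix.nonsing_inv_mul _ (isUnit_det_gramMetric hI')
  have hII' : ∀ c, ∑ l, (gramMetric I (Ψ θ))⁻¹ q l * inner ℝ (pd c I (Ψ θ)) (pd l I (Ψ θ)) =
      (1 : Matrix (Fin n) (Fin n) ℝ) q c := fun c => by
    rw [← hII, Matrix.mul_apply]
    exact Finset.sum_congr rfl fun l _ => by rw [gramMetric_comm, gramMetric_apply]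
  -- The transformation law, multiplied by the Jacobian of Ψ, replaces ∂ᵢ∂ⱼΨ - Γ(Y)∂Ψ by -Γ(Z)
  -- contracted with two Jacobians. Only a difference of Christoffel symbols remains, which is
  -- tensorial.
  have hL : coordMapLaplacian (gramMetric Y) (gramMetric I) Ψ θ q =
      ∑ i, ∑ j, (gramMetric Y θ)⁻¹ i j * ∑ a, ∑ b, (jacobian Ψ θ a i * jacobian Ψ θ b j) *
        (christoffel (gramMetric I) (Ψ θ) q a b - christoffel (gramMetric Z) (Ψ θ) q a b) := by
    simp only [coordMapLaplacian, hp1, hp2]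
    refine Finset.sum_congr rfl fun i _ => Finset.sum_congr rfl fun j _ => ?_
    congr 1
    have := sum_jacobian_mul_christoffel h hZ hΨ hY hZ' q i j
    have e : ∑ k, christoffel (gramMetric Y) θ k i j * jacobian Ψ θ q k =
        ∑ k, jacobian Ψ θ q k * christoffel (gramMetric Y) θ k i j :=
      Finset.sum_congr rfl fun k _ => mul_comm _ _
    rw [e, this]
    simp only [mul_sub, Finset.sum_sub_distrib]
    have e2 : ∑ a, ∑ b, christoffel (gramMetric I) (Ψ θ) q a b * jacobian Ψ θ a i *
          jacobian Ψ θ b j =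
        ∑ a, ∑ b, jacobian Ψ θ a i * jacobian Ψ θ b j *
          christoffel (gramMetric I) (Ψ θ) q a b :=
      Finset.sum_congr rfl fun a _ => Finset.sum_congr rfl fun b _ => by ring
    rw [e2]
    ring
  -- The same difference appears as the tangential component of the Hessian of I taken with the
  -- connection of Z: ∂ₐ∂_b I contributes Γ(I), and the correction contributes -Γ(Z).
  have hR : ∀ a b, ∑ l, (gramMetric I (Ψ θ))⁻¹ q l *
      inner ℝ (pd a (pd b I) (Ψ θ) - ∑ c, christoffel (gramMetric Z) (Ψ θ) c a b • pd c I (Ψ θ))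
        (pd l I (Ψ θ)) =
      christoffel (gramMetric I) (Ψ θ) q a b - christoffel (gramMetric Z) (Ψ θ) q a b := by
    intro a b
    simp only [inner_sub_left, mul_sub, Finset.sum_sub_distrib, ← christoffel_gramMetric hI]
    congr 1
    simp only [sum_inner, inner_smul_left, conj_trivial, Finset.mul_sum]
    rw [Finset.sum_comm]
    have : ∀ c, ∑ l, (gramMetric I (Ψ θ))⁻¹ q l *
        (christoffel (gramMetric Z) (Ψ θ) c a b * inner ℝ (pd c I (Ψ θ)) (pd l I (Ψ θ))) =
        christoffel (gramMetric Z) (Ψ θ) c a b * (1 : Matrix (Fin n) (Fin n) ℝ) q c := fun c => by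
      rw [← hII', Finset.mul_sum]
      exact Finset.sum_congr rfl fun l _ => by ring
    simp [this, Matrix.one_apply]
  have h5 := sum_inv_smul_conj (g := gramMetric Z (Ψ θ)) hB (fun a b =>
    christoffel (gramMetric I) (Ψ θ) q a b - christoffel (gramMetric Z) (Ψ θ) q a b)
  rw [hL, hg]
  simp only [smul_eq_mul] at h5
  rw [h5]
  simp only [coordLaplacian, sum_inner, inner_smul_left, conj_trivial, Finset.mul_sum, ← hR]
  calc _ = ∑ a, ∑ l, ∑ b, _ := Finset.sum_congr rfl fun a _ => Finset.sum_comm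
    _ = ∑ l, ∑ a, ∑ b, _ := Finset.sum_comm
    _ = _ := Finset.sum_congr rfl fun l _ => Finset.sum_congr rfl fun a _ =>
      Finset.sum_congr rfl fun b _ => by ring

/-- Gauss formula: subtracting Γᵏᵢⱼ ∂ₖY removes exactly the tangential projection of ∂ᵢ∂ⱼY, so every
entry of the Hessian is normal already before the trace is taken. -/
theorem inner_coordLaplacian_pd {Y : Euc n → Euc m} {θ : Euc n} (hY : ContDiffAt ℝ 2 Y θ)
    (hY' : Function.Injective (fderiv ℝ Y θ)) (l : Fin n) :
    inner ℝ (coordLaplacian (gramMetric Y) Y θ) (pd l Y θ) = 0 := by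
  have hgg : (gramMetric Y θ)⁻¹ * gramMetric Y θ = 1 :=
    Matrix.nonsing_inv_mul _ (isUnit_det_gramMetric hY')
  have key : ∀ i j, inner ℝ (pd i (pd j Y) θ -
      ∑ k, christoffel (gramMetric Y) θ k i j • pd k Y θ) (pd l Y θ) = 0 := by
    intro i j
    simp only [inner_sub_left, sum_inner, inner_smul_left, conj_trivial,
      christoffel_gramMetric hY, Finset.sum_mul]
    rw [Finset.sum_comm, sub_eq_zero]
    have : ∀ p, ∑ k, (gramMetric Y θ)⁻¹ k p * inner ℝ (pd i (pd j Y) θ) (pd p Y θ) *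
        inner ℝ (pd k Y θ) (pd l Y θ) =
        inner ℝ (pd i (pd j Y) θ) (pd p Y θ) * (1 : Matrix (Fin n) (Fin n) ℝ) p l := fun p => by
      rw [← hgg, Matrix.mul_apply, Finset.mul_sum]
      refine Finset.sum_congr rfl fun k _ => ?_
      rw [gramMetric_inv_comm, gramMetric_apply]; ring
    simp [this, Matrix.one_apply]
  simp [coordLaplacian, sum_inner, inner_smul_left, key]

theorem inner_coordLaplacian_normal {Y : Euc n → Euc m} {θ : Euc n} {ν : Euc m}
    (g : Euc n → Matrix (Fin n) (Fin n) ℝ)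
    (hν : ∀ i, inner ℝ (pd i Y θ) ν = 0) :
    inner ℝ (coordLaplacian g Y θ) ν =
      ∑ i, ∑ j, (g θ)⁻¹ i j * inner ℝ (pd i (pd j Y) θ) ν := by
  simp [coordLaplacian, sum_inner, inner_smul_left, inner_sub_left, hν]

theorem linearIndependent_cons_normal {Y : Euc n → Euc m} {θ : Euc n} {ν : Euc m}
    (hY : Function.Injective (fderiv ℝ Y θ)) (hν0 : ν ≠ 0)
    (hν : ∀ i, inner ℝ (pd i Y θ) ν = 0) :
    LinearIndependent ℝ (Fin.cons ν (fun i => pd i Y θ) : Fin (n + 1) → Euc m) := by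
  rw [linearIndependent_finCons]
  refine ⟨linearIndependent_pd hY, fun hmem => hν0 ?_⟩
  have : inner ℝ ν ν = 0 := by
    refine Submodule.span_induction (p := fun z _ => inner ℝ z ν = 0) ?_ ?_ ?_ ?_ hmem
    · rintro _ ⟨j, rfl⟩; exact hν j
    · simp
    · intro a c _ _ ha hc; rw [inner_add_left, ha, hc, add_zero]
    · intro r a _ ha; rw [inner_smul_left, ha, mul_zero]
  exact inner_self_eq_zero.1 this

/-- A vector orthogonal to the tangent space and to the normal vanishes. -/
theorem eq_zero_of_inner_eq_zero {Y : Euc n → Euc (n + 1)} {θ : Euc n} {ν u : Euc (n + 1)}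
    (hY : Function.Injective (fderiv ℝ Y θ)) (hν0 : ν ≠ 0)
    (hν : ∀ i, inner ℝ (pd i Y θ) ν = 0) (hu : ∀ i, inner ℝ (pd i Y θ) u = 0)
    (huν : inner ℝ ν u = 0) : u = 0 := by
  have hspan := (linearIndependent_cons_normal hY hν0 hν).span_eq_top_of_card_eq_finrank' (by simp)
  have hmem : u ∈ Submodule.span ℝ
      (Set.range (Fin.cons ν (fun i => pd i Y θ) : Fin (n + 1) → Euc (n + 1))) := by
    rw [hspan]; trivial
  have : inner ℝ u u = 0 := by
    refine Submodule.span_induction (p := fun z _ => inner ℝ z u = 0) ?_ ?_ ?_ ?_ hmem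
    · rintro _ ⟨j, rfl⟩
      refine Fin.cases ?_ (fun k => ?_) j
      · simpa using huν
      · simpa using hu k
    · simp
    · intro a c _ _ ha hc; rw [inner_add_left, ha, hc, add_zero]
    · intro r a _ ha; rw [inner_smul_left, ha, mul_zero]
  exact inner_self_eq_zero.1 this

/-- The tangential part vanishes by `inner_coordLaplacian_pd`, and in codimension one the tangent
vectors together with ν span the whole space. -/
theorem coordLaplacian_self_eq {Y : Euc n → Euc (n + 1)} {θ : Euc n} {ν : Euc (n + 1)}
    (hY : ContDiffAt ℝ 2 Y θ) (hY' : Function.Injective (fderiv ℝ Y θ)) (hν1 : ‖ν‖ = 1)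
    (hν : ∀ i, inner ℝ (pd i Y θ) ν = 0) :
    coordLaplacian (gramMetric Y) Y θ =
      inner ℝ (coordLaplacian (gramMetric Y) Y θ) ν • ν := by
  have hνν : inner ℝ ν ν = 1 := by rw [real_inner_self_eq_norm_sq, hν1]; norm_num
  have hν0 : ν ≠ 0 := by rintro rfl; simp at hν1
  rw [← sub_eq_zero]
  refine eq_zero_of_inner_eq_zero hY' hν0 hν (fun i => ?_) ?_
  · rw [inner_sub_right, real_inner_comm, inner_coordLaplacian_pd hY hY', inner_smul_right, hν,
      mul_zero, sub_zero]
  · rw [inner_sub_right, inner_smul_right, hνν, mul_one, real_inner_comm, sub_self]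

end Transformation

end

end DeTurck

namespace DeTurck

noncomputable section

/-! ### The Laplace operator in divergence form -/

/-! ### Derivatives of determinants and of inverse matrices -/

section Determinant

variable {n d : ℕ} {E : Type*} [NormedAddCommGroup E] [NormedSpace ℝ E] {k : WithTop ℕ∞}

theorem ContDiffAt.matrix_det {A : E → Matrix (Fin d) (Fin d) ℝ} {θ : E}
    (hA : ∀ i j, ContDiffAt ℝ k (fun ϑ => A ϑ i j) θ) : ContDiffAt ℝ k (fun ϑ => (A ϑ).det) θ := by
  simp only [Matrix.det_apply']
  exact ContDiffAt.sum fun σ _ => contDiffAt_const.mul (contDiffAt_prod fun i _ => hA _ _)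

theorem ContDiffAt.matrix_inv {A : E → Matrix (Fin d) (Fin d) ℝ} {θ : E}
    (hA : ∀ i j, ContDiffAt ℝ k (fun ϑ => A ϑ i j) θ) (hdet : (A θ).det ≠ 0) (i j : Fin d) :
    ContDiffAt ℝ k (fun ϑ => (A ϑ)⁻¹ i j) θ := by
  simp only [Matrix.inv_def, Ring.inverse_eq_inv', Matrix.smul_apply, Matrix.adjugate_apply,
    smul_eq_mul]
  refine ((ContDiffAt.matrix_det hA).inv hdet).mul (ContDiffAt.matrix_det fun a b => ?_)
  by_cases h : a = j
  · subst h; simp only [Matrix.updateRow_self]; exact contDiffAt_const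
  · simp only [Matrix.updateRow_ne h]; exact hA a b

theorem pd_prod {ι : Type*} [DecidableEq ι] (s : Finset ι) {c : ι → Euc n → ℝ} {θ : Euc n}
    (hc : ∀ a ∈ s, DifferentiableAt ℝ (c a) θ) (i : Fin n) :
    pd i (fun ϑ => ∏ a ∈ s, c a ϑ) θ = ∑ a ∈ s, (∏ b ∈ s.erase a, c b θ) * pd i (c a) θ := by
  have h := HasFDerivAt.finsetProd (u := s) (g := c) (g' := fun a => fderiv ℝ (c a) θ) (x := θ)
    fun a ha => (hc a ha).hasFDerivAt
  rw [pd, h.fderiv]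
  simp [pd]

/-- Jacobi's formula. -/
theorem pd_det {A : Euc n → Matrix (Fin d) (Fin d) ℝ} {θ : Euc n}
    (hA : ∀ i j, DifferentiableAt ℝ (fun ϑ => A ϑ i j) θ) (hdet : (A θ).det ≠ 0) (l : Fin n) :
    pd l (fun ϑ => (A ϑ).det) θ =
      (A θ).det * ∑ i, ∑ j, (A θ)⁻¹ i j * pd l (fun ϑ => A ϑ j i) θ := by
  have hp : ∀ σ : Equiv.Perm (Fin d), DifferentiableAt ℝ (fun ϑ => ∏ i, A ϑ (σ i) i) θ :=
    fun σ => (HasFDerivAt.finsetProd fun i _ => (hA (σ i) i).hasFDerivAt).differentiableAt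
  -- The determinant is multilinear in the columns, so its derivative is the sum over the columns of
  -- the determinants with that column differentiated; each of these is then an entry of the
  -- adjugate applied to the differentiated column.
  have h1 : pd l (fun ϑ => (A ϑ).det) θ =
      ∑ i, ((A θ).updateCol i fun k => pd l (fun ϑ => A ϑ k i) θ).det := by
    simp only [Matrix.det_apply']
    rw [pd_sum (F := fun (σ : Equiv.Perm (Fin d)) ϑ => ((Equiv.Perm.sign σ : ℤ) : ℝ) *
      ∏ i, A ϑ (σ i) i) _ fun σ _ => (hp σ).const_mul _, Finset.sum_comm]
    refine Finset.sum_congr rfl fun σ _ => ?_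
    rw [← Finset.mul_sum, pd_mul (differentiableAt_const _) (hp σ), pd_prod _ fun i _ => hA _ _]
    have h0 : pd l (fun _ : Euc n => ((Equiv.Perm.sign σ : ℤ) : ℝ)) θ = 0 := by simp [pd]
    rw [h0, zero_mul, add_zero]
    congr 1
    refine Finset.sum_congr rfl fun i _ => ?_
    rw [← Finset.mul_prod_erase _ _ (Finset.mem_univ i), Matrix.updateCol_self, mul_comm]
    congr 1
    exact Finset.prod_congr rfl fun j hj => by rw [Matrix.updateCol_ne (Finset.ne_of_mem_erase hj)]
  rw [h1, Finset.mul_sum]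
  refine Finset.sum_congr rfl fun i _ => ?_
  rw [← Matrix.cramer_apply, Matrix.cramer_eq_adjugate_mulVec, Matrix.mulVec, dotProduct,
    Finset.mul_sum]
  refine Finset.sum_congr rfl fun j _ => ?_
  rw [Matrix.inv_def, Ring.inverse_eq_inv', Matrix.smul_apply, smul_eq_mul]
  field_simp

/-- The identity A⁻¹A = 1 holds near θ because the determinant stays nonzero there. Differentiating
it and multiplying by A⁻¹ from the right isolates the derivative of A⁻¹. -/
theorem pd_matrix_inv {A : Euc n → Matrix (Fin d) (Fin d) ℝ} {θ : Euc n}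
    (hA : ∀ i j, ContDiffAt ℝ 1 (fun ϑ => A ϑ i j) θ) (hdet : (A θ).det ≠ 0) (l : Fin n)
    (i j : Fin d) :
    pd l (fun ϑ => (A ϑ)⁻¹ i j) θ =
      -∑ a, ∑ b, (A θ)⁻¹ i a * pd l (fun ϑ => A ϑ a b) θ * (A θ)⁻¹ b j := by
  have hAd : ∀ i j, DifferentiableAt ℝ (fun ϑ => A ϑ i j) θ := fun i j =>
    (hA i j).differentiableAt (by simp)
  have hId : ∀ i j, DifferentiableAt ℝ (fun ϑ => (A ϑ)⁻¹ i j) θ := fun i j =>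
    (ContDiffAt.matrix_inv hA hdet i j).differentiableAt (by simp)
  have h1 : ∀ b, ∑ a, ((A θ)⁻¹ i a * pd l (fun ϑ => A ϑ a b) θ +
      pd l (fun ϑ => (A ϑ)⁻¹ i a) θ * A θ a b) = 0 := by
    intro b
    have h2 : (fun ϑ => ∑ a, (A ϑ)⁻¹ i a * A ϑ a b) =ᶠ[𝓝 θ]
        fun _ => (1 : Matrix (Fin d) (Fin d) ℝ) i b := by
      filter_upwards [(ContDiffAt.matrix_det hA).continuousAt.eventually_ne hdet] with ϑ hϑ
      rw [← Matrix.nonsing_inv_mul (A ϑ) hϑ.isUnit, Matrix.mul_apply]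
    have h3 := pd_congr h2 l
    rw [pd_sum (F := fun a ϑ => (A ϑ)⁻¹ i a * A ϑ a b) _ fun a _ => (hId i a).mul (hAd a b)] at h3
    simp_rw [fun a => pd_mul (hId i a) (hAd a b) l] at h3
    rw [h3]; simp [pd]
  have h4 : ∑ b, (∑ a, ((A θ)⁻¹ i a * pd l (fun ϑ => A ϑ a b) θ +
      pd l (fun ϑ => (A ϑ)⁻¹ i a) θ * A θ a b)) * (A θ)⁻¹ b j = 0 := by simp [h1]
  simp only [Finset.sum_add_distrib, add_mul, Finset.sum_mul] at h4
  have h5 : ∑ b, ∑ a, pd l (fun ϑ => (A ϑ)⁻¹ i a) θ * A θ a b * (A θ)⁻¹ b j =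
      pd l (fun ϑ => (A ϑ)⁻¹ i j) θ := by
    rw [Finset.sum_comm]
    have : ∀ a, ∑ b, pd l (fun ϑ => (A ϑ)⁻¹ i a) θ * A θ a b * (A θ)⁻¹ b j =
        pd l (fun ϑ => (A ϑ)⁻¹ i a) θ * (1 : Matrix (Fin d) (Fin d) ℝ) a j := fun a => by
      rw [← Matrix.mul_nonsing_inv (A θ) hdet.isUnit, Matrix.mul_apply, Finset.mul_sum]
      exact Finset.sum_congr rfl fun b _ => by ring
    simp [this, Matrix.one_apply]
  rw [h5, Finset.sum_comm] at h4
  linarith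

end Determinant

section Divergence

variable {n m : ℕ} {V : Type*} [NormedAddCommGroup V] [NormedSpace ℝ V]

/-- The component `√det g gⁱʲ ∂ᵢ F` of the gradient of `F`, for the metric `g` induced by `Y`. -/
def gradDensity (Y : Euc n → Euc m) (F : Euc n → V) (j : Fin n) (θ : Euc n) : V :=
  ∑ i, (√(gramMetric Y θ).det * (gramMetric Y θ)⁻¹ i j) • pd i F θ

theorem contDiffAt_sqrt_det {Y : Euc n → Euc m} {θ : Euc n} (hY : ContDiffAt ℝ 2 Y θ)
    (hY' : Function.Injective (fderiv ℝ Y θ)) :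
    ContDiffAt ℝ 1 (fun ϑ => √(gramMetric Y ϑ).det) θ :=
  (ContDiffAt.matrix_det (ContDiffAt.gramMetric hY (by norm_num))).sqrt
    (posDef_gramMetric hY').det_pos.ne'

theorem contDiffAt_gramMetric_inv {Y : Euc n → Euc m} {θ : Euc n} (hY : ContDiffAt ℝ 2 Y θ)
    (hY' : Function.Injective (fderiv ℝ Y θ)) (i j : Fin n) :
    ContDiffAt ℝ 1 (fun ϑ => (gramMetric Y ϑ)⁻¹ i j) θ :=
  ContDiffAt.matrix_inv (ContDiffAt.gramMetric hY (by norm_num))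
    (posDef_gramMetric hY').det_pos.ne' i j

theorem contDiffAt_gradDensity {Y : Euc n → Euc m} {F : Euc n → V} {θ : Euc n}
    (hY : ContDiffAt ℝ 2 Y θ) (hY' : Function.Injective (fderiv ℝ Y θ)) (hF : ContDiffAt ℝ 2 F θ)
    (j : Fin n) : ContDiffAt ℝ 1 (gradDensity Y F j) θ :=
  ContDiffAt.sum fun i _ => ((contDiffAt_sqrt_det hY hY').mul
    (contDiffAt_gramMetric_inv hY hY' i j)).smul (ContDiffAt.pd hF (by norm_num) i)

theorem pd_gramMetric {Y : Euc n → Euc m} {θ : Euc n} (hY : ContDiffAt ℝ 2 Y θ)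
    (l a b : Fin n) :
    pd l (fun ϑ => gramMetric Y ϑ a b) θ =
      inner ℝ (pd l (pd a Y) θ) (pd b Y θ) + inner ℝ (pd l (pd b Y) θ) (pd a Y θ) := by
  have hd : ∀ a, DifferentiableAt ℝ (pd a Y) θ := fun a =>
    (ContDiffAt.pd (k := 1) hY (by norm_num) a).differentiableAt (by simp)
  simp only [gramMetric_apply]
  rw [pd_inner (hd a) (hd b), real_inner_comm (pd l (pd b Y) θ), add_comm]

/-- Jacobi's formula: the two halves of ∂ₗ gₐ_b contribute equally because g⁻¹ is symmetric, and the
resulting factor 2 cancels the one from the square root. -/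
theorem pd_sqrt_det {Y : Euc n → Euc m} {θ : Euc n} (hY : ContDiffAt ℝ 2 Y θ)
    (hY' : Function.Injective (fderiv ℝ Y θ)) (l : Fin n) :
    pd l (fun ϑ => √(gramMetric Y ϑ).det) θ = √(gramMetric Y θ).det *
      ∑ a, ∑ b, (gramMetric Y θ)⁻¹ a b * inner ℝ (pd l (pd a Y) θ) (pd b Y θ) := by
  have hpos := (posDef_gramMetric hY').det_pos
  have hg1 : ∀ i j, ContDiffAt ℝ 1 (fun ϑ => gramMetric Y ϑ i j) θ :=
    ContDiffAt.gramMetric hY (by norm_num)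
  have hgd : DifferentiableAt ℝ (fun ϑ => (gramMetric Y ϑ).det) θ :=
    (ContDiffAt.matrix_det hg1).differentiableAt (by simp)
  have h1 : pd l (fun ϑ => √(gramMetric Y ϑ).det) θ =
      1 / (2 * √(gramMetric Y θ).det) * pd l (fun ϑ => (gramMetric Y ϑ).det) θ := by
    rw [pd, (hgd.hasFDerivAt.sqrt hpos.ne').fderiv]
    rfl
  rw [h1, pd_det (fun i j => (hg1 i j).differentiableAt (by simp)) hpos.ne']
  have h2 : ∑ i, ∑ j, (gramMetric Y θ)⁻¹ i j * pd l (fun ϑ => gramMetric Y ϑ j i) θ =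
      2 * ∑ a, ∑ b, (gramMetric Y θ)⁻¹ a b * inner ℝ (pd l (pd a Y) θ) (pd b Y θ) := by
    simp only [pd_gramMetric hY, mul_add, Finset.sum_add_distrib]
    rw [two_mul]
    congr 1
    rw [Finset.sum_comm]
    exact Finset.sum_congr rfl fun a _ => Finset.sum_congr rfl fun b _ => by
      rw [gramMetric_inv_comm]
  rw [h2]
  have h3 := Real.mul_self_sqrt hpos.le
  have h4 := (Real.sqrt_pos.2 hpos).ne'
  field_simp
  rw [sq, h3]

/-- The derivative of g⁻¹ has two terms, one for each factor in ∂g = ⟨∂∂Y, ∂Y⟩ + ⟨∂Y, ∂∂Y⟩. After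
summation over j the first is cancelled by the derivative of √det g (`e1`), and the second is the
traced Christoffel symbol (`e2`). -/
theorem sum_pd_sqrt_det_mul_inv {Y : Euc n → Euc m} {θ : Euc n} (hY : ContDiffAt ℝ 2 Y θ)
    (hY' : Function.Injective (fderiv ℝ Y θ)) (i : Fin n) :
    ∑ j, pd j (fun ϑ => √(gramMetric Y ϑ).det * (gramMetric Y ϑ)⁻¹ i j) θ =
      -(√(gramMetric Y θ).det *
        ∑ a, ∑ b, (gramMetric Y θ)⁻¹ a b * christoffel (gramMetric Y) θ i a b) := by
  have hpos := (posDef_gramMetric hY').det_pos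
  have hg1 : ∀ i j, ContDiffAt ℝ 1 (fun ϑ => gramMetric Y ϑ i j) θ :=
    ContDiffAt.gramMetric hY (by norm_num)
  have hsd := (contDiffAt_sqrt_det hY hY').differentiableAt (by simp)
  have hid : ∀ j, DifferentiableAt ℝ (fun ϑ => (gramMetric Y ϑ)⁻¹ i j) θ := fun j =>
    (contDiffAt_gramMetric_inv hY hY' i j).differentiableAt (by simp)
  simp_rw [fun j => pd_mul hsd (hid j) j, pd_sqrt_det hY hY', pd_matrix_inv hg1 hpos.ne',
    pd_gramMetric hY, christoffel_gramMetric hY]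
  set g := (gramMetric Y θ)⁻¹ with hgdef
  have hsym : ∀ a b, g a b = g b a := gramMetric_inv_comm Y θ
  have e1 : ∑ j, ∑ a, ∑ b, g i a * inner ℝ (pd j (pd a Y) θ) (pd b Y θ) * g b j =
      ∑ j, (∑ a, ∑ b, g a b * inner ℝ (pd j (pd a Y) θ) (pd b Y θ)) * g i j := by
    rw [Finset.sum_comm]
    refine Finset.sum_congr rfl fun a _ => ?_
    rw [Finset.sum_mul]
    refine Finset.sum_congr rfl fun j _ => ?_
    rw [Finset.sum_mul]
    refine Finset.sum_congr rfl fun b _ => ?_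
    rw [pd_comm hY j a, hsym b j]; ring
  have e2 : ∑ j, ∑ a, ∑ b, g i a * inner ℝ (pd j (pd b Y) θ) (pd a Y θ) * g b j =
      ∑ a, ∑ b, g a b * ∑ l, g i l * inner ℝ (pd a (pd b Y) θ) (pd l Y θ) := by
    refine Finset.sum_congr rfl fun j _ => ?_
    rw [Finset.sum_comm]
    refine Finset.sum_congr rfl fun b _ => ?_
    rw [Finset.mul_sum]
    refine Finset.sum_congr rfl fun a _ => ?_
    rw [hsym b j]; ring
  have e3 : ∀ j, √(gramMetric Y θ).det * -∑ a, ∑ b, g i a *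
        (inner ℝ (pd j (pd a Y) θ) (pd b Y θ) + inner ℝ (pd j (pd b Y) θ) (pd a Y θ)) * g b j +
      √(gramMetric Y θ).det * (∑ a, ∑ b, g a b * inner ℝ (pd j (pd a Y) θ) (pd b Y θ)) * g i j =
      √(gramMetric Y θ).det *
        ((∑ a, ∑ b, g a b * inner ℝ (pd j (pd a Y) θ) (pd b Y θ)) * g i j -
        ∑ a, ∑ b, g i a * inner ℝ (pd j (pd a Y) θ) (pd b Y θ) * g b j -
        ∑ a, ∑ b, g i a * inner ℝ (pd j (pd b Y) θ) (pd a Y θ) * g b j) := by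
    intro j
    simp only [mul_add, add_mul, Finset.sum_add_distrib]
    ring
  rw [Finset.sum_congr rfl fun j _ => e3 j, ← Finset.mul_sum, Finset.sum_sub_distrib,
    Finset.sum_sub_distrib, e1, e2, sub_self, zero_sub, mul_neg]

/-- In the product rule, derivatives falling on ∂ᵢF give the pure second-order part of the Laplacian
and derivatives falling on the coefficients give its Christoffel part. This divergence form is what
can be integrated by parts. -/
theorem sum_pd_gradDensity {Y : Euc n → Euc m} {F : Euc n → V} {θ : Euc n}
    (hY : ContDiffAt ℝ 2 Y θ) (hY' : Function.Injective (fderiv ℝ Y θ))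
    (hF : ContDiffAt ℝ 2 F θ) :
    ∑ j, pd j (gradDensity Y F j) θ =
      √(gramMetric Y θ).det • coordLaplacian (gramMetric Y) F θ := by
  have hcd : ∀ i j, DifferentiableAt ℝ
      (fun ϑ => √(gramMetric Y ϑ).det * (gramMetric Y ϑ)⁻¹ i j) θ := fun i j =>
    ((contDiffAt_sqrt_det hY hY').mul (contDiffAt_gramMetric_inv hY hY' i j)).differentiableAt
      (by simp)
  have hpd : ∀ i, DifferentiableAt ℝ (pd i F) θ := fun i =>
    (ContDiffAt.pd (k := 1) hF (by norm_num) i).differentiableAt (by simp)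
  have h1 : ∀ j, pd j (gradDensity Y F j) θ =
      ∑ i, ((√(gramMetric Y θ).det * (gramMetric Y θ)⁻¹ i j) • pd j (pd i F) θ +
        pd j (fun ϑ => √(gramMetric Y ϑ).det * (gramMetric Y ϑ)⁻¹ i j) θ • pd i F θ) := fun j =>
    (pd_sum (F := fun i ϑ => (√(gramMetric Y ϑ).det * (gramMetric Y ϑ)⁻¹ i j) • pd i F ϑ) _
      (fun i _ => (hcd i j).smul (hpd i)) j).trans
      (Finset.sum_congr rfl fun i _ => pd_smul (hcd i j) (hpd i) j)
  have h2 : ∑ j, ∑ i, pd j (fun ϑ => √(gramMetric Y ϑ).det * (gramMetric Y ϑ)⁻¹ i j) θ •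
      pd i F θ = -(√(gramMetric Y θ).det • ∑ a, ∑ b, (gramMetric Y θ)⁻¹ a b •
        ∑ i, christoffel (gramMetric Y) θ i a b • pd i F θ) := by
    rw [Finset.sum_comm]
    simp_rw [← Finset.sum_smul, sum_pd_sqrt_det_mul_inv hY hY']
    simp only [neg_smul, Finset.sum_neg_distrib, Finset.smul_sum, Finset.sum_smul, smul_smul,
      Finset.mul_sum]
    congr 1
    rw [Finset.sum_comm]
    refine Finset.sum_congr rfl fun a _ => ?_
    rw [Finset.sum_comm]
  simp only [h1, Finset.sum_add_distrib, h2, coordLaplacian, smul_sub, Finset.sum_sub_distrib]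
  rw [← sub_eq_add_neg]
  congr 1
  simp only [Finset.smul_sum, smul_smul]
  refine Finset.sum_congr rfl fun a _ => Finset.sum_congr rfl fun b _ => ?_
  rw [gramMetric_inv_comm]

end Divergence

end

end DeTurck

namespace DeTurck

noncomputable section

/-! ### Weak derivatives and test functions of class `C¹` -/

section WeakPartial

variable {n : ℕ}

open scoped Convolution

/-- Bump functions whose supports shrink to the origin. -/
def shrinkingBump (n : ℕ) (δ : ℝ) (hδ : 0 < δ) (k : ℕ) : ContDiffBump (0 : Euc n) where
  rIn := δ / (k + 2) / 2
  -- The shift by 2 keeps the radius strictly below δ also for k = 0.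
  rOut := δ / (k + 2)
  rIn_pos := by positivity
  rIn_lt_rOut := half_lt_self (by positivity)

theorem shrinkingBump_rOut_lt {δ : ℝ} (hδ : 0 < δ) (k : ℕ) :
    (shrinkingBump n δ hδ k).rOut < δ := by
  show δ / (k + 2) < δ
  exact div_lt_self hδ (by linarith [k.cast_nonneg (α := ℝ)])

theorem tendsto_shrinkingBump_rOut {δ : ℝ} (hδ : 0 < δ) :
    Tendsto (fun k => (shrinkingBump n δ hδ k).rOut) atTop (𝓝 0) := by
  show Tendsto (fun k : ℕ => δ / (k + 2)) atTop (𝓝 0)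
  exact tendsto_const_nhds.div_atTop
    (tendsto_atTop_add_const_right _ _ tendsto_natCast_atTop_atTop)

/-- The mollification of `f`. -/
def mollify (η : ContDiffBump (0 : Euc n)) (f : Euc n → ℝ) : Euc n → ℝ :=
  η.normed volume ⋆[ContinuousLinearMap.lsmul ℝ ℝ, volume] f

theorem contDiff_mollify (η : ContDiffBump (0 : Euc n)) {f : Euc n → ℝ} (hf : Continuous f) :
    ContDiff ℝ ∞ (mollify η f) :=
  HasCompactSupport.contDiff_convolution_left _ η.hasCompactSupport_normed η.contDiff_normed
    hf.locallyIntegrable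

theorem pd_mollify (η : ContDiffBump (0 : Euc n)) {f : Euc n → ℝ} (hf : ContDiff ℝ 1 f)
    (hc : HasCompactSupport f) (i : Fin n) : pd i (mollify η f) = mollify η (pd i f) := by
  have hl : LocallyIntegrable (η.normed volume) (volume : Measure (Euc n)) :=
    η.continuous_normed.locallyIntegrable
  funext θ
  have h := hc.hasFDerivAt_convolution_right (ContinuousLinearMap.lsmul ℝ ℝ) hl hf θ
  rw [pd, mollify, h.fderiv]
  exact convolution_precompR_apply _ hl (hc.fderiv ℝ) (hf.continuous_fderiv (by simp)) θ _

/-- The value of the mollification differs from f θ by at most the oscillation 2C, and |f θ| ≤ C.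
The constant is not sharp; only a bound independent of the bump is needed as a majorant. -/
theorem abs_mollify_le (η : ContDiffBump (0 : Euc n)) {f : Euc n → ℝ} (hf : Continuous f) {C : ℝ}
    (hC : ∀ θ, |f θ| ≤ C) (θ : Euc n) : |mollify η f θ| ≤ 3 * C := by
  have h := ContDiffBump.dist_normed_convolution_le (φ := η) (μ := volume) (x₀ := θ) (ε := 2 * C)
    hf.aestronglyMeasurable fun x _ => by
      rw [Real.dist_eq]
      linarith [abs_sub (f x) (f θ), hC x, hC θ]
  rw [Real.dist_eq] at h
  have h2 := abs_sub_abs_le_abs_sub (mollify η f θ) (f θ)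
  have h3 : |mollify η f θ - f θ| ≤ 2 * C := h
  linarith [hC θ]

theorem mollify_eq_zero (η : ContDiffBump (0 : Euc n)) {f : Euc n → ℝ} {δ : ℝ}
    (hη : η.rOut < δ) {θ : Euc n} (hθ : θ ∉ Metric.cthickening δ (tsupport f)) :
    mollify η f θ = 0 := by
  by_contra h
  have h1 : θ ∈ Function.support (mollify η f) := h
  obtain ⟨a, ha, b, hb, rfl⟩ := support_convolution_subset _ h1
  refine hθ (Metric.mem_cthickening_of_dist_le _ b _ _ (subset_tsupport f hb) ?_)
  rw [η.support_normed_eq] at ha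
  rw [dist_eq_norm, add_sub_cancel_right]
  exact (mem_ball_zero_iff.1 ha).le.trans hη.le

theorem tendsto_mollify {δ : ℝ} (hδ : 0 < δ) {f : Euc n → ℝ} (hf : Continuous f) (θ : Euc n) :
    Tendsto (fun k => mollify (shrinkingBump n δ hδ k) f θ) atTop (𝓝 (f θ)) :=
  ContDiffBump.convolution_tendsto_right_of_continuous (tendsto_shrinkingBump_rOut hδ) hf θ

/-- F is only locally integrable on Ω, so the mollifications must be supported in one fixed compact
subset of Ω. The δ-thickening of the support of f is such a set, and on it 3C|F| dominates. -/
theorem tendsto_integral_mul_mollify {Ω : Set (Euc n)} {F f : Euc n → ℝ}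
    (hF : LocallyIntegrableOn F Ω) (hf : Continuous f) (hc : HasCompactSupport f) {δ : ℝ}
    (hδ : 0 < δ) (hK : Metric.cthickening δ (tsupport f) ⊆ Ω) :
    Tendsto (fun k => ∫ θ in Ω, F θ * mollify (shrinkingBump n δ hδ k) f θ) atTop
      (𝓝 (∫ θ in Ω, F θ * f θ)) := by
  set K := Metric.cthickening δ (tsupport f) with hKdef
  have hKc : IsCompact K := hc.isCompact.cthickening
  obtain ⟨C, hC⟩ := hf.bounded_above_of_compact_support hc
  have hC' : ∀ θ, |f θ| ≤ C := hC
  have hFK : IntegrableOn F K := (hF.mono_set hK).integrableOn_isCompact hKc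
  have hFm : AEStronglyMeasurable F (volume.restrict Ω) := hF.aestronglyMeasurable
  refine tendsto_integral_of_dominated_convergence
    (K.indicator fun θ => |F θ| * (3 * C)) (fun k => ?_) ?_ (fun k => ?_) ?_
  · exact hFm.mul (contDiff_mollify _ hf).continuous.aestronglyMeasurable
  · exact ((integrable_indicator_iff hKc.measurableSet).2
      ((hFK.abs).mul_const (3 * C))).mono_measure Measure.restrict_le_self
  · refine Eventually.of_forall fun θ => ?_
    rw [Real.norm_eq_abs, abs_mul]
    by_cases hθ : θ ∈ K
    · rw [indicator_of_mem hθ]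
      gcongr
      exact abs_mollify_le _ hf hC' θ
    · rw [indicator_of_notMem hθ, mollify_eq_zero _ (shrinkingBump_rOut_lt hδ k) hθ]
      simp
  · exact Eventually.of_forall fun θ => (tendsto_mollify hδ hf θ).const_mul _

theorem tsupport_pd_subset {f : Euc n → ℝ} (i : Fin n) : tsupport (pd i f) ⊆ tsupport f := by
  refine closure_minimal (fun θ hθ => ?_) (isClosed_tsupport f)
  refine support_fderiv_subset ℝ (f := f) fun h => hθ ?_
  rw [pd, h]; rfl

theorem continuous_pd {f : Euc n → ℝ} (hf : ContDiff ℝ 1 f) (i : Fin n) : Continuous (pd i f) :=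
  (hf.continuous_fderiv (by simp)).clm_apply continuous_const

theorem hasCompactSupport_pd {f : Euc n → ℝ} (hc : HasCompactSupport f) (i : Fin n) :
    HasCompactSupport (pd i f) :=
  hc.of_isClosed_subset (isClosed_tsupport _) (tsupport_pd_subset i)

/-- Weak derivatives may be tested with functions of class `C¹`. -/
theorem IsWeakPartial.integral_mul_pd {Ω : Set (Euc n)} (hΩ : IsOpen Ω) {i : Fin n}
    {F W : Euc n → ℝ} (h : IsWeakPartial Ω i F W) {φ : Euc n → ℝ} (hφ : ContDiff ℝ 1 φ)
    (hc : HasCompactSupport φ) (hs : tsupport φ ⊆ Ω) :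
    ∫ θ in Ω, F θ * pd i φ θ = - ∫ θ in Ω, W θ * φ θ := by
  obtain ⟨δ, hδ, hK⟩ := hc.isCompact.exists_cthickening_subset_open hΩ hs
  have h1 := tendsto_integral_mul_mollify h.1 (continuous_pd hφ i) (hasCompactSupport_pd hc i)
    hδ ((Metric.cthickening_subset_of_subset δ (tsupport_pd_subset i)).trans hK)
  have h2 := (tendsto_integral_mul_mollify h.2.1 hφ.continuous hc hδ hK).neg
  refine tendsto_nhds_unique h1 (h2.congr fun k => ?_)
  have hsub : tsupport (mollify (shrinkingBump n δ hδ k) φ) ⊆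
      Metric.cthickening δ (tsupport φ) :=
    closure_minimal (fun θ hθ => by_contra fun h0 =>
      hθ (mollify_eq_zero _ (shrinkingBump_rOut_lt hδ k) h0)) Metric.isClosed_cthickening
  have h3 := h.2.2 (mollify (shrinkingBump n δ hδ k) φ) (contDiff_mollify _ hφ.continuous)
    (hc.isCompact.cthickening.of_isClosed_subset (isClosed_tsupport _) hsub) (hsub.trans hK)
  -- Mollification commutes with ∂ᵢ, so the identity for the smooth test functions is already the
  -- one whose two sides converge to the claim.
  rw [pd_mollify _ hφ hc] at h3
  exact h3.symm

end WeakPartial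

end

end DeTurck

namespace DeTurck

noncomputable section

/-! ### Maps on the hypersurface in charts -/

theorem two_le_infty : (2 : WithTop ℕ∞) ≤ ∞ := by
  exact WithTop.coe_le_coe.2 (le_top : (2 : ℕ∞) ≤ ⊤)

theorem pullbackMetric_eq {n : ℕ} {M : Set (Euc (n + 1))} (y : M → Euc (n + 1))
    (e : OpenPartialHomeomorph M (Euc n)) : pullbackMetric y e = gramMetric (y ∘ e.symm) := rfl

section Charts

variable {n : ℕ} {M : Set (Euc (n + 1))} [ChartedSpace (Euc n) M]
  {V : Type*} [NormedAddCommGroup V] [NormedSpace ℝ V]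

theorem isOpen_chart_target (a : M) : IsOpen (chartAt (Euc n) a).target :=
  (chartAt (Euc n) a).open_target

/-- The transition map between two charts. -/
def transition (a b : M) : Euc n → Euc n := chartAt (Euc n) b ∘ (chartAt (Euc n) a).symm

theorem comp_chart_symm_eventuallyEq {X : Type*} (f : M → X) {a b : M} {θ : Euc n}
    (hθ : θ ∈ (chartAt (Euc n) a).target)
    (hb : (chartAt (Euc n) a).symm θ ∈ (chartAt (Euc n) b).source) :
    f ∘ (chartAt (Euc n) a).symm =ᶠ[𝓝 θ] (f ∘ (chartAt (Euc n) b).symm) ∘ transition a b := by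
  have hc : ContinuousAt (chartAt (Euc n) a).symm θ :=
    (chartAt (Euc n) a).continuousAt_symm hθ
  filter_upwards [hc.eventually ((chartAt (Euc n) b).open_source.mem_nhds hb)] with ϑ hϑ
  simp [transition, (chartAt (Euc n) b).left_inv hϑ]

theorem transition_mem_target {a b : M} {θ : Euc n}
    (hb : (chartAt (Euc n) a).symm θ ∈ (chartAt (Euc n) b).source) :
    transition a b θ ∈ (chartAt (Euc n) b).target :=
  (chartAt (Euc n) b).map_source hb

theorem continuous_of_continuousOn_charts {X : Type*} [TopologicalSpace X] {f : M → X}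
    (hf : ∀ a : M, ContinuousOn (f ∘ (chartAt (Euc n) a).symm) (chartAt (Euc n) a).target) :
    Continuous f := by
  refine continuous_iff_continuousAt.2 fun p => ?_
  set e := chartAt (Euc n) p
  have hp : p ∈ e.source := mem_chart_source _ p
  have h1 : ContinuousAt ((f ∘ e.symm) ∘ e) p :=
    ContinuousAt.comp ((hf p).continuousAt (e.open_target.mem_nhds (e.map_source hp)))
      (e.continuousAt hp)
  refine h1.congr ?_
  filter_upwards [e.open_source.mem_nhds hp] with q hq
  simp [e.left_inv hq]

variable [IsManifold (𝓡 n) ∞ M]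

theorem contDiffOn_comp_chart_symm {k : WithTop ℕ∞} (hk : k ≤ ∞) {f : M → V}
    (hf : ContMDiff (𝓡 n) 𝓘(ℝ, V) k f) (a : M) :
    ContDiffOn ℝ k (f ∘ (chartAt (Euc n) a).symm) (chartAt (Euc n) a).target := by
  have h1 : ContMDiffOn (𝓡 n) (𝓡 n) k (chartAt (Euc n) a).symm (chartAt (Euc n) a).target :=
    (contMDiffOn_chart_symm (n := ∞)).of_le hk
  exact contMDiffOn_iff_contDiffOn.1 (hf.comp_contMDiffOn h1)

theorem contDiffAt_comp_chart_symm {k : WithTop ℕ∞} (hk : k ≤ ∞) {f : M → V}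
    (hf : ContMDiff (𝓡 n) 𝓘(ℝ, V) k f) (a : M) {θ : Euc n}
    (hθ : θ ∈ (chartAt (Euc n) a).target) :
    ContDiffAt ℝ k (f ∘ (chartAt (Euc n) a).symm) θ :=
  (contDiffOn_comp_chart_symm hk hf a).contDiffAt ((isOpen_chart_target a).mem_nhds hθ)

theorem fderiv_comp_chart_symm {f : M → V} (hf : MDifferentiable (𝓡 n) 𝓘(ℝ, V) f) (a : M)
    {θ : Euc n} (hθ : θ ∈ (chartAt (Euc n) a).target) :
    fderiv ℝ (f ∘ (chartAt (Euc n) a).symm) θ =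
      (mfderiv (𝓡 n) 𝓘(ℝ, V) f ((chartAt (Euc n) a).symm θ)).comp
        (mfderiv (𝓡 n) (𝓡 n) (chartAt (Euc n) a).symm θ) := by
  rw [← mfderiv_eq_fderiv]
  exact mfderiv_comp θ (hf _)
    ((mdifferentiable_chart (I := 𝓡 n) a).mdifferentiableAt_symm hθ)

theorem injective_fderiv_comp_chart_symm {f : M → V}
    (hf : MDifferentiable (𝓡 n) 𝓘(ℝ, V) f)
    (hf' : ∀ p, Function.Injective (mfderiv (𝓡 n) 𝓘(ℝ, V) f p)) (a : M) {θ : Euc n}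
    (hθ : θ ∈ (chartAt (Euc n) a).target) :
    Function.Injective (fderiv ℝ (f ∘ (chartAt (Euc n) a).symm) θ) := by
  rw [fderiv_comp_chart_symm hf a hθ]
  exact (hf' _).comp ((mdifferentiable_chart (I := 𝓡 n) a).symm.mfderiv_injective hθ)

theorem contDiffAt_transition {a b : M} {θ : Euc n} (hθ : θ ∈ (chartAt (Euc n) a).target)
    (hb : (chartAt (Euc n) a).symm θ ∈ (chartAt (Euc n) b).source) :
    ContDiffAt ℝ ∞ (transition a b) θ := by
  have h1 : ContMDiffAt (𝓡 n) (𝓡 n) ∞ (chartAt (Euc n) a).symm θ :=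
    (contMDiffOn_chart_symm (n := ∞)).contMDiffAt ((isOpen_chart_target a).mem_nhds hθ)
  have h2 : ContMDiffAt (𝓡 n) (𝓡 n) ∞ (chartAt (Euc n) b) ((chartAt (Euc n) a).symm θ) :=
    (contMDiffOn_chart (n := ∞)).contMDiffAt ((chartAt (Euc n) b).open_source.mem_nhds hb)
  exact contMDiffAt_iff_contDiffAt.1 (h2.comp θ h1)

/-- `laplacian` is evaluated at each point in the chart chosen at that point. Invariance permits a
single chart for all points of its domain, which differentiation and integration require. -/
theorem laplacian_chart_symm {y : M → Euc (n + 1)} {f : M → V}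
    (hy : ContMDiff (𝓡 n) 𝓘(ℝ, Euc (n + 1)) 2 y)
    (hy' : ∀ p, Function.Injective (mfderiv (𝓡 n) 𝓘(ℝ, Euc (n + 1)) y p))
    (hf : ContMDiff (𝓡 n) 𝓘(ℝ, V) 2 f) (a : M) {θ : Euc n}
    (hθ : θ ∈ (chartAt (Euc n) a).target) :
    laplacian y f ((chartAt (Euc n) a).symm θ) =
      coordLaplacian (gramMetric (y ∘ (chartAt (Euc n) a).symm))
        (f ∘ (chartAt (Euc n) a).symm) θ := by
  set p := (chartAt (Euc n) a).symm θ with hp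
  have hb : p ∈ (chartAt (Euc n) p).source := mem_chart_source _ p
  have hb' : transition a p θ ∈ (chartAt (Euc n) p).target := transition_mem_target hb
  have hmd : MDifferentiable (𝓡 n) 𝓘(ℝ, Euc (n + 1)) y := hy.mdifferentiable (by simp)
  exact (coordLaplacian_comp (comp_chart_symm_eventuallyEq y hθ hb)
    (comp_chart_symm_eventuallyEq f hθ hb) (contDiffAt_comp_chart_symm two_le_infty hy p hb')
    (contDiffAt_comp_chart_symm two_le_infty hf p hb') ((contDiffAt_transition hθ hb).of_le two_le_infty)
    (injective_fderiv_comp_chart_symm hmd hy' a hθ)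
    (injective_fderiv_comp_chart_symm hmd hy' p hb')).symm

end Charts

/-! ### The tangential gradient in charts -/

theorem IsEmbeddingOfClass.mdifferentiable {n : ℕ} {M : Set (Euc (n + 1))}
    [ChartedSpace (Euc n) M] {k : WithTop ℕ∞} {y : M → Euc (n + 1)}
    (h : IsEmbeddingOfClass k y) (hk : k ≠ 0) :
    MDifferentiable (𝓡 n) 𝓘(ℝ, Euc (n + 1)) y :=
  h.contMDiff.mdifferentiable hk

theorem gramMetric_eq_mul {n m : ℕ} (Y : Euc n → Euc m) (θ : Euc n) :
    gramMetric Y θ = (jacobian Y θ)ᵀ * jacobian Y θ := by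
  ext i j
  rw [gramMetric_apply, Matrix.mul_apply, PiLp.inner_apply]
  refine Finset.sum_congr rfl fun k _ => ?_
  simp [jacobian_apply, mul_comm]

theorem coordGradient_apply {n : ℕ} {M : Set (Euc (n + 1))}
    {e : OpenPartialHomeomorph M (Euc n)} (W : Fin n → ℝ) (θ : Euc n)
    (β : Fin (n + 1)) :
    coordGradient e W θ β = ∑ j, (∑ i, W i * (gramMetric (incl M ∘ e.symm) θ)⁻¹ i j) *
      jacobian (incl M ∘ e.symm) θ β j := by
  rw [coordGradient, pullbackMetric_eq, Finset.sum_comm]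
  simp only [WithLp.ofLp_sum, WithLp.ofLp_smul, Finset.sum_apply, Pi.smul_apply, smul_eq_mul,
    Finset.sum_mul, jacobian_apply]
  exact Finset.sum_congr rfl fun j _ => Finset.sum_congr rfl fun i _ => by ring

section Gradient

variable {n : ℕ} {M : Set (Euc (n + 1))} [ChartedSpace (Euc n) M] [IsManifold (𝓡 n) ∞ M]

theorem IsEmbeddingOfClass.injective_fderiv {k : WithTop ℕ∞} {y : M → Euc (n + 1)}
    (h : IsEmbeddingOfClass k y) (hk : k ≠ 0) (a : M) {θ : Euc n}
    (hθ : θ ∈ (chartAt (Euc n) a).target) :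
    Function.Injective (fderiv ℝ (y ∘ (chartAt (Euc n) a).symm) θ) :=
  injective_fderiv_comp_chart_symm (h.mdifferentiable hk) h.immersion a hθ

/-- The tangential gradient is the contraction of the inverse metric with ∂f ⊗ ∂(inclusion), hence
independent of the chart by `sum_inv_smul_conj`. As for the Laplacian, this frees the formula from
the chart preferred at each point. -/
theorem tangGrad_chart_symm (hM : IsEmbeddingOfClass ∞ (incl M)) {f : M → ℝ}
    (hf : ContMDiff (𝓡 n) 𝓘(ℝ, ℝ) 1 f) (a : M) {θ : Euc n}
    (hθ : θ ∈ (chartAt (Euc n) a).target) :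
    tangGrad f ((chartAt (Euc n) a).symm θ) =
      coordGradient (chartAt (Euc n) a)
        (fun i => pd i (f ∘ (chartAt (Euc n) a).symm) θ) θ := by
  set p := (chartAt (Euc n) a).symm θ with hp
  have hb : p ∈ (chartAt (Euc n) p).source := mem_chart_source _ p
  have hb' : transition a p θ ∈ (chartAt (Euc n) p).target := transition_mem_target hb
  have h1 : (1 : WithTop ℕ∞) ≤ ∞ := by exact_mod_cast le_top
  have hI := comp_chart_symm_eventuallyEq (incl M) hθ hb
  have hΨ : DifferentiableAt ℝ (transition a p) θ :=
    (contDiffAt_transition hθ hb).differentiableAt (by simp)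
  have hId : DifferentiableAt ℝ (incl M ∘ (chartAt (Euc n) p).symm) (transition a p θ) :=
    (contDiffAt_comp_chart_symm le_rfl hM.contMDiff p hb').differentiableAt (by simp)
  have hfd : DifferentiableAt ℝ (f ∘ (chartAt (Euc n) p).symm) (transition a p θ) :=
    (contDiffAt_comp_chart_symm h1 hf p hb').differentiableAt (by simp)
  have hinj := hM.injective_fderiv (by simp) a hθ
  have hS := sum_inv_smul_conj (g := gramMetric (incl M ∘ (chartAt (Euc n) p).symm)
    (transition a p θ)) (isUnit_det_jacobian hI hId hΨ hinj) fun i j =>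
      pd i (f ∘ (chartAt (Euc n) p).symm) (transition a p θ) •
        pd j (incl M ∘ (chartAt (Euc n) p).symm) (transition a p θ)
  rw [← gramMetric_comp hI hId hΨ] at hS
  simp only [tangGrad, coordGradient, pullbackMetric_eq, mul_smul]
  refine hS.symm.trans ?_
  refine Finset.sum_congr rfl fun i _ => Finset.sum_congr rfl fun j _ => ?_
  rw [pd_congr hI, pd_congr (comp_chart_symm_eventuallyEq f hθ hb), pd_comp hId hΨ, pd_comp hfd hΨ]
  refine congrArg _ ?_
  rw [Finset.sum_smul]
  refine Finset.sum_congr rfl fun a _ => ?_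
  rw [Finset.smul_sum]
  refine Finset.sum_congr rfl fun b _ => ?_
  simp only [smul_smul, jacobian_apply, smul_eq_mul]
  ring_nf

theorem tangJac_chart_symm (hM : IsEmbeddingOfClass ∞ (incl M)) {f : M → Euc (n + 1)}
    (hf : ContMDiff (𝓡 n) 𝓘(ℝ, Euc (n + 1)) 1 f) (a : M) {θ : Euc n}
    (hθ : θ ∈ (chartAt (Euc n) a).target) :
    tangJac f ((chartAt (Euc n) a).symm θ) =
      jacobian (f ∘ (chartAt (Euc n) a).symm) θ *
        (gramMetric (incl M ∘ (chartAt (Euc n) a).symm) θ)⁻¹ *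
        (jacobian (incl M ∘ (chartAt (Euc n) a).symm) θ)ᵀ := by
  have hfd : DifferentiableAt ℝ (f ∘ (chartAt (Euc n) a).symm) θ :=
    (contDiffAt_comp_chart_symm (by exact_mod_cast le_top) hf a hθ).differentiableAt (by simp)
  ext κ β
  have hκ : ContMDiff (𝓡 n) 𝓘(ℝ, ℝ) 1 fun q => f q κ :=
    (EuclideanSpace.proj κ : Euc (n + 1) →L[ℝ] ℝ).contMDiff.comp hf
  rw [tangJac, Matrix.of_apply, tangGrad_chart_symm hM hκ a hθ, coordGradient_apply]
  simp only [Matrix.mul_apply, Matrix.transpose_apply]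
  refine Finset.sum_congr rfl fun j _ => ?_
  congr 1
  exact Finset.sum_congr rfl fun i _ => by rw [jacobian_apply, ← pd_apply hfd]; rfl

end Gradient

/-! ### The matrix representation of a metric -/

section MetricRep

variable {n m d : ℕ}

/-- The relations between the tangent vectors (the columns of `B`) and the unit normal `u`. -/
structure IsAdapted (B : Matrix (Fin d) (Fin n) ℝ) (u : Fin d → ℝ) : Prop where
  isUnit : IsUnit (Bᵀ * B).det
  unit : u ⬝ᵥ u = 1
  normal : Bᵀ *ᵥ u = 0
  complete : B * (Bᵀ * B)⁻¹ * Bᵀ + Matrix.vecMulVec u u = 1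

/-- The matrix of the tangential gradients of a map with the Jacobian matrix `Y`. -/
def tangMatrix (B : Matrix (Fin d) (Fin n) ℝ) (Y : Matrix (Fin m) (Fin n) ℝ) :
    Matrix (Fin m) (Fin d) ℝ :=
  Y * (Bᵀ * B)⁻¹ * Bᵀ

theorem tangMatrix_transpose (B : Matrix (Fin d) (Fin n) ℝ) (Y : Matrix (Fin m) (Fin n) ℝ) :
    (tangMatrix B Y)ᵀ = B * (Bᵀ * B)⁻¹ * Yᵀ := by
  rw [tangMatrix, Matrix.transpose_mul, Matrix.transpose_mul, Matrix.transpose_nonsing_inv,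
    Matrix.transpose_mul, Matrix.transpose_transpose, Matrix.mul_assoc]

variable {B : Matrix (Fin d) (Fin n) ℝ} {u : Fin d → ℝ}

theorem IsAdapted.tangMatrix_mul (hB : IsAdapted B u) (Y : Matrix (Fin m) (Fin n) ℝ) :
    tangMatrix B Y * B = Y := by
  rw [tangMatrix, Matrix.mul_assoc, Matrix.mul_assoc, Matrix.nonsing_inv_mul _ hB.isUnit,
    Matrix.mul_one]

theorem IsAdapted.mul_tangMatrix_transpose (hB : IsAdapted B u) (Y : Matrix (Fin m) (Fin n) ℝ) :
    Bᵀ * (tangMatrix B Y)ᵀ = Yᵀ := by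
  rw [← Matrix.transpose_mul, hB.tangMatrix_mul]

/-- Completeness turns u ⊗ u into 1 minus the tangential projection, so the matrix is 1 + BC with C
mapping into the n coordinates. Then det(1 + BC) = det(1 + CB), and 1 + CB = (BᵀB)⁻¹YᵀY. -/
theorem IsAdapted.det_mul_det (hB : IsAdapted B u) (Y : Matrix (Fin m) (Fin n) ℝ) :
    ((tangMatrix B Y)ᵀ * tangMatrix B Y + Matrix.vecMulVec u u).det * (Bᵀ * B).det =
      (Yᵀ * Y).det := by
  have h1 : (tangMatrix B Y)ᵀ * tangMatrix B Y + Matrix.vecMulVec u u =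
      1 + B * ((Bᵀ * B)⁻¹ * (Yᵀ * tangMatrix B Y - Bᵀ)) := by
    rw [← hB.complete, tangMatrix_transpose]
    simp only [Matrix.mul_sub, Matrix.mul_assoc]
    abel
  have h2 : (1 + (Bᵀ * B)⁻¹ * (Yᵀ * tangMatrix B Y - Bᵀ) * B) = (Bᵀ * B)⁻¹ * (Yᵀ * Y) := by
    rw [Matrix.mul_assoc, Matrix.sub_mul, Matrix.mul_assoc, hB.tangMatrix_mul, Matrix.mul_sub,
      Matrix.nonsing_inv_mul _ hB.isUnit, add_sub_cancel]
  rw [h1, Matrix.det_one_add_mul_comm, h2, mul_comm, ← Matrix.det_mul,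
    Matrix.mul_nonsing_inv_cancel_left _ _ hB.isUnit]

theorem contract_eq_trace (A J K : Matrix (Fin d) (Fin d) ℝ) :
    contract A J K = (J * A * Kᵀ).trace := by
  simp only [contract, Matrix.trace, Matrix.diag, Matrix.mul_apply, Matrix.transpose_apply,
    Finset.sum_mul, Finset.mul_sum]
  calc _ = ∑ β, ∑ κ, ∑ γ, A β γ * (J κ β * K κ γ) :=
        Finset.sum_congr rfl fun β _ => Finset.sum_comm
    _ = ∑ κ, ∑ β, ∑ γ, A β γ * (J κ β * K κ γ) := Finset.sum_comm
    _ = ∑ κ, ∑ γ, ∑ β, A β γ * (J κ β * K κ γ) :=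
        Finset.sum_congr rfl fun κ _ => Finset.sum_comm
    _ = _ := Finset.sum_congr rfl fun κ _ => Finset.sum_congr rfl fun γ _ =>
        Finset.sum_congr rfl fun β _ => by ring

/-- The matrix preserves the splitting into tangent space and normal line: it is the identity on the
line, and on the tangent space it represents the metric YᵀY. Each block is inverted separately; the
mixed products vanish since Bᵀu = 0. -/
theorem IsAdapted.inv_eq (hB : IsAdapted B u) {Y : Matrix (Fin m) (Fin n) ℝ}
    (hY : IsUnit (Yᵀ * Y).det) :
    ((tangMatrix B Y)ᵀ * tangMatrix B Y + Matrix.vecMulVec u u)⁻¹ =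
      B * (Yᵀ * Y)⁻¹ * Bᵀ + Matrix.vecMulVec u u := by
  have hU1 : Bᵀ * Matrix.vecMulVec u u = 0 := by
    rw [Matrix.mul_vecMulVec, hB.normal, Matrix.zero_vecMulVec]
  have hU2 : Matrix.vecMulVec u u * B = 0 := by
    rw [Matrix.vecMulVec_mul, ← Matrix.mulVec_transpose, hB.normal]
    ext i j
    simp [Matrix.vecMulVec_apply]
  have hU3 : Matrix.vecMulVec u u * Matrix.vecMulVec u u = Matrix.vecMulVec u u := by
    rw [Matrix.vecMulVec_mul_vecMulVec, hB.unit, one_smul]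
  refine Matrix.inv_eq_right_inv ?_
  have h1 : tangMatrix B Y * Matrix.vecMulVec u u = 0 := by
    rw [tangMatrix, Matrix.mul_assoc, hU1, Matrix.mul_zero]
  rw [Matrix.add_mul, Matrix.mul_add, Matrix.mul_add, hU3,
    Matrix.mul_assoc _ (tangMatrix B Y) (Matrix.vecMulVec u u), h1, Matrix.mul_zero, add_zero, ← Matrix.mul_assoc (Matrix.vecMulVec u u),
    ← Matrix.mul_assoc (Matrix.vecMulVec u u), hU2, Matrix.zero_mul, Matrix.zero_mul, zero_add,
    Matrix.mul_assoc _ (tangMatrix B Y), ← Matrix.mul_assoc (tangMatrix B Y),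
    ← Matrix.mul_assoc (tangMatrix B Y), hB.tangMatrix_mul, ← hB.complete, tangMatrix_transpose]
  congr 1
  rw [Matrix.mul_assoc _ Yᵀ, ← Matrix.mul_assoc Yᵀ, ← Matrix.mul_assoc Yᵀ,
    Matrix.mul_nonsing_inv _ hY, Matrix.one_mul]

/-- The normal block of the inverse is annihilated by tangential gradients, so the contraction
reduces to the coordinate expression of the Dirichlet form. -/
theorem IsAdapted.contract_eq (hB : IsAdapted B u) {Y : Matrix (Fin m) (Fin n) ℝ}
    (hY : IsUnit (Yᵀ * Y).det) (X W : Matrix (Fin d) (Fin n) ℝ) :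
    contract ((tangMatrix B Y)ᵀ * tangMatrix B Y + Matrix.vecMulVec u u)⁻¹
      (tangMatrix B X) (tangMatrix B W) = (X * (Yᵀ * Y)⁻¹ * Wᵀ).trace := by
  have hU1 : Bᵀ * Matrix.vecMulVec u u = 0 := by
    rw [Matrix.mul_vecMulVec, hB.normal, Matrix.zero_vecMulVec]
  have h1 : tangMatrix B X * Matrix.vecMulVec u u = 0 := by
    rw [tangMatrix, Matrix.mul_assoc, hU1, Matrix.mul_zero]
  rw [contract_eq_trace, hB.inv_eq hY, Matrix.mul_add, h1, add_zero, ← Matrix.mul_assoc,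
    ← Matrix.mul_assoc, hB.tangMatrix_mul, Matrix.mul_assoc _ Bᵀ, hB.mul_tangMatrix_transpose]

end MetricRep

end

end DeTurck

namespace DeTurck

noncomputable section

/-! ### The metric representation in charts -/

section MetricRepChart

variable {n : ℕ} {M : Set (Euc (n + 1))} [ChartedSpace (Euc n) M] [IsManifold (𝓡 n) ∞ M]

theorem one_le_infty : (1 : WithTop ℕ∞) ≤ ∞ :=
  WithTop.coe_le_coe.2 (le_top : (1 : ℕ∞) ≤ ⊤)

theorem inner_pd_normal {y : M → Euc (n + 1)} (hy : MDifferentiable (𝓡 n) 𝓘(ℝ, Euc (n + 1)) y)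
    (a : M) {θ : Euc n} (hθ : θ ∈ (chartAt (Euc n) a).target) {ν : Euc (n + 1)}
    (hν : IsUnitNormalAt y ((chartAt (Euc n) a).symm θ) ν) (i : Fin n) :
    inner ℝ (pd i (y ∘ (chartAt (Euc n) a).symm) θ) ν = 0 := by
  rw [real_inner_comm, pd, fderiv_comp_chart_symm hy a hθ]
  exact hν.2 _

theorem isAdapted_jacobian (hM : IsEmbeddingOfClass ∞ (incl M)) {μ : M → Euc (n + 1)}
    (hμ : ∀ p, IsUnitNormalAt (incl M) p (μ p)) (a : M) {θ : Euc n}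
    (hθ : θ ∈ (chartAt (Euc n) a).target) :
    IsAdapted (jacobian (incl M ∘ (chartAt (Euc n) a).symm) θ)
      (μ ((chartAt (Euc n) a).symm θ)).ofLp := by
  set I := incl M ∘ (chartAt (Euc n) a).symm with hI
  set ν := μ ((chartAt (Euc n) a).symm θ) with hν
  have hinj : Function.Injective (fderiv ℝ I θ) := hM.injective_fderiv (by simp) a hθ
  have hperp : ∀ i, inner ℝ (pd i I θ) ν = 0 :=
    inner_pd_normal (hM.mdifferentiable (by simp)) a hθ (hμ _)
  have hunit : IsUnit ((jacobian I θ)ᵀ * jacobian I θ).det := by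
    rw [← gramMetric_eq_mul]; exact isUnit_det_gramMetric hinj
  have hν0 : ν ≠ 0 := by
    intro h
    have := (hμ ((chartAt (Euc n) a).symm θ)).1
    rw [← hν, h] at this
    simp at this
  have huu : ν.ofLp ⬝ᵥ ν.ofLp = 1 := by
    have h : inner ℝ ν ν = 1 := by
      rw [real_inner_self_eq_norm_sq, (hμ _).1]; norm_num
    rw [← h, PiLp.inner_apply, dotProduct]
    simp [sq]
  have hnorm : (jacobian I θ)ᵀ *ᵥ ν.ofLp = 0 := by
    funext i
    rw [Pi.zero_apply, ← hperp i, PiLp.inner_apply, Matrix.mulVec, dotProduct]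
    exact Finset.sum_congr rfl fun k _ => by simp [jacobian_apply, mul_comm]
  refine ⟨hunit, huu, hnorm, ?_⟩
  set B := jacobian I θ with hB
  set P := B * (Bᵀ * B)⁻¹ * Bᵀ + Matrix.vecMulVec ν.ofLp ν.ofLp with hP
  -- Completeness: every column of P - 1 is orthogonal to the tangent vectors and to the normal, and
  -- therefore vanishes.
  have h1 : Bᵀ * (P - 1) = 0 := by
    rw [hP, Matrix.mul_sub, Matrix.mul_add, Matrix.mul_vecMulVec, hnorm, Matrix.zero_vecMulVec,
      add_zero, Matrix.mul_one, ← Matrix.mul_assoc, ← Matrix.mul_assoc,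
      Matrix.mul_nonsing_inv _ hunit, Matrix.one_mul, sub_self]
  have h2 : ν.ofLp ᵥ* (P - 1) = 0 := by
    rw [hP, Matrix.vecMul_sub, Matrix.vecMul_add, Matrix.vecMul_vecMulVec, huu,
      ← Matrix.vecMul_vecMul, ← Matrix.vecMul_vecMul, ← Matrix.mulVec_transpose B, hnorm]
    simp
  rw [← sub_eq_zero]
  ext i j
  have h3 : (WithLp.toLp 2 fun k => (P - 1) k j : Euc (n + 1)) = 0 := by
    refine eq_zero_of_inner_eq_zero hinj hν0 hperp (fun l => ?_) ?_
    · have := congrFun (congrFun h1 l) j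
      rw [Matrix.mul_apply] at this
      rw [PiLp.inner_apply]
      refine Eq.trans (Finset.sum_congr rfl fun k _ => ?_) this
      simp [B, jacobian_apply, mul_comm]
    · have := congrFun h2 j
      rw [Matrix.vecMul, dotProduct] at this
      rw [PiLp.inner_apply]
      refine Eq.trans (Finset.sum_congr rfl fun k _ => ?_) this
      simp [mul_comm]
  have h4 := congrArg (fun w : Euc (n + 1) => w i) h3
  simpa using h4

theorem tangJac_eq_tangMatrix (hM : IsEmbeddingOfClass ∞ (incl M)) {f : M → Euc (n + 1)}
    (hf : ContMDiff (𝓡 n) 𝓘(ℝ, Euc (n + 1)) 1 f) (a : M) {θ : Euc n}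
    (hθ : θ ∈ (chartAt (Euc n) a).target) :
    tangJac f ((chartAt (Euc n) a).symm θ) =
      tangMatrix (jacobian (incl M ∘ (chartAt (Euc n) a).symm) θ)
        (jacobian (f ∘ (chartAt (Euc n) a).symm) θ) := by
  rw [tangJac_chart_symm hM hf a hθ, gramMetric_eq_mul, tangMatrix]

/-- No continuity of μ is assumed. Its square μ ⊗ μ is nevertheless determined by the tangent
spaces, as the complement of the projection ∇_M id, and this form makes the continuity of Ĝ
available. -/
theorem vecMulVec_normal_eq (hM : IsEmbeddingOfClass ∞ (incl M)) {μ : M → Euc (n + 1)}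
    (hμ : ∀ p, IsUnitNormalAt (incl M) p (μ p)) (p : M) :
    Matrix.vecMulVec (μ p).ofLp (μ p).ofLp = 1 - tangJac (incl M) p := by
  have hθ : chartAt (Euc n) p p ∈ (chartAt (Euc n) p).target :=
    (chartAt (Euc n) p).map_source (mem_chart_source _ p)
  have h1 := isAdapted_jacobian hM hμ p hθ
  have h2 := tangJac_eq_tangMatrix hM (hM.contMDiff.of_le one_le_infty) p hθ
  rw [(chartAt (Euc n) p).left_inv (mem_chart_source _ p)] at h1 h2
  rw [h2, ← h1.complete, tangMatrix, add_sub_cancel_left]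

theorem continuousOn_jacobian {Y : Euc n → Euc (n + 1)} {s : Set (Euc n)} (hs : IsOpen s)
    (hY : ContDiffOn ℝ 1 Y s) : ContinuousOn (jacobian Y) s := by
  refine continuousOn_pi.2 fun κ => continuousOn_pi.2 fun i => ?_
  exact (EuclideanSpace.proj κ : Euc (n + 1) →L[ℝ] ℝ).continuous.comp_continuousOn
    (ContDiffOn.pd (k := 0) hs hY (by simp) i).continuousOn

theorem continuousOn_tangMatrix {X : Type*} [TopologicalSpace X] {d m k : ℕ} {s : Set X}
    {B : X → Matrix (Fin d) (Fin k) ℝ} {Y : X → Matrix (Fin m) (Fin k) ℝ}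
    (hB : ContinuousOn B s) (hY : ContinuousOn Y s) (hdet : ∀ x ∈ s, ((B x)ᵀ * B x).det ≠ 0) :
    ContinuousOn (fun x => tangMatrix (B x) (Y x)) s := by
  rw [continuousOn_iff_continuous_domRestrict] at hB hY ⊢
  have hB' : Continuous fun x : s => B x := hB
  have hY' : Continuous fun x : s => Y x := hY
  have hBB : Continuous fun x : s => (B x)ᵀ * B x := hB'.matrix_transpose.matrix_mul hB'
  have hinv : Continuous fun x : s => ((B x)ᵀ * B x)⁻¹ := by
    simp only [Matrix.inv_def, Ring.inverse_eq_inv']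
    exact (hBB.matrix_det.inv₀ fun x => hdet x x.2).smul hBB.matrix_adjugate
  exact (hY'.matrix_mul hinv).matrix_mul hB'.matrix_transpose

theorem continuous_tangJac (hM : IsEmbeddingOfClass ∞ (incl M)) {f : M → Euc (n + 1)}
    (hf : ContMDiff (𝓡 n) 𝓘(ℝ, Euc (n + 1)) 1 f) : Continuous (tangJac f) := by
  refine continuous_of_continuousOn_charts fun a => ?_
  have hI := contDiffOn_comp_chart_symm one_le_infty (hM.contMDiff.of_le one_le_infty) a
  have hB := continuousOn_jacobian (isOpen_chart_target a) hI
  have hX := continuousOn_jacobian (isOpen_chart_target a)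
    (contDiffOn_comp_chart_symm one_le_infty hf a)
  exact (continuousOn_tangMatrix hB hX fun θ hθ => by
    rw [← gramMetric_eq_mul]
    exact (isUnit_det_gramMetric (hM.injective_fderiv (by simp) a hθ)).ne_zero).congr
    fun θ hθ => tangJac_eq_tangMatrix hM hf a hθ

theorem continuous_metricRep (hM : IsEmbeddingOfClass ∞ (incl M)) {μ : M → Euc (n + 1)}
    (hμ : ∀ p, IsUnitNormalAt (incl M) p (μ p)) {y : M → Euc (n + 1)}
    (hy : ContMDiff (𝓡 n) 𝓘(ℝ, Euc (n + 1)) 1 y) : Continuous (metricRep μ y) := by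
  have h : metricRep μ y = fun p => (tangJac y p)ᵀ * tangJac y p + (1 - tangJac (incl M) p) := by
    funext p
    rw [metricRep, vecMulVec_normal_eq hM hμ]
  rw [h]
  have h1 := continuous_tangJac hM hy
  have h2 := continuous_tangJac hM (hM.contMDiff.of_le one_le_infty)
  fun_prop

theorem metricRep_chart_symm (hM : IsEmbeddingOfClass ∞ (incl M)) (μ : M → Euc (n + 1))
    {y : M → Euc (n + 1)} (hy : ContMDiff (𝓡 n) 𝓘(ℝ, Euc (n + 1)) 1 y) (a : M) {θ : Euc n}
    (hθ : θ ∈ (chartAt (Euc n) a).target) :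
    metricRep μ y ((chartAt (Euc n) a).symm θ) =
      (tangMatrix (jacobian (incl M ∘ (chartAt (Euc n) a).symm) θ)
        (jacobian (y ∘ (chartAt (Euc n) a).symm) θ))ᵀ *
      tangMatrix (jacobian (incl M ∘ (chartAt (Euc n) a).symm) θ)
        (jacobian (y ∘ (chartAt (Euc n) a).symm) θ) +
      Matrix.vecMulVec (μ ((chartAt (Euc n) a).symm θ)).ofLp
        (μ ((chartAt (Euc n) a).symm θ)).ofLp := by
  rw [metricRep, tangJac_eq_tangMatrix hM hy a hθ]

theorem det_metricRep_mul (hM : IsEmbeddingOfClass ∞ (incl M)) {μ : M → Euc (n + 1)}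
    (hμ : ∀ p, IsUnitNormalAt (incl M) p (μ p)) {y : M → Euc (n + 1)}
    (hy : ContMDiff (𝓡 n) 𝓘(ℝ, Euc (n + 1)) 1 y) (a : M) {θ : Euc n}
    (hθ : θ ∈ (chartAt (Euc n) a).target) :
    (metricRep μ y ((chartAt (Euc n) a).symm θ)).det *
      (gramMetric (incl M ∘ (chartAt (Euc n) a).symm) θ).det =
      (gramMetric (y ∘ (chartAt (Euc n) a).symm) θ).det := by
  rw [metricRep_chart_symm hM μ hy a hθ, gramMetric_eq_mul, gramMetric_eq_mul,
    (isAdapted_jacobian hM hμ a hθ).det_mul_det]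

/-- In a chart det Ĝ is the quotient of the Gram determinants of y and of the inclusion, both
positive for immersions. -/
theorem det_metricRep_pos (hM : IsEmbeddingOfClass ∞ (incl M)) {μ : M → Euc (n + 1)}
    (hμ : ∀ p, IsUnitNormalAt (incl M) p (μ p)) {y : M → Euc (n + 1)}
    (hy : ContMDiff (𝓡 n) 𝓘(ℝ, Euc (n + 1)) 1 y)
    (hy' : ∀ p, Function.Injective (mfderiv (𝓡 n) 𝓘(ℝ, Euc (n + 1)) y p)) (p : M) :
    0 < (metricRep μ y p).det := by
  have hθ : chartAt (Euc n) p p ∈ (chartAt (Euc n) p).target :=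
    (chartAt (Euc n) p).map_source (mem_chart_source _ p)
  have h := det_metricRep_mul hM hμ hy p hθ
  rw [(chartAt (Euc n) p).left_inv (mem_chart_source _ p)] at h
  have h1 := (posDef_gramMetric (hM.injective_fderiv (by simp) p hθ)).det_pos
  have h2 := (posDef_gramMetric
    (injective_fderiv_comp_chart_symm (hy.mdifferentiable (by simp)) hy' p hθ)).det_pos
  rw [← h] at h2
  exact (mul_pos_iff_of_pos_right h1).1 h2

/-- The factor √det Ĝ converts do_h into the area element of the metric induced by y. -/
theorem sqrt_det_metricRep_mul (hM : IsEmbeddingOfClass ∞ (incl M)) {μ : M → Euc (n + 1)}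
    (hμ : ∀ p, IsUnitNormalAt (incl M) p (μ p)) {y : M → Euc (n + 1)}
    (hy : ContMDiff (𝓡 n) 𝓘(ℝ, Euc (n + 1)) 1 y) (a : M) {θ : Euc n}
    (hθ : θ ∈ (chartAt (Euc n) a).target) :
    √(metricRep μ y ((chartAt (Euc n) a).symm θ)).det *
      √(gramMetric (incl M ∘ (chartAt (Euc n) a).symm) θ).det =
      √(gramMetric (y ∘ (chartAt (Euc n) a).symm) θ).det := by
  rw [← det_metricRep_mul hM hμ hy a hθ, Real.sqrt_mul']
  exact (posDef_gramMetric (hM.injective_fderiv (by simp) a hθ)).det_pos.le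

/-- The Dirichlet form in a chart. -/
theorem contract_metricRep_chart (hM : IsEmbeddingOfClass ∞ (incl M)) {μ : M → Euc (n + 1)}
    (hμ : ∀ p, IsUnitNormalAt (incl M) p (μ p)) {y f : M → Euc (n + 1)}
    (hy : ContMDiff (𝓡 n) 𝓘(ℝ, Euc (n + 1)) 1 y)
    (hy' : ∀ p, Function.Injective (mfderiv (𝓡 n) 𝓘(ℝ, Euc (n + 1)) y p))
    (hf : ContMDiff (𝓡 n) 𝓘(ℝ, Euc (n + 1)) 1 f) (a : M) {θ : Euc n}
    (hθ : θ ∈ (chartAt (Euc n) a).target) {K : Matrix (Fin (n + 1)) (Fin (n + 1)) ℝ}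
    {W : Fin (n + 1) → Fin n → ℝ}
    (hK : ∀ κ β, K κ β = coordGradient (chartAt (Euc n) a) (W κ) θ β) :
    √(gramMetric (y ∘ (chartAt (Euc n) a).symm) θ).det *
      contract (metricRep μ y ((chartAt (Euc n) a).symm θ))⁻¹
        (tangJac f ((chartAt (Euc n) a).symm θ)) K =
      ∑ κ, ∑ j, gradDensity (y ∘ (chartAt (Euc n) a).symm) (f ∘ (chartAt (Euc n) a).symm) j θ κ *
        W κ j := by
  have hK' : K = tangMatrix (jacobian (incl M ∘ (chartAt (Euc n) a).symm) θ) (Matrix.of W) := by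
    ext κ β
    rw [hK, coordGradient_apply, tangMatrix, Matrix.mul_apply, gramMetric_eq_mul]
    rfl
  have hY : IsUnit ((jacobian (y ∘ (chartAt (Euc n) a).symm) θ)ᵀ *
      jacobian (y ∘ (chartAt (Euc n) a).symm) θ).det := by
    rw [← gramMetric_eq_mul]
    exact isUnit_det_gramMetric
      (injective_fderiv_comp_chart_symm (hy.mdifferentiable (by simp)) hy' a hθ)
  rw [metricRep_chart_symm hM μ hy a hθ, tangJac_eq_tangMatrix hM hf a hθ, hK',
    (isAdapted_jacobian hM hμ a hθ).contract_eq hY, ← gramMetric_eq_mul, Matrix.trace,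
    Finset.mul_sum]
  refine Finset.sum_congr rfl fun κ _ => ?_
  rw [Matrix.diag, Matrix.mul_apply, Finset.mul_sum]
  refine Finset.sum_congr rfl fun j _ => ?_
  simp only [gradDensity, WithLp.ofLp_sum, WithLp.ofLp_smul, Finset.sum_apply, Pi.smul_apply,
    smul_eq_mul, Matrix.mul_apply, Matrix.transpose_apply, Matrix.of_apply, jacobian_apply,
    Finset.sum_mul, Finset.mul_sum]
  exact Finset.sum_congr rfl fun i _ => by ring

theorem sqrt_det_mul_laplacian {y f : M → Euc (n + 1)}
    (hy : ContMDiff (𝓡 n) 𝓘(ℝ, Euc (n + 1)) 2 y)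
    (hy' : ∀ p, Function.Injective (mfderiv (𝓡 n) 𝓘(ℝ, Euc (n + 1)) y p))
    (hf : ContMDiff (𝓡 n) 𝓘(ℝ, Euc (n + 1)) 2 f) (a : M) {θ : Euc n}
    (hθ : θ ∈ (chartAt (Euc n) a).target) :
    √(gramMetric (y ∘ (chartAt (Euc n) a).symm) θ).det •
      laplacian y f ((chartAt (Euc n) a).symm θ) =
      ∑ j, pd j (gradDensity (y ∘ (chartAt (Euc n) a).symm) (f ∘ (chartAt (Euc n) a).symm) j) θ := by
  rw [laplacian_chart_symm hy hy' hf a hθ, sum_pd_gradDensity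
    (contDiffAt_comp_chart_symm two_le_infty hy a hθ)
    (injective_fderiv_comp_chart_symm (hy.mdifferentiable (by simp)) hy' a hθ)
    (contDiffAt_comp_chart_symm two_le_infty hf a hθ)]

/-- Continuity is not evident from the definition, whose chart varies with the point. In a fixed
chart the Laplacian is the divergence of a C¹ field divided by a positive continuous density. -/
theorem continuous_laplacian {y f : M → Euc (n + 1)}
    (hy : ContMDiff (𝓡 n) 𝓘(ℝ, Euc (n + 1)) 2 y)
    (hy' : ∀ p, Function.Injective (mfderiv (𝓡 n) 𝓘(ℝ, Euc (n + 1)) y p))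
    (hf : ContMDiff (𝓡 n) 𝓘(ℝ, Euc (n + 1)) 2 f) : Continuous (laplacian y f) := by
  refine continuous_of_continuousOn_charts fun a => ?_
  set T := (chartAt (Euc n) a).target with hT
  have hinj : ∀ θ ∈ T, Function.Injective (fderiv ℝ (y ∘ (chartAt (Euc n) a).symm) θ) :=
    fun θ hθ => injective_fderiv_comp_chart_symm (hy.mdifferentiable (by simp)) hy' a hθ
  have hyc : ∀ θ ∈ T, ContDiffAt ℝ 2 (y ∘ (chartAt (Euc n) a).symm) θ := fun θ hθ =>
    contDiffAt_comp_chart_symm two_le_infty hy a hθ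
  have hfc : ∀ θ ∈ T, ContDiffAt ℝ 2 (f ∘ (chartAt (Euc n) a).symm) θ := fun θ hθ =>
    contDiffAt_comp_chart_symm two_le_infty hf a hθ
  have h1 : ContinuousOn (fun θ => (√(gramMetric (y ∘ (chartAt (Euc n) a).symm) θ).det)⁻¹ •
      ∑ j, pd j (gradDensity (y ∘ (chartAt (Euc n) a).symm) (f ∘ (chartAt (Euc n) a).symm) j) θ)
      T := by
    have hs : ContinuousOn (fun θ => √(gramMetric (y ∘ (chartAt (Euc n) a).symm) θ).det) T :=
      fun θ hθ => (contDiffAt_sqrt_det (hyc θ hθ) (hinj θ hθ)).continuousAt.continuousWithinAt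
    have hs0 : ∀ θ ∈ T, √(gramMetric (y ∘ (chartAt (Euc n) a).symm) θ).det ≠ 0 := fun θ hθ =>
      (Real.sqrt_pos.2 (posDef_gramMetric (hinj θ hθ)).det_pos).ne'
    refine (hs.inv₀ hs0).smul (continuousOn_finsetSum _ fun j _ θ hθ => ?_)
    have h := ContDiffAt.pd (k := 0)
      (contDiffAt_gradDensity (hyc θ hθ) (hinj θ hθ) (hfc θ hθ) j) (by simp) j
    exact h.continuousAt.continuousWithinAt
  refine h1.congr fun θ hθ => ?_
  beta_reduce
  rw [← sqrt_det_mul_laplacian hy hy' hf a hθ, inv_smul_smul₀]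
  · rfl
  · exact (Real.sqrt_pos.2 (posDef_gramMetric (hinj θ hθ)).det_pos).ne'

end MetricRepChart

end

end DeTurck

namespace DeTurck

noncomputable section

/-! ### The surface measure in charts -/

section Partition

variable {n : ℕ} (M : Set (Euc (n + 1))) [ChartedSpace (Euc n) M] [IsManifold (𝓡 n) ∞ M]
  [CompactSpace M]

theorem tsupport_chartPartition_subset (a : M) :
    tsupport (chartPartition M a) ⊆ (chartAt (Euc n) a).source :=
  (SmoothPartitionOfUnity.exists_isSubordinate_chartAt_source (𝓡 n) M).choose_spec a

theorem finite_chartPartition_support :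
    {a : M | (Function.support (chartPartition M a)).Nonempty}.Finite :=
  (chartPartition M).locallyFinite.finite_nonempty_of_compact

/-- The charts that contribute to the partition of unity. -/
def activeCharts : Finset M := (finite_chartPartition_support M).toFinset

variable {M}

theorem chartPartition_eq_zero {a : M} (ha : a ∉ activeCharts M) (p : M) :
    chartPartition M a p = 0 := by
  by_contra h
  exact ha ((finite_chartPartition_support M).mem_toFinset.2 ⟨p, h⟩)

theorem sum_chartPartition (p : M) : ∑ a ∈ activeCharts M, chartPartition M a p = 1 := by
  refine (chartPartition M).sum_finsupport' p (mem_univ p) fun a ha => ?_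
  by_contra h
  exact ((chartPartition M).mem_finsupport p).1 ha (chartPartition_eq_zero h p)

theorem chartPartition_eq_zero_of_notMem_source {a p : M}
    (hp : p ∉ (chartAt (Euc n) a).source) : chartPartition M a p = 0 :=
  image_eq_zero_of_notMem_tsupport fun h => hp (tsupport_chartPartition_subset M a h)

theorem contMDiff_chartPartition (a : M) :
    ContMDiff (𝓡 n) 𝓘(ℝ, ℝ) ∞ (chartPartition M a) := (chartPartition M a).contMDiff

end Partition

theorem measurableSet_target_inter_preimage {n : ℕ} {M : Set (Euc (n + 1))}
    [ChartedSpace (Euc n) M] (a : M) {s : Set M} (hs : MeasurableSet s) :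
    MeasurableSet ((chartAt (Euc n) a).target ∩ (chartAt (Euc n) a).symm ⁻¹' s) := by
  have hm : Measurable fun θ : (chartAt (Euc n) a).target => (chartAt (Euc n) a).symm θ :=
    (continuousOn_iff_continuous_domRestrict.1 (chartAt (Euc n) a).continuousOn_symm).measurable
  have h := (isOpen_chart_target a).measurableSet.subtype_image (hm hs)
  convert h using 1
  ext θ
  simp [and_comm]

theorem det_fderiv_eq {n : ℕ} {f : Euc n → Euc n} {θ : Euc n} :
    (fderiv ℝ f θ).det = (jacobian f θ).det := by
  have h : LinearMap.toMatrix (EuclideanSpace.basisFun (Fin n) ℝ).toBasis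
      (EuclideanSpace.basisFun (Fin n) ℝ).toBasis (fderiv ℝ f θ : Euc n →ₗ[ℝ] Euc n) =
      jacobian f θ := by
    ext i j
    simp [LinearMap.toMatrix_apply, jacobian_apply, pd]
  rw [ContinuousLinearMap.det, ← h, LinearMap.det_toMatrix]

/-! ### Transition maps and push-forward of measures from charts -/

section Transition

variable {n : ℕ} {M : Set (Euc (n + 1))} [ChartedSpace (Euc n) M]

theorem image_transition (a b : M) {s : Set M} (hs : s ⊆ (chartAt (Euc n) a).source) :
    transition b a '' ((chartAt (Euc n) b).target ∩ (chartAt (Euc n) b).symm ⁻¹' s) =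
      (chartAt (Euc n) a).target ∩
        (chartAt (Euc n) a).symm ⁻¹' (s ∩ (chartAt (Euc n) b).source) := by
  ext θ
  constructor
  · rintro ⟨ϑ, ⟨h1, h2⟩, rfl⟩
    have h3 := hs h2
    refine ⟨transition_mem_target h3, ?_⟩
    simp only [transition, mem_preimage, Function.comp, (chartAt (Euc n) a).left_inv h3]
    exact ⟨h2, (chartAt (Euc n) b).map_target h1⟩
  · rintro ⟨h1, h2, h3⟩
    refine ⟨chartAt (Euc n) b ((chartAt (Euc n) a).symm θ),
      ⟨(chartAt (Euc n) b).map_source h3, ?_⟩, ?_⟩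
    · rw [mem_preimage, (chartAt (Euc n) b).left_inv h3]; exact h2
    · simp only [transition, Function.comp, (chartAt (Euc n) b).left_inv h3]
      exact (chartAt (Euc n) a).right_inv h1

theorem injOn_transition (a b : M) {s : Set M} (hs : s ⊆ (chartAt (Euc n) a).source) :
    InjOn (transition b a) ((chartAt (Euc n) b).target ∩ (chartAt (Euc n) b).symm ⁻¹' s) :=
  fun _ h1 _ h2 h => (chartAt (Euc n) b).symm.injOn h1.1 h2.1
    ((chartAt (Euc n) a).injOn (hs h1.2) (hs h2.2) h)

theorem aemeasurable_chart_symm (a : M) (w : Euc n → ENNReal) :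
    AEMeasurable (chartAt (Euc n) a).symm
      (((volume : Measure (Euc n)).restrict (chartAt (Euc n) a).target).withDensity w) :=
  ((chartAt (Euc n) a).continuousOn_symm.aemeasurable
    (isOpen_chart_target a).measurableSet).mono_ac (withDensity_absolutelyContinuous _ _)

theorem map_withDensity_apply (a : M) (w : Euc n → ENNReal) {s : Set M} (hs : MeasurableSet s) :
    ((((volume : Measure (Euc n)).restrict (chartAt (Euc n) a).target).withDensity w).map
      (chartAt (Euc n) a).symm) s =
      ∫⁻ θ in (chartAt (Euc n) a).target ∩ (chartAt (Euc n) a).symm ⁻¹' s, w θ := by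
  rw [Measure.map_apply_of_aemeasurable (aemeasurable_chart_symm a w) hs, withDensity_apply',
    Measure.restrict_restrict' (isOpen_chart_target a).measurableSet, inter_comm]

end Transition

section SurfaceMeasure

variable {n : ℕ} {M : Set (Euc (n + 1))} [ChartedSpace (Euc n) M] [IsManifold (𝓡 n) ∞ M]

/-- The density `√det h` of the surface measure in the chart at `a`. -/
def areaDensity (a : M) (θ : Euc n) : ℝ :=
  √(gramMetric (incl M ∘ (chartAt (Euc n) a).symm) θ).det

theorem areaDensity_pos (hM : IsEmbeddingOfClass ∞ (incl M)) (a : M) {θ : Euc n}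
    (hθ : θ ∈ (chartAt (Euc n) a).target) : 0 < areaDensity a θ :=
  Real.sqrt_pos.2 (posDef_gramMetric (hM.injective_fderiv (by simp) a hθ)).det_pos

theorem continuousOn_areaDensity (hM : IsEmbeddingOfClass ∞ (incl M)) (a : M) :
    ContinuousOn (areaDensity a) (chartAt (Euc n) a).target := fun _ hθ =>
  (contDiffAt_sqrt_det (contDiffAt_comp_chart_symm two_le_infty
    (hM.contMDiff.of_le two_le_infty) a hθ)
    (hM.injective_fderiv (by simp) a hθ)).continuousAt.continuousWithinAt

/-- The Gram matrix transforms as JᵀGJ, so its determinant acquires (det J)², whose root is |det J|.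
This is the factor of the change of variables. -/
theorem areaDensity_transition (hM : IsEmbeddingOfClass ∞ (incl M)) {a b : M} {θ : Euc n}
    (hθ : θ ∈ (chartAt (Euc n) b).target)
    (ha : (chartAt (Euc n) b).symm θ ∈ (chartAt (Euc n) a).source) :
    areaDensity b θ = |(fderiv ℝ (transition b a) θ).det| * areaDensity a (transition b a θ) := by
  have hI := comp_chart_symm_eventuallyEq (incl M) hθ ha
  have hΨ : DifferentiableAt ℝ (transition b a) θ :=
    (contDiffAt_transition hθ ha).differentiableAt (by simp)
  have hId : DifferentiableAt ℝ (incl M ∘ (chartAt (Euc n) a).symm) (transition b a θ) :=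
    (contDiffAt_comp_chart_symm le_rfl hM.contMDiff a
      (transition_mem_target ha)).differentiableAt (by simp)
  rw [areaDensity, gramMetric_comp hI hId hΨ, det_fderiv_eq, Matrix.det_mul, Matrix.det_mul,
    Matrix.det_transpose, areaDensity, mul_right_comm, Real.sqrt_mul (mul_self_nonneg _),
    Real.sqrt_mul_self_eq_abs]

/-- The change of variables between two charts. -/
theorem lintegral_areaDensity_chart (hM : IsEmbeddingOfClass ∞ (incl M)) (a b : M) {s : Set M}
    (hs : MeasurableSet s) (hsa : s ⊆ (chartAt (Euc n) a).source) {u : M → ℝ}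
    (hub : ∀ p ∉ (chartAt (Euc n) b).source, u p = 0) :
    ∫⁻ θ in (chartAt (Euc n) b).target ∩ (chartAt (Euc n) b).symm ⁻¹' s,
        ENNReal.ofReal (u ((chartAt (Euc n) b).symm θ) * areaDensity b θ) =
      ∫⁻ θ in (chartAt (Euc n) a).target ∩ (chartAt (Euc n) a).symm ⁻¹' s,
        ENNReal.ofReal (u ((chartAt (Euc n) a).symm θ) * areaDensity a θ) := by
  set A := (chartAt (Euc n) b).target ∩ (chartAt (Euc n) b).symm ⁻¹' s with hA
  have hAm : MeasurableSet A := measurableSet_target_inter_preimage b hs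
  have hcv := lintegral_image_eq_lintegral_abs_det_fderiv_mul volume hAm
    (fun θ hθ => ((contDiffAt_transition hθ.1 (hsa hθ.2)).differentiableAt
      (by simp)).hasFDerivAt.hasFDerivWithinAt) (injOn_transition a b hsa)
    (fun θ => ENNReal.ofReal (u ((chartAt (Euc n) a).symm θ) * areaDensity a θ))
  have h1 : ∫⁻ θ in A, ENNReal.ofReal (u ((chartAt (Euc n) b).symm θ) * areaDensity b θ) =
      ∫⁻ θ in A, ENNReal.ofReal |(fderiv ℝ (transition b a) θ).det| *
        ENNReal.ofReal (u ((chartAt (Euc n) a).symm (transition b a θ)) *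
          areaDensity a (transition b a θ)) := by
    refine setLIntegral_congr_fun hAm fun θ hθ => ?_
    have h2 : (chartAt (Euc n) a).symm (transition b a θ) = (chartAt (Euc n) b).symm θ :=
      (chartAt (Euc n) a).left_inv (hsa hθ.2)
    simp only [h2]
    rw [← ENNReal.ofReal_mul (abs_nonneg _), areaDensity_transition hM hθ.1 (hsa hθ.2)]
    congr 1
    ring
  -- The change of variables only covers the overlap of the two charts. Since u vanishes off the
  -- source of the chart at b, the domain may be enlarged to the full preimage of s in the chart at
  -- a.
  rw [h1, ← hcv, hA, image_transition a b hsa,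
    ← lintegral_indicator (measurableSet_target_inter_preimage a
      (hs.inter (chartAt (Euc n) b).open_source.measurableSet)),
    ← lintegral_indicator (measurableSet_target_inter_preimage a hs)]
  congr 1
  funext θ
  by_cases h3 : (chartAt (Euc n) a).symm θ ∈ (chartAt (Euc n) b).source
  · classical
    simp only [indicator_apply]
    exact if_congr ⟨fun h => ⟨h.1, h.2.1⟩, fun h => ⟨h.1, h.2, h3⟩⟩ rfl rfl
  · simp only [indicator, hub _ h3, zero_mul, ENNReal.ofReal_zero, ite_self]

theorem aemeasurable_areaDensity (hM : IsEmbeddingOfClass ∞ (incl M)) (a : M) :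
    AEMeasurable (fun θ => ENNReal.ofReal (areaDensity a θ))
      ((volume : Measure (Euc n)).restrict (chartAt (Euc n) a).target) :=
  ((continuousOn_areaDensity hM a).aemeasurable
    (isOpen_chart_target a).measurableSet).ennreal_ofReal

variable [CompactSpace M]

/-- The measure is assembled from pieces living in different charts. For a set inside one chart
every piece is transported to that chart, where the weights of the partition of unity add up to 1.
-/
theorem surfaceMeasure_apply (hM : IsEmbeddingOfClass ∞ (incl M)) (a : M) {s : Set M}
    (hs : MeasurableSet s) (hsa : s ⊆ (chartAt (Euc n) a).source) :
    surfaceMeasure M s = ∫⁻ θ in (chartAt (Euc n) a).target ∩ (chartAt (Euc n) a).symm ⁻¹' s,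
      ENNReal.ofReal (areaDensity a θ) := by
  have hcont : ∀ b : M, ContinuousOn
      (fun θ => chartPartition M b ((chartAt (Euc n) a).symm θ) * areaDensity a θ)
      (chartAt (Euc n) a).target := fun b =>
    ((contMDiff_chartPartition b).continuous.comp_continuousOn
      (chartAt (Euc n) a).continuousOn_symm).mul (continuousOn_areaDensity hM a)
  have hAm := measurableSet_target_inter_preimage a hs
  have h1 : ∀ b : M, ((((volume : Measure (Euc n)).restrict
      (chartAt (Euc n) b).target).withDensity fun θ =>
      ENNReal.ofReal (chartPartition M b ((chartAt (Euc n) b).symm θ) *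
        √(pullbackMetric (incl M) (chartAt (Euc n) b) θ).det)).map (chartAt (Euc n) b).symm) s =
      ∫⁻ θ in (chartAt (Euc n) a).target ∩ (chartAt (Euc n) a).symm ⁻¹' s,
        ENNReal.ofReal (chartPartition M b ((chartAt (Euc n) a).symm θ) * areaDensity a θ) := by
    intro b
    rw [map_withDensity_apply b _ hs]
    exact lintegral_areaDensity_chart hM a b hs hsa
      fun p hp => chartPartition_eq_zero_of_notMem_source hp
  rw [surfaceMeasure, riemannianMeasure, Measure.sum_apply _ hs]
  simp only [h1]
  rw [tsum_eq_sum (s := activeCharts M) fun b hb => by simp [chartPartition_eq_zero hb],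
    ← lintegral_finsetSum' _ fun b _ => (((hcont b).mono inter_subset_left).aemeasurable
      hAm).ennreal_ofReal]
  refine setLIntegral_congr_fun hAm fun θ hθ => ?_
  rw [← ENNReal.ofReal_sum_of_nonneg fun b _ => mul_nonneg ((chartPartition M).nonneg b _)
    (areaDensity_pos hM a hθ.1).le, ← Finset.sum_mul, sum_chartPartition, one_mul]

theorem surfaceMeasure_restrict_source (hM : IsEmbeddingOfClass ∞ (incl M)) (a : M) :
    (surfaceMeasure M).restrict (chartAt (Euc n) a).source =
      (((volume : Measure (Euc n)).restrict (chartAt (Euc n) a).target).withDensity fun θ =>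
        ENNReal.ofReal (areaDensity a θ)).map (chartAt (Euc n) a).symm := by
  have hsm := (chartAt (Euc n) a).open_source.measurableSet
  ext s hs
  rw [Measure.restrict_apply hs, surfaceMeasure_apply hM a (hs.inter hsm) inter_subset_right,
    map_withDensity_apply a _ hs]
  congr 2
  ext θ
  constructor
  · exact fun h => ⟨h.1, h.2.1⟩
  · exact fun h => ⟨h.1, h.2, (chartAt (Euc n) a).map_target h.1⟩

/-- The integral of a function that vanishes outside the domain of a chart. -/
theorem integral_surfaceMeasure_eq (hM : IsEmbeddingOfClass ∞ (incl M)) (a : M) {f : M → ℝ}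
    (hf : AEStronglyMeasurable f (surfaceMeasure M))
    (hfa : ∀ p ∉ (chartAt (Euc n) a).source, f p = 0) :
    ∫ p, f p ∂(surfaceMeasure M) =
      ∫ θ in (chartAt (Euc n) a).target, areaDensity a θ * f ((chartAt (Euc n) a).symm θ) := by
  have hf' := hf.mono_measure
    (Measure.restrict_le_self (s := (chartAt (Euc n) a).source))
  rw [surfaceMeasure_restrict_source hM a] at hf'
  rw [← setIntegral_eq_integral_of_forall_compl_eq_zero hfa, surfaceMeasure_restrict_source hM a,
    integral_map (aemeasurable_chart_symm a _) hf',
    integral_withDensity_eq_integral_toReal_smul₀ (aemeasurable_areaDensity hM a)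
      (Eventually.of_forall fun _ => ENNReal.ofReal_lt_top)]
  refine setIntegral_congr_fun (isOpen_chart_target a).measurableSet fun θ hθ => ?_
  rw [ENNReal.toReal_ofReal (areaDensity_pos hM a hθ).le, smul_eq_mul]

/-- The area of a whole chart domain is not controlled directly in its coordinates, but the compact
supports of the finitely many active partition functions have finite area and cover M. Finiteness
gives L² ⊆ L¹ for the Sobolev fields. -/
theorem isFiniteMeasure_surfaceMeasure (hM : IsEmbeddingOfClass ∞ (incl M)) :
    IsFiniteMeasure (surfaceMeasure M) := by
  have hK : ∀ a : M, surfaceMeasure M (tsupport (chartPartition M a)) < ⊤ := by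
    intro a
    have hc : IsCompact (tsupport (chartPartition M a)) := (isClosed_tsupport _).isCompact
    set e := chartAt (Euc n) a with he
    have hsub := tsupport_chartPartition_subset M a
    rw [surfaceMeasure_apply hM a (isClosed_tsupport _).measurableSet hsub]
    have hset : e.target ∩ e.symm ⁻¹' tsupport (chartPartition M a) =
        e '' tsupport (chartPartition M a) := by
      rw [e.image_eq_target_inter_inv_preimage hsub]
    rw [← he, hset]
    have hc' : IsCompact (e '' tsupport (chartPartition M a)) :=
      hc.image_of_continuousOn (e.continuousOn.mono hsub)
    have hi : IntegrableOn (areaDensity a) (e '' tsupport (chartPartition M a)) :=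
      ((continuousOn_areaDensity hM a).mono
        (by rw [← hset]; exact inter_subset_left)).integrableOn_compact hc'
    exact hi.lintegral_lt_top
  refine ⟨lt_of_le_of_lt (measure_mono ?_)
    ((measure_biUnion_lt_top (activeCharts M).finite_toSet fun a _ => hK a))⟩
  intro p _
  have h := sum_chartPartition p
  obtain ⟨a, ha, ha'⟩ := Finset.exists_ne_zero_of_sum_ne_zero (h.trans_ne one_ne_zero)
  exact mem_biUnion ha (subset_tsupport _ ha')

end SurfaceMeasure

end

end DeTurck

namespace DeTurck

noncomputable section

/-! ### Green's formula -/

theorem tsupport_indicator_subset {E V : Type*} [TopologicalSpace E] [Zero V] {T K : Set E}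
    {g : E → V} (hK : IsClosed K) (h0 : ∀ θ ∈ T, θ ∉ K → g θ = 0) :
    tsupport (T.indicator g) ⊆ K :=
  closure_minimal (fun θ hθ => by_contra fun h => by
    have h1 := mem_of_indicator_ne_zero (s := T) (f := g) hθ
    exact hθ (by rw [indicator_of_mem h1, h0 θ h1 h])) hK

section Extension

variable {E V : Type*} [NormedAddCommGroup E] [NormedSpace ℝ E] [NormedAddCommGroup V]
  [NormedSpace ℝ V] {T K : Set E} {g : E → V}

theorem contDiff_indicator {k : WithTop ℕ∞} (hT : IsOpen T) (hK : IsClosed K) (hKT : K ⊆ T)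
    (hg : ContDiffOn ℝ k g T) (h0 : ∀ θ ∈ T, θ ∉ K → g θ = 0) : ContDiff ℝ k (T.indicator g) := by
  refine contDiff_iff_contDiffAt.2 fun θ => ?_
  by_cases hθ : θ ∈ T
  · refine (hg.contDiffAt (hT.mem_nhds hθ)).congr_of_eventuallyEq ?_
    filter_upwards [hT.mem_nhds hθ] with ϑ hϑ using indicator_of_mem hϑ g
  · refine (contDiffAt_const (c := (0 : V))).congr_of_eventuallyEq ?_
    filter_upwards [hK.isOpen_compl.mem_nhds fun h => hθ (hKT h)] with ϑ hϑ
    by_cases h1 : ϑ ∈ T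
    · rw [indicator_of_mem h1, h0 ϑ h1 hϑ]
    · exact indicator_of_notMem h1 g

end Extension

theorem integrableOn_mul_of_hasCompactSupport {n : ℕ} {Ω : Set (Euc n)} {F f : Euc n → ℝ}
    (hF : LocallyIntegrableOn F Ω) (hf : Continuous f) (hc : HasCompactSupport f)
    (hs : tsupport f ⊆ Ω) : IntegrableOn (fun θ => F θ * f θ) Ω := by
  have h1 : IntegrableOn (fun θ => F θ * f θ) (tsupport f) :=
    ((hF.mono_set hs).integrableOn_isCompact hc).mul_continuousOn hf.continuousOn hc
  refine ((integrableOn_iff_integrable_of_support_subset fun θ hθ => ?_).1 h1).integrableOn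
  exact subset_tsupport f fun h => hθ (by simp [h])

/-! ### Absolute convergence of the integrals -/

section Integrability

variable {n : ℕ} {M : Set (Euc (n + 1))} [ChartedSpace (Euc n) M] [IsManifold (𝓡 n) ∞ M]
  [CompactSpace M]

theorem integrable_continuous_mul {c u : M → ℝ} (hc : Continuous c)
    (hu : Integrable u (surfaceMeasure M)) :
    Integrable (fun p => c p * u p) (surfaceMeasure M) := by
  obtain ⟨C, hC⟩ := isCompact_univ.exists_bound_of_continuousOn hc.continuousOn
  exact hu.bdd_mul hc.aestronglyMeasurable (Eventually.of_forall fun p => hC p (mem_univ p))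

theorem IsSobolevH12.integrable_apply (hM : IsEmbeddingOfClass ∞ (incl M))
    {χ : M → Euc (n + 1)} {Dχ : M → Matrix (Fin (n + 1)) (Fin (n + 1)) ℝ}
    (h : IsSobolevH12 χ Dχ) (κ : Fin (n + 1)) :
    Integrable (fun p => χ p κ) (surfaceMeasure M) := by
  have := isFiniteMeasure_surfaceMeasure hM
  exact (EuclideanSpace.proj κ : Euc (n + 1) →L[ℝ] ℝ).integrable_comp
    (h.memLp.integrable (by norm_num))

theorem IsSobolevH12.integrable_grad_apply (hM : IsEmbeddingOfClass ∞ (incl M))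
    {χ : M → Euc (n + 1)} {Dχ : M → Matrix (Fin (n + 1)) (Fin (n + 1)) ℝ}
    (h : IsSobolevH12 χ Dχ) (κ β : Fin (n + 1)) :
    Integrable (fun p => Dχ p κ β) (surfaceMeasure M) := by
  have := isFiniteMeasure_surfaceMeasure hM
  exact (h.memLp_grad κ β).integrable (by norm_num)

theorem integrable_inner_mul {w χ : M → Euc (n + 1)} {s : M → ℝ} (hw : Continuous w)
    (hs : Continuous s) (hχ : ∀ κ, Integrable (fun p => χ p κ) (surfaceMeasure M)) :
    Integrable (fun p => inner ℝ (w p) (χ p) * s p) (surfaceMeasure M) := by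
  have h : (fun p => inner ℝ (w p) (χ p) * s p) = fun p => ∑ κ, (w p κ * s p) * χ p κ := by
    funext p
    rw [PiLp.inner_apply, Finset.sum_mul]
    exact Finset.sum_congr rfl fun κ _ => by simp; ring
  rw [h]
  refine integrable_finsetSum _ fun κ _ => integrable_continuous_mul ?_ (hχ κ)
  exact ((EuclideanSpace.proj κ : Euc (n + 1) →L[ℝ] ℝ).continuous.comp hw).mul hs

theorem integrable_contract_mul {A J D : M → Matrix (Fin (n + 1)) (Fin (n + 1)) ℝ} {s : M → ℝ}
    (hA : Continuous A) (hJ : Continuous J) (hs : Continuous s)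
    (hD : ∀ κ β, Integrable (fun p => D p κ β) (surfaceMeasure M)) :
    Integrable (fun p => contract (A p) (J p) (D p) * s p) (surfaceMeasure M) := by
  have h : (fun p => contract (A p) (J p) (D p) * s p) =
      fun p => ∑ β, ∑ γ, ∑ κ, (A p β γ * J p κ β * s p) * D p κ γ := by
    funext p
    simp only [contract, Finset.sum_mul, Finset.mul_sum]
    exact Finset.sum_congr rfl fun β _ => Finset.sum_congr rfl fun γ _ =>
      Finset.sum_congr rfl fun κ _ => by ring
  rw [h]
  refine integrable_finsetSum _ fun β _ => integrable_finsetSum _ fun γ _ =>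
    integrable_finsetSum _ fun κ _ => integrable_continuous_mul ?_ (hD κ γ)
  exact ((hA.matrix_elem β γ).mul (hJ.matrix_elem κ β)).mul hs

end Integrability

/-! ### Tangential gradients of cutoffs and test functions in a chart -/

section TangGrad

variable {n : ℕ} {M : Set (Euc (n + 1))} [ChartedSpace (Euc n) M] [IsManifold (𝓡 n) ∞ M]

theorem contDiffOn_gradDensity_chart {y f : M → Euc (n + 1)}
    (hy : ContMDiff (𝓡 n) 𝓘(ℝ, Euc (n + 1)) 2 y)
    (hy' : ∀ p, Function.Injective (mfderiv (𝓡 n) 𝓘(ℝ, Euc (n + 1)) y p))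
    (hf : ContMDiff (𝓡 n) 𝓘(ℝ, Euc (n + 1)) 2 f) (a : M) (j : Fin n) :
    ContDiffOn ℝ 1 (gradDensity (y ∘ (chartAt (Euc n) a).symm) (f ∘ (chartAt (Euc n) a).symm) j)
      (chartAt (Euc n) a).target := fun _ hθ =>
  (contDiffAt_gradDensity (contDiffAt_comp_chart_symm two_le_infty hy a hθ)
    (injective_fderiv_comp_chart_symm (hy.mdifferentiable (by simp)) hy' a hθ)
    (contDiffAt_comp_chart_symm two_le_infty hf a hθ) j).contDiffWithinAt

theorem continuous_tangGrad_apply (hM : IsEmbeddingOfClass ∞ (incl M)) {f : M → ℝ}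
    (hf : ContMDiff (𝓡 n) 𝓘(ℝ, ℝ) 1 f) (β : Fin (n + 1)) :
    Continuous fun p => tangGrad f p β := by
  -- The scalar f is placed in component 0 of a vector-valued map in order to reuse the continuity
  -- of `tangJac`.
  have h1 : ContMDiff (𝓡 n) 𝓘(ℝ, Euc (n + 1)) 1
      (fun p => f p • (EuclideanSpace.single 0 1 : Euc (n + 1))) :=
    hf.smul contMDiff_const
  have h2 := (continuous_tangJac hM h1).matrix_elem 0 β
  simpa [tangJac] using h2

/-- Applied to the partition of unity, this is why the error terms of the localization cancel. -/
theorem sum_tangGrad_eq_zero {ι : Type*} (s : Finset ι) {f : ι → M → ℝ}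
    (hf : ∀ a ∈ s, ContMDiff (𝓡 n) 𝓘(ℝ, ℝ) 1 (f a)) {c : ℝ} (hc : ∀ p, ∑ a ∈ s, f a p = c)
    (p : M) : ∑ a ∈ s, tangGrad (f a) p = 0 := by
  have hθ : chartAt (Euc n) p p ∈ (chartAt (Euc n) p).target :=
    (chartAt (Euc n) p).map_source (mem_chart_source _ p)
  have h1 : ∀ i, ∑ a ∈ s, pd i (f a ∘ (chartAt (Euc n) p).symm) (chartAt (Euc n) p p) = 0 := by
    intro i
    rw [← pd_sum _ fun a ha => (contDiffAt_comp_chart_symm one_le_infty (hf a ha) p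
      hθ).differentiableAt (by simp)]
    simp [Function.comp, hc, pd]
  simp only [tangGrad, coordGradient]
  rw [Finset.sum_comm]
  refine Finset.sum_eq_zero fun i _ => ?_
  rw [Finset.sum_comm]
  refine Finset.sum_eq_zero fun j _ => ?_
  rw [← Finset.sum_smul, ← Finset.mul_sum, h1, mul_zero, zero_smul]

theorem tangGrad_eq_zero {n : ℕ} {M : Set (Euc (n + 1))} [ChartedSpace (Euc n) M] {f : M → ℝ}
    {p : M} (hp : p ∉ tsupport f) : tangGrad f p = 0 := by
  set e := chartAt (Euc n) p with he
  have hs : p ∈ e.source := mem_chart_source _ p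
  have hc : Tendsto e.symm (𝓝 (e p)) (𝓝 p) := by
    have := e.continuousAt_symm (e.map_source hs)
    rwa [ContinuousAt, e.left_inv hs] at this
  have h1 : f ∘ e.symm =ᶠ[𝓝 (e p)] fun _ => 0 := by
    filter_upwards [hc.eventually ((isClosed_tsupport f).isOpen_compl.mem_nhds hp)] with θ hθ
    exact image_eq_zero_of_notMem_tsupport (f := f) hθ
  have h2 : ∀ i, pd i (f ∘ e.symm) (e p) = 0 := fun i => by
    rw [pd_congr h1]; simp [pd]
  simp [tangGrad, coordGradient, ← he, h2]

theorem contract_sum {d : ℕ} {ι : Type*} (s : Finset ι) (A J : Matrix (Fin d) (Fin d) ℝ)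
    (K : ι → Matrix (Fin d) (Fin d) ℝ) :
    ∑ a ∈ s, contract A J (K a) = contract A J (∑ a ∈ s, K a) := by
  simp only [contract_eq_trace, Matrix.transpose_sum, Matrix.mul_sum, Matrix.trace_sum]

/-- The test function `ρ √det g gⁱʲ ∂ᵢ f_κ` in a chart. -/
def gradTest (y f : M → Euc (n + 1)) (ρ : M → ℝ) (a : M) (j : Fin n) (κ : Fin (n + 1)) :
    Euc n → ℝ :=
  (chartAt (Euc n) a).target.indicator fun θ => ρ ((chartAt (Euc n) a).symm θ) *
    gradDensity (y ∘ (chartAt (Euc n) a).symm) (f ∘ (chartAt (Euc n) a).symm) j θ κ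

variable {y f : M → Euc (n + 1)} {ρ : M → ℝ} {a : M}

theorem pd_gradTest (hy : ContMDiff (𝓡 n) 𝓘(ℝ, Euc (n + 1)) 2 y)
    (hy' : ∀ p, Function.Injective (mfderiv (𝓡 n) 𝓘(ℝ, Euc (n + 1)) y p))
    (hf : ContMDiff (𝓡 n) 𝓘(ℝ, Euc (n + 1)) 2 f) (hρ : ContMDiff (𝓡 n) 𝓘(ℝ, ℝ) 1 ρ)
    (j : Fin n) (κ : Fin (n + 1)) {θ : Euc n} (hθ : θ ∈ (chartAt (Euc n) a).target) :
    pd j (gradTest y f ρ a j κ) θ =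
      ρ ((chartAt (Euc n) a).symm θ) *
        pd j (gradDensity (y ∘ (chartAt (Euc n) a).symm) (f ∘ (chartAt (Euc n) a).symm) j) θ κ +
      pd j (ρ ∘ (chartAt (Euc n) a).symm) θ *
        gradDensity (y ∘ (chartAt (Euc n) a).symm) (f ∘ (chartAt (Euc n) a).symm) j θ κ := by
  have hg := ((contDiffOn_gradDensity_chart hy hy' hf a j).contDiffAt
    ((isOpen_chart_target a).mem_nhds hθ)).differentiableAt (by simp)
  have hρd := (contDiffAt_comp_chart_symm one_le_infty hρ a hθ).differentiableAt (by simp)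
  have h1 : gradTest y f ρ a j κ =ᶠ[𝓝 θ] fun θ => (ρ ∘ (chartAt (Euc n) a).symm) θ *
      gradDensity (y ∘ (chartAt (Euc n) a).symm) (f ∘ (chartAt (Euc n) a).symm) j θ κ := by
    filter_upwards [(isOpen_chart_target a).mem_nhds hθ] with ϑ hϑ using indicator_of_mem hϑ _
  have hgκ : DifferentiableAt ℝ (fun θ => gradDensity (y ∘ (chartAt (Euc n) a).symm)
      (f ∘ (chartAt (Euc n) a).symm) j θ κ) θ :=
    (EuclideanSpace.proj κ : Euc (n + 1) →L[ℝ] ℝ).differentiableAt.comp θ hg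
  rw [pd_congr h1, pd_mul hρd hgκ, pd_apply hg]
  rfl

end TangGrad

section Green

variable {n : ℕ} {M : Set (Euc (n + 1))} [ChartedSpace (Euc n) M] [IsManifold (𝓡 n) ∞ M]
  [CompactSpace M]

variable {y f : M → Euc (n + 1)} {ρ : M → ℝ} {a : M}

/-- M is compact, so the support of ρ has a compact image inside the chart target and extension by
zero keeps the regularity. This is C¹ and no better, since y and f are C² and their first
derivatives enter. -/
theorem gradTest_properties (hy : ContMDiff (𝓡 n) 𝓘(ℝ, Euc (n + 1)) 2 y)
    (hy' : ∀ p, Function.Injective (mfderiv (𝓡 n) 𝓘(ℝ, Euc (n + 1)) y p))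
    (hf : ContMDiff (𝓡 n) 𝓘(ℝ, Euc (n + 1)) 2 f) (hρ : ContMDiff (𝓡 n) 𝓘(ℝ, ℝ) 1 ρ)
    (hρa : tsupport ρ ⊆ (chartAt (Euc n) a).source) (j : Fin n) (κ : Fin (n + 1)) :
    ContDiff ℝ 1 (gradTest y f ρ a j κ) ∧ HasCompactSupport (gradTest y f ρ a j κ) ∧
      tsupport (gradTest y f ρ a j κ) ⊆ (chartAt (Euc n) a).target := by
  set e := chartAt (Euc n) a with he
  have hK : IsCompact (e '' tsupport ρ) :=
    (isClosed_tsupport ρ).isCompact.image_of_continuousOn (e.continuousOn.mono hρa)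
  have hKT : e '' tsupport ρ ⊆ e.target := by
    rintro _ ⟨p, hp, rfl⟩
    exact e.map_source (hρa hp)
  have h0 : ∀ θ ∈ e.target, θ ∉ e '' tsupport ρ → ρ (e.symm θ) *
      gradDensity (y ∘ e.symm) (f ∘ e.symm) j θ κ = 0 := by
    intro θ hθ h
    have : ρ (e.symm θ) = 0 := image_eq_zero_of_notMem_tsupport fun h1 =>
      h ⟨e.symm θ, h1, e.right_inv hθ⟩
    rw [this, zero_mul]
  have hcd : ContDiffOn ℝ 1 (fun θ => ρ (e.symm θ) *
      gradDensity (y ∘ e.symm) (f ∘ e.symm) j θ κ) e.target :=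
    (contDiffOn_comp_chart_symm one_le_infty hρ a).mul
      ((EuclideanSpace.proj κ : Euc (n + 1) →L[ℝ] ℝ).contDiff.comp_contDiffOn
        (contDiffOn_gradDensity_chart hy hy' hf a j))
  have hsub := tsupport_indicator_subset hK.isClosed h0
  exact ⟨contDiff_indicator e.open_target hK.isClosed hKT hcd h0,
    hK.of_isClosed_subset (isClosed_tsupport _) hsub, hsub.trans hKT⟩

variable {μ χ : M → Euc (n + 1)} {Dχ : M → Matrix (Fin (n + 1)) (Fin (n + 1)) ℝ}

/-- The integrand is the product-rule expansion of Green's formula tested with ρχ; the last term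
collects the derivatives of ρ through χ ⊗ ∇_M ρ. In the chart it is ∑ χ_κ ∂ⱼφ + (∂ⱼχ_κ) φ with φ =
`gradTest`, whose integral vanishes by the definition of the weak derivative. Thus ρχ itself need
not be shown to be a Sobolev field. -/
theorem green_local (hM : IsEmbeddingOfClass ∞ (incl M))
    (hμ : ∀ p, IsUnitNormalAt (incl M) p (μ p)) (hy : ContMDiff (𝓡 n) 𝓘(ℝ, Euc (n + 1)) 2 y)
    (hy' : ∀ p, Function.Injective (mfderiv (𝓡 n) 𝓘(ℝ, Euc (n + 1)) y p))
    (hf : ContMDiff (𝓡 n) 𝓘(ℝ, Euc (n + 1)) 2 f) (hχ : IsSobolevH12 χ Dχ)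
    (hρ : ContMDiff (𝓡 n) 𝓘(ℝ, ℝ) 1 ρ) (hρa : tsupport ρ ⊆ (chartAt (Euc n) a).source)
    (hmeas : AEStronglyMeasurable (fun p => ρ p *
      (inner ℝ (laplacian y f p) (χ p) * √(metricRep μ y p).det +
        contract (metricRep μ y p)⁻¹ (tangJac f p) (Dχ p) * √(metricRep μ y p).det) +
      contract (metricRep μ y p)⁻¹ (tangJac f p)
        (Matrix.vecMulVec (χ p).ofLp (tangGrad ρ p).ofLp) * √(metricRep μ y p).det)
      (surfaceMeasure M)) :
    ∫ p, (ρ p * (inner ℝ (laplacian y f p) (χ p) * √(metricRep μ y p).det +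
        contract (metricRep μ y p)⁻¹ (tangJac f p) (Dχ p) * √(metricRep μ y p).det) +
      contract (metricRep μ y p)⁻¹ (tangJac f p)
        (Matrix.vecMulVec (χ p).ofLp (tangGrad ρ p).ofLp) * √(metricRep μ y p).det)
      ∂(surfaceMeasure M) = 0 := by
  choose W hW hWD using fun κ => hχ.weak _ (chart_mem_atlas (Euc n) a) κ
  have hT := isOpen_chart_target a
  have htest := fun j κ => gradTest_properties (a := a) hy hy' hf hρ hρa j κ
  rw [integral_surfaceMeasure_eq hM a hmeas fun p hp => ?_]
  swap
  · have h1 : p ∉ tsupport ρ := fun h => hp (hρa h)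
    simp [image_eq_zero_of_notMem_tsupport h1, tangGrad_eq_zero h1, contract_eq_trace]
  have hi1 : ∀ κ j, IntegrableOn (fun θ => χ ((chartAt (Euc n) a).symm θ) κ *
      pd j (gradTest y f ρ a j κ) θ) (chartAt (Euc n) a).target := fun κ j =>
    integrableOn_mul_of_hasCompactSupport (hW κ j).1 (continuous_pd (htest j κ).1 j)
      (hasCompactSupport_pd (htest j κ).2.1 j) ((tsupport_pd_subset j).trans (htest j κ).2.2)
  have hi2 : ∀ κ j, IntegrableOn (fun θ => W κ j θ * gradTest y f ρ a j κ θ)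
      (chartAt (Euc n) a).target := fun κ j =>
    integrableOn_mul_of_hasCompactSupport (hW κ j).2.1 (htest j κ).1.continuous (htest j κ).2.1
      (htest j κ).2.2
  have hi3 : ∀ κ j, Integrable (fun θ => χ ((chartAt (Euc n) a).symm θ) κ *
      pd j (gradTest y f ρ a j κ) θ + W κ j θ * gradTest y f ρ a j κ θ)
      (volume.restrict (chartAt (Euc n) a).target) := fun κ j => (hi1 κ j).add (hi2 κ j)
  have hzero : ∫ θ in (chartAt (Euc n) a).target, ∑ κ, ∑ j,
      (χ ((chartAt (Euc n) a).symm θ) κ * pd j (gradTest y f ρ a j κ) θ +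
        W κ j θ * gradTest y f ρ a j κ θ) = 0 := by
    rw [integral_finsetSum _ fun κ _ => integrable_finsetSum _ fun j _ => hi3 κ j]
    refine Finset.sum_eq_zero fun κ _ => ?_
    rw [integral_finsetSum _ fun j _ => hi3 κ j]
    refine Finset.sum_eq_zero fun j _ => ?_
    rw [integral_add (hi1 κ j) (hi2 κ j), (hW κ j).integral_mul_pd hT (htest j κ).1
      (htest j κ).2.1 (htest j κ).2.2, neg_add_cancel]
  rw [← hzero]
  refine integral_congr_ae ?_
  filter_upwards [ae_all_iff.2 hWD, ae_restrict_mem hT.measurableSet] with θ hD hθ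
  have hy1 := hy.of_le one_le_two
  have hf1 := hf.of_le one_le_two
  set p := (chartAt (Euc n) a).symm θ with hp
  set V := gradDensity (y ∘ (chartAt (Euc n) a).symm) (f ∘ (chartAt (Euc n) a).symm) with hV
  have e1 := sqrt_det_metricRep_mul hM hμ hy1 a hθ
  have e2 := contract_metricRep_chart hM hμ hy1 hy' hf1 a hθ (K := Dχ p)
    (W := fun κ j => W κ j θ) hD
  -- χ ⊗ ∇_M ρ has the form of a tangential gradient with coordinate derivatives χ_κ ∂ⱼρ, so the
  -- chart formula for the Dirichlet form applies to it too.
  have e3 := contract_metricRep_chart hM hμ hy1 hy' hf1 a hθ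
    (K := Matrix.vecMulVec (χ p).ofLp (tangGrad ρ p).ofLp)
    (W := fun κ j => χ p κ * pd j (ρ ∘ (chartAt (Euc n) a).symm) θ) fun κ β => by
      rw [Matrix.vecMulVec_apply, hp, tangGrad_chart_symm hM hρ a hθ, coordGradient_apply,
        coordGradient_apply]
      simp only [Finset.mul_sum, Finset.sum_mul]
      exact Finset.sum_congr rfl fun j _ => Finset.sum_congr rfl fun i _ => by ring
  have e4 : √(gramMetric (y ∘ (chartAt (Euc n) a).symm) θ).det *
      inner ℝ (laplacian y f p) (χ p) = ∑ κ, ∑ j, χ p κ * pd j (V j) θ κ := by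
    rw [← real_inner_smul_left, sqrt_det_mul_laplacian hy hy' hf a hθ, sum_inner,
      Finset.sum_comm]
    refine Finset.sum_congr rfl fun j _ => ?_
    rw [PiLp.inner_apply]
    exact Finset.sum_congr rfl fun κ _ => by simp [hV]
  have e5 : ∀ j κ, gradTest y f ρ a j κ θ = ρ p * V j θ κ := fun j κ => indicator_of_mem hθ _
  have e6 : ∀ j κ, pd j (gradTest y f ρ a j κ) θ = ρ p * pd j (V j) θ κ +
      pd j (ρ ∘ (chartAt (Euc n) a).symm) θ * V j θ κ := fun j κ =>
    pd_gradTest hy hy' hf hρ j κ hθ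
  have e7 : areaDensity a θ * (ρ p * (inner ℝ (laplacian y f p) (χ p) * √(metricRep μ y p).det +
        contract (metricRep μ y p)⁻¹ (tangJac f p) (Dχ p) * √(metricRep μ y p).det) +
      contract (metricRep μ y p)⁻¹ (tangJac f p)
        (Matrix.vecMulVec (χ p).ofLp (tangGrad ρ p).ofLp) * √(metricRep μ y p).det) =
      ρ p * (√(gramMetric (y ∘ (chartAt (Euc n) a).symm) θ).det *
          inner ℝ (laplacian y f p) (χ p)) +
        ρ p * (√(gramMetric (y ∘ (chartAt (Euc n) a).symm) θ).det *
          contract (metricRep μ y p)⁻¹ (tangJac f p) (Dχ p)) +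
        √(gramMetric (y ∘ (chartAt (Euc n) a).symm) θ).det *
          contract (metricRep μ y p)⁻¹ (tangJac f p)
            (Matrix.vecMulVec (χ p).ofLp (tangGrad ρ p).ofLp) := by
    rw [← e1, areaDensity]; ring
  rw [e7, e2, e3, e4]
  simp only [e5, e6, Finset.mul_sum, ← Finset.sum_add_distrib]
  exact Finset.sum_congr rfl fun κ _ => Finset.sum_congr rfl fun j _ => by ring

theorem integrable_inner_laplacian (hM : IsEmbeddingOfClass ∞ (incl M))
    (hμ : ∀ p, IsUnitNormalAt (incl M) p (μ p)) (hy : ContMDiff (𝓡 n) 𝓘(ℝ, Euc (n + 1)) 1 y)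
    {w : M → Euc (n + 1)} (hw : Continuous w) (hχ : IsSobolevH12 χ Dχ) :
    Integrable (fun p => inner ℝ (w p) (χ p) * √(metricRep μ y p).det) (surfaceMeasure M) :=
  integrable_inner_mul hw (continuous_metricRep hM hμ hy).matrix_det.sqrt
    (hχ.integrable_apply hM)

theorem integrable_contract_metricRep (hM : IsEmbeddingOfClass ∞ (incl M))
    (hμ : ∀ p, IsUnitNormalAt (incl M) p (μ p)) (hy : ContMDiff (𝓡 n) 𝓘(ℝ, Euc (n + 1)) 1 y)
    (hy' : ∀ p, Function.Injective (mfderiv (𝓡 n) 𝓘(ℝ, Euc (n + 1)) y p))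
    (hf : ContMDiff (𝓡 n) 𝓘(ℝ, Euc (n + 1)) 1 f)
    {D : M → Matrix (Fin (n + 1)) (Fin (n + 1)) ℝ}
    (hD : ∀ κ β, Integrable (fun p => D p κ β) (surfaceMeasure M)) :
    Integrable (fun p => contract (metricRep μ y p)⁻¹ (tangJac f p) (D p) *
      √(metricRep μ y p).det) (surfaceMeasure M) := by
  have hG := continuous_metricRep hM hμ hy
  have hGinv : Continuous fun p => (metricRep μ y p)⁻¹ := by
    simp only [Matrix.inv_def, Ring.inverse_eq_inv']
    exact (hG.matrix_det.inv₀ fun p => (det_metricRep_pos hM hμ hy hy' p).ne').smul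
      hG.matrix_adjugate
  exact integrable_contract_mul hGinv (continuous_tangJac hM hf) hG.matrix_det.sqrt hD

/-- Green's formula for the metric induced by `y`. -/
theorem green (hM : IsEmbeddingOfClass ∞ (incl M))
    (hμ : ∀ p, IsUnitNormalAt (incl M) p (μ p)) (hy : ContMDiff (𝓡 n) 𝓘(ℝ, Euc (n + 1)) 2 y)
    (hy' : ∀ p, Function.Injective (mfderiv (𝓡 n) 𝓘(ℝ, Euc (n + 1)) y p))
    (hf : ContMDiff (𝓡 n) 𝓘(ℝ, Euc (n + 1)) 2 f) (hχ : IsSobolevH12 χ Dχ) :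
    (∫ p, inner ℝ (laplacian y f p) (χ p) * √(metricRep μ y p).det ∂(surfaceMeasure M)) +
      ∫ p, contract (metricRep μ y p)⁻¹ (tangJac f p) (Dχ p) * √(metricRep μ y p).det
        ∂(surfaceMeasure M) = 0 := by
  have hy1 := hy.of_le one_le_two
  have hf1 := hf.of_le one_le_two
  have hρ : ∀ a : M, ContMDiff (𝓡 n) 𝓘(ℝ, ℝ) 1 (chartPartition M a) := fun a =>
    (contMDiff_chartPartition a).of_le one_le_infty
  have hi1 := integrable_inner_laplacian hM hμ hy1 (continuous_laplacian hy hy' hf) hχ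
  have hi2 := integrable_contract_metricRep hM hμ hy1 hy' hf1 (hχ.integrable_grad_apply hM)
  have hi3 : ∀ a : M, Integrable (fun p => contract (metricRep μ y p)⁻¹ (tangJac f p)
      (Matrix.vecMulVec (χ p).ofLp (tangGrad (chartPartition M a) p).ofLp) *
      √(metricRep μ y p).det) (surfaceMeasure M) := fun a =>
    integrable_contract_metricRep hM hμ hy1 hy' hf1 fun κ β => by
      simp only [Matrix.vecMulVec_apply, mul_comm (χ _ κ)]
      exact integrable_continuous_mul (continuous_tangGrad_apply hM (hρ a) β)
        (hχ.integrable_apply hM κ)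
  have hi4 : ∀ a : M, Integrable (fun p => chartPartition M a p *
      (inner ℝ (laplacian y f p) (χ p) * √(metricRep μ y p).det +
        contract (metricRep μ y p)⁻¹ (tangJac f p) (Dχ p) * √(metricRep μ y p).det) +
      contract (metricRep μ y p)⁻¹ (tangJac f p)
        (Matrix.vecMulVec (χ p).ofLp (tangGrad (chartPartition M a) p).ofLp) *
        √(metricRep μ y p).det) (surfaceMeasure M) := fun a =>
    (integrable_continuous_mul (hρ a).continuous (hi1.add hi2)).add (hi3 a)
  have hsum := Finset.sum_eq_zero fun a (_ : a ∈ activeCharts M) =>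
    green_local hM hμ hy hy' hf hχ (hρ a) (tsupport_chartPartition_subset M a)
      (hi4 a).aestronglyMeasurable
  rw [← integral_finsetSum _ fun a _ => hi4 a] at hsum
  rw [← integral_add hi1 hi2, ← hsum]
  refine integral_congr_ae (Eventually.of_forall fun p => ?_)
  -- The contraction is linear in its last argument, and the gradients of the partition functions
  -- sum to the gradient of the constant 1.
  have h1 : ∑ a ∈ activeCharts M, contract (metricRep μ y p)⁻¹ (tangJac f p)
      (Matrix.vecMulVec (χ p).ofLp (tangGrad (chartPartition M a) p).ofLp) = 0 := by
    have h2 : ∑ a ∈ activeCharts M,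
        Matrix.vecMulVec (χ p).ofLp (tangGrad (chartPartition M a) p).ofLp = 0 := by
      have h3 := sum_tangGrad_eq_zero (activeCharts M) (fun a _ => hρ a) sum_chartPartition p
      ext κ β
      have h4 := congrArg (fun w : Euc (n + 1) => w β) h3
      simp only [WithLp.ofLp_sum, Finset.sum_apply] at h4
      rw [Matrix.sum_apply]
      simp only [Matrix.vecMulVec_apply]
      rw [← Finset.mul_sum, h4]
      simp
    rw [contract_sum, h2, contract_eq_trace]
    simp
  beta_reduce
  rw [Finset.sum_add_distrib, ← Finset.sum_mul, ← Finset.sum_mul, h1, sum_chartPartition]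
  ring

end Green

end

end DeTurck

namespace DeTurck

noncomputable section

/-! ### The time derivative of the mean curvature–DeTurck flow -/

/-- Derivative of `s ↦ g (s, φ s)` along the implicit function `φ` given by `f (s, φ s) = const`,
when the partial differential of `g` factors as `L` after that of `f`. -/
theorem exists_implicit_hasDerivAt {n : ℕ} {V : Type*} [NormedAddCommGroup V] [NormedSpace ℝ V]
    {f : ℝ × Euc n → Euc n} {g : ℝ × Euc n → V} {t : ℝ} {u : Euc n}
    (hf : ContDiffAt ℝ 1 f (t, u)) (hg : ContDiffAt ℝ 1 g (t, u))
    (hinj : Function.Injective (fderiv ℝ (fun w => f (t, w)) u)) {L : Euc n →L[ℝ] V}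
    (hL : fderiv ℝ (fun w => g (t, w)) u = L.comp (fderiv ℝ (fun w => f (t, w)) u))
    {a : Euc n} {b : V} (ha : HasDerivAt (fun s => f (s, u)) a t)
    (hb : HasDerivAt (fun s => g (s, u)) b t) :
    ∃ φ : ℝ → Euc n, φ t = u ∧ ContinuousAt φ t ∧ (∀ᶠ s in 𝓝 t, f (s, φ s) = f (t, u)) ∧
      HasDerivAt (fun s => g (s, φ s)) (b - L a) t := by
  have hfd : HasFDerivAt f (fderiv ℝ f (t, u)) (t, u) :=
    (hf.differentiableAt (by simp)).hasFDerivAt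
  have hgd : HasFDerivAt g (fderiv ℝ g (t, u)) (t, u) :=
    (hg.differentiableAt (by simp)).hasFDerivAt
  have hr : HasFDerivAt (fun w : Euc n => (t, w)) (ContinuousLinearMap.inr ℝ ℝ (Euc n)) u :=
    hasFDerivAt_prodMk_right t u
  have hl : HasDerivAt (fun s : ℝ => (s, u)) ((1 : ℝ), (0 : Euc n)) t :=
    (hasDerivAt_id t).prodMk (hasDerivAt_const t u)
  have hf2 : fderiv ℝ (fun w => f (t, w)) u =
      (fderiv ℝ f (t, u)).comp (ContinuousLinearMap.inr ℝ ℝ (Euc n)) := (hfd.comp u hr).fderiv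
  have hg2 : fderiv ℝ (fun w => g (t, w)) u =
      (fderiv ℝ g (t, u)).comp (ContinuousLinearMap.inr ℝ ℝ (Euc n)) := (hgd.comp u hr).fderiv
  have hfa : fderiv ℝ f (t, u) (1, 0) = a := (hfd.comp_hasDerivAt t hl).unique ha
  have hgb : fderiv ℝ g (t, u) (1, 0) = b := (hgd.comp_hasDerivAt t hl).unique hb
  -- An injective endomorphism of a finite-dimensional space is invertible, so the implicit function
  -- theorem applies in the space variable.
  have hinv : ((fderiv ℝ f (t, u)).comp
      (ContinuousLinearMap.inr ℝ ℝ (Euc n))).IsInvertible := by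
    rw [← hf2]
    exact ⟨(LinearEquiv.ofInjectiveEndo _ hinj).toContinuousLinearEquiv, by ext w; rfl⟩
  set φ := hf.implicitFunction one_ne_zero hinv with hφ
  have hφt : φ t = u := hf.implicitFunction_apply_self one_ne_zero hinv
  have hev : ∀ᶠ s in 𝓝 t, f (s, φ s) = f (t, u) :=
    hf.eventually_apply_implicitFunction one_ne_zero hinv
  have hφd : DifferentiableAt ℝ φ t :=
    (hf.hasStrictFDerivAt_implicitFunction one_ne_zero hinv).hasFDerivAt.differentiableAt
  set u' := deriv φ t
  have hpath : HasDerivAt (fun s => (s, φ s)) ((1 : ℝ), u') t :=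
    (hasDerivAt_id t).prodMk hφd.hasDerivAt
  have hfd' : HasFDerivAt f (fderiv ℝ f (t, u)) (t, φ t) := by rwa [hφt]
  have hgd' : HasFDerivAt g (fderiv ℝ g (t, u)) (t, φ t) := by rwa [hφt]
  have hsplit : ((1 : ℝ), u') = (1, 0) + ContinuousLinearMap.inr ℝ ℝ (Euc n) u' := by simp
  have h0 : fderiv ℝ f (t, u) (1, u') = 0 :=
    ((hfd'.comp_hasDerivAt t hpath).congr_of_eventuallyEq (hev.mono fun s h => h.symm)).unique
      (hasDerivAt_const t (f (t, u)))
  -- Differentiating f(s, φ(s)) = const determines only D_u f applied to φ'. That suffices, because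
  -- the space differential of g factors through D_u f.
  have h1 : fderiv ℝ (fun w => f (t, w)) u u' = -a := by
    rw [hsplit, map_add, hfa] at h0
    rw [hf2]
    exact eq_neg_of_add_eq_zero_right h0
  refine ⟨φ, hφt, hφd.continuousAt, hev, ?_⟩
  have h2 := hgd'.comp_hasDerivAt t hpath
  have h3 : fderiv ℝ g (t, u) (1, u') = b - L a := by
    have h4 : fderiv ℝ g (t, u) (ContinuousLinearMap.inr ℝ ℝ (Euc n) u') = L (-a) := by
      rw [← h1]
      exact congrArg (fun A : Euc n →L[ℝ] V => A u') (hg2.symm.trans hL)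
    rw [hsplit, map_add, hgb, h4, map_neg, sub_eq_add_neg]
  rwa [h3] at h2

/-! ### The equation of motion of the mean curvature–DeTurck flow -/

section Flow

variable {n : ℕ} {M : Set (Euc (n + 1))} [ChartedSpace (Euc n) M]

/-- The coordinate form of `(∇_M y) v` for a vector field `v` on `M`. -/
theorem tangJac_mulVec [IsManifold (𝓡 n) ∞ M] (hM : IsEmbeddingOfClass ∞ (incl M))
    {y : M → Euc (n + 1)} (hy : ContMDiff (𝓡 n) 𝓘(ℝ, Euc (n + 1)) 1 y) (a : M) {θ : Euc n}
    (hθ : θ ∈ (chartAt (Euc n) a).target) (v : Euc (n + 1)) {w : Euc n}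
    (hw : ∀ q, w q = ∑ l, (gramMetric (incl M ∘ (chartAt (Euc n) a).symm) θ)⁻¹ q l *
      inner ℝ v (pd l (incl M ∘ (chartAt (Euc n) a).symm) θ)) :
    WithLp.toLp 2 (tangJac y ((chartAt (Euc n) a).symm θ) *ᵥ v.ofLp) =
      fderiv ℝ (y ∘ (chartAt (Euc n) a).symm) θ w := by
  rw [tangJac_chart_symm hM hy a hθ, ← Matrix.mulVec_mulVec, ← Matrix.mulVec_mulVec,
    fderiv_eq_sum_pd]
  set I := incl M ∘ (chartAt (Euc n) a).symm
  have h1 : (gramMetric I θ)⁻¹ *ᵥ ((jacobian I θ)ᵀ *ᵥ v.ofLp) = w.ofLp := by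
    funext q
    rw [hw, Matrix.mulVec, dotProduct]
    refine Finset.sum_congr rfl fun l _ => ?_
    rw [Matrix.mulVec, dotProduct, PiLp.inner_apply]
    simp [jacobian_apply]
  rw [h1]
  ext κ
  simp [Matrix.mulVec, dotProduct, jacobian_apply, mul_comm]

theorem contMDiff_deTurckFlow {T : ℝ} {x₀ : M → Euc (n + 1)} {x : ℝ → M → Euc (n + 1)}
    {ν : ℝ → Euc (n + 1) → Euc (n + 1)} (hx : IsMeanCurvatureFlow T x₀ x ν)
    (ψ : ℝ → Diffeomorph (𝓡 n) (𝓡 n) M M 2) {t : ℝ} (ht : t ∈ Ioo 0 T) :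
    ContMDiff (𝓡 n) 𝓘(ℝ, Euc (n + 1)) 2 (deTurckFlow x ψ t) :=
  (hx.embedding t (Ioo_subset_Ico_self ht)).contMDiff.comp (ψ t).symm.contMDiff

theorem injective_mfderiv_deTurckFlow {T : ℝ} {x₀ : M → Euc (n + 1)} {x : ℝ → M → Euc (n + 1)}
    {ν : ℝ → Euc (n + 1) → Euc (n + 1)} (hx : IsMeanCurvatureFlow T x₀ x ν)
    (ψ : ℝ → Diffeomorph (𝓡 n) (𝓡 n) M M 2) {t : ℝ} (ht : t ∈ Ioo 0 T) (p : M) :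
    Function.Injective (mfderiv (𝓡 n) 𝓘(ℝ, Euc (n + 1)) (deTurckFlow x ψ t) p) := by
  have hemb := hx.embedding t (Ioo_subset_Ico_self ht)
  have hs : MDifferentiable (𝓡 n) (𝓡 n) (ψ t).symm :=
    (ψ t).symm.contMDiff.mdifferentiable (by simp)
  have h : mfderiv (𝓡 n) 𝓘(ℝ, Euc (n + 1)) (deTurckFlow x ψ t) p =
      (mfderiv (𝓡 n) 𝓘(ℝ, Euc (n + 1)) (x t) ((ψ t).symm p)).comp
        (mfderiv (𝓡 n) (𝓡 n) (ψ t).symm p) :=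
    mfderiv_comp p (hemb.mdifferentiable (by simp) _) (hs p)
  rw [h]
  refine (hemb.immersion _).comp ?_
  exact ((ψ t).symm.toOpenPartialHomeomorph_mdifferentiable (by simp)).mfderiv_injective
    (mem_univ p)

variable [IsManifold (𝓡 n) ∞ M]

/-- The map `(s, u) ↦ (s, e⁻¹ u)`. -/
theorem contMDiffAt_prodMk_chart_symm (a : M) (t : ℝ) {u : Euc n}
    (hu : u ∈ (chartAt (Euc n) a).target) :
    ContMDiffAt 𝓘(ℝ, ℝ × Euc n) (𝓘(ℝ, ℝ).prod (𝓡 n)) 1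
      (fun z : ℝ × Euc n => (z.1, (chartAt (Euc n) a).symm z.2)) (t, u) := by
  have h1 : ContMDiffAt (𝓡 n) (𝓡 n) 1 (chartAt (Euc n) a).symm u :=
    ((contMDiffOn_chart_symm (n := ∞)).contMDiffAt
      ((isOpen_chart_target a).mem_nhds hu)).of_le one_le_infty
  have h2 : ContMDiffAt 𝓘(ℝ, ℝ × Euc n) (𝓡 n) 1 (fun z : ℝ × Euc n => z.2) (t, u) :=
    contDiffAt_snd.contMDiffAt
  have h3 : ContMDiffAt 𝓘(ℝ, ℝ × Euc n) 𝓘(ℝ, ℝ) 1 (fun z : ℝ × Euc n => z.1) (t, u) :=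
    contDiffAt_fst.contMDiffAt
  exact h3.prodMk (ContMDiffAt.comp (t, u) h1 h2)

/-- The mean curvature–DeTurck flow solves `∂ₜ x̂ = Δ_ĝ x̂ - α⁻¹ (∇_M x̂) v`; the first term is normal
and the second one tangential to the hypersurface. -/
theorem hasDerivAt_deTurckFlow (hM : IsEmbeddingOfClass ∞ (incl M)) {α T : ℝ}
    {x₀ : M → Euc (n + 1)} {x : ℝ → M → Euc (n + 1)} {ν : ℝ → Euc (n + 1) → Euc (n + 1)}
    (hx : IsMeanCurvatureFlow T x₀ x ν) {ψ : ℝ → Diffeomorph (𝓡 n) (𝓡 n) M M 2}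
    (hψ : IsHarmonicMapHeatFlow T α x ψ) {t : ℝ} (ht : t ∈ Ioo 0 T) (q : M) :
    HasDerivAt (fun s => deTurckFlow x ψ s (ψ t q))
        (laplacian (deTurckFlow x ψ t) (deTurckFlow x ψ t) (ψ t q) - (1 / α) •
          WithLp.toLp 2 (tangJac (deTurckFlow x ψ t) (ψ t q) *ᵥ
            (laplacian (deTurckFlow x ψ t) (incl M) (ψ t q)).ofLp)) t ∧
      inner ℝ (laplacian (deTurckFlow x ψ t) (deTurckFlow x ψ t) (ψ t q)) (ν t (x t q)) •
        ν t (x t q) = laplacian (deTurckFlow x ψ t) (deTurckFlow x ψ t) (ψ t q) ∧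
      inner ℝ (WithLp.toLp 2 (tangJac (deTurckFlow x ψ t) (ψ t q) *ᵥ
            (laplacian (deTurckFlow x ψ t) (incl M) (ψ t q)).ofLp)) (ν t (x t q)) = 0 := by
  have hemb := hx.embedding t (Ioo_subset_Ico_self ht)
  set y := deTurckFlow x ψ t with hy
  have hyC : ContMDiff (𝓡 n) 𝓘(ℝ, Euc (n + 1)) 2 y := contMDiff_deTurckFlow hx ψ ht
  have hyI := injective_mfderiv_deTurckFlow hx ψ ht
  set p := ψ t q with hp
  set eq := chartAt (Euc n) q with heq
  set ep := chartAt (Euc n) p with hep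
  have hqs : q ∈ eq.source := mem_chart_source _ q
  have hps : p ∈ ep.source := mem_chart_source _ p
  set u := eq q with hu
  have hut : u ∈ eq.target := eq.map_source hqs
  have hequ : eq.symm u = q := eq.left_inv hqs
  have hwt : ep p ∈ ep.target := ep.map_source hps
  have hepw : ep.symm (ep p) = p := ep.left_inv hps
  set Ψ := ep ∘ ψ t ∘ eq.symm with hΨ
  have hΨu : Ψ u = ep p := by simp [hΨ, hequ, hp]
  have hcont : ContinuousAt (ψ t ∘ eq.symm) u := by
    have : ContinuousAt (ψ t) (eq.symm u) := (ψ t).continuous.continuousAt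
    exact this.comp (eq.continuousAt_symm hut)
  have hXZ : x t ∘ eq.symm =ᶠ[𝓝 u] (y ∘ ep.symm) ∘ Ψ := by
    have : (ψ t ∘ eq.symm) u ∈ ep.source := by simp [hequ, ← hp, hps]
    filter_upwards [hcont.eventually (ep.open_source.mem_nhds this)] with w hw
    have hw' : ep.symm (ep (ψ t (eq.symm w))) = ψ t (eq.symm w) := ep.left_inv hw
    simp [hΨ, hw', hy, deTurckFlow]
  have hX : ContDiffAt ℝ 2 (x t ∘ eq.symm) u :=
    contDiffAt_comp_chart_symm two_le_infty hemb.contMDiff q hut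
  have hX' : Function.Injective (fderiv ℝ (x t ∘ eq.symm) u) :=
    hemb.injective_fderiv (by simp) q hut
  have hZ : ContDiffAt ℝ 2 (y ∘ ep.symm) (Ψ u) := by
    rw [hΨu]; exact contDiffAt_comp_chart_symm two_le_infty hyC p hwt
  have hZ' : Function.Injective (fderiv ℝ (y ∘ ep.symm) (Ψ u)) := by
    rw [hΨu]
    exact injective_fderiv_comp_chart_symm (hyC.mdifferentiable (by simp)) hyI p hwt
  have hI : ContDiffAt ℝ 2 (incl M ∘ ep.symm) (Ψ u) := by
    rw [hΨu]
    exact contDiffAt_comp_chart_symm two_le_infty (hM.contMDiff.of_le two_le_infty) p hwt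
  have hI' : Function.Injective (fderiv ℝ (incl M ∘ ep.symm) (Ψ u)) := by
    rw [hΨu]; exact hM.injective_fderiv (by simp) p hwt
  have hΨC : ContDiffAt ℝ 2 Ψ u := by
    have h1 : ContMDiffAt (𝓡 n) (𝓡 n) 2 eq.symm u :=
      ((contMDiffOn_chart_symm (n := ∞)).contMDiffAt
        ((isOpen_chart_target q).mem_nhds hut)).of_le two_le_infty
    have h2 : ContMDiffAt (𝓡 n) (𝓡 n) 2 ep (ψ t (eq.symm u)) := by
      rw [hequ, ← hp]
      exact ((contMDiffOn_chart (n := ∞)).contMDiffAt (ep.open_source.mem_nhds hps)).of_le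
        two_le_infty
    exact contMDiffAt_iff_contDiffAt.1
      (ContMDiffAt.comp u h2 (ContMDiffAt.comp u (ψ t).contMDiff.contMDiffAt h1))
  have hZd : DifferentiableAt ℝ (y ∘ ep.symm) (Ψ u) := hZ.differentiableAt (by simp)
  have hΨd : DifferentiableAt ℝ Ψ u := hΨC.differentiableAt (by simp)
  have hchain : fderiv ℝ (x t ∘ eq.symm) u =
      (fderiv ℝ (y ∘ ep.symm) (Ψ u)).comp (fderiv ℝ Ψ u) := by
    rw [hXZ.fderiv_eq, fderiv_comp u hZd hΨd]
  have hΨinj : Function.Injective (fderiv ℝ Ψ u) := by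
    rw [hchain] at hX'
    exact Function.Injective.of_comp hX'
  -- the normal component
  have hνX : IsUnitNormalAt (x t) q (ν t (x t q)) := hx.normal t (Ioo_subset_Ico_self ht) q
  set N := ν t (x t q) with hN
  have hperp : ∀ i, inner ℝ (pd i (x t ∘ eq.symm) u) N = 0 :=
    inner_pd_normal (hemb.mdifferentiable (by simp)) q hut (by rw [← heq, hequ]; exact hνX)
  have hlapZ : laplacian y y p = coordLaplacian (gramMetric (x t ∘ eq.symm)) (x t ∘ eq.symm) u := by
    rw [coordLaplacian_comp hXZ hXZ hZ hZ hΨC hX' hZ', hΨu]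
    rfl
  have hself : inner ℝ (laplacian y y p) N • N = laplacian y y p := by
    rw [hlapZ]
    exact (coordLaplacian_self_eq hX hX' hνX.1 hperp).symm
  -- Against N the Christoffel terms of the Laplacian vanish, so its normal component is the trace
  -- of the second derivatives, which is -H. Since the Laplacian is purely normal, this is the
  -- velocity of mean curvature flow.
  have hmean : -(meanCurvature (x t) N q • N) = laplacian y y p := by
    rw [← hself, hlapZ, inner_coordLaplacian_normal _ hperp, ← neg_smul]
    congr 1
    exact neg_neg _
  -- the tangential component
  have hmap : fderiv ℝ (y ∘ ep.symm) (Ψ u) (mapLaplacian (x t) (ψ t) q) =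
      WithLp.toLp 2 (tangJac y p *ᵥ (laplacian y (incl M) p).ofLp) := by
    have h1 := tangJac_mulVec hM (hyC.of_le (by norm_num)) p hwt (laplacian y (incl M) p)
      (w := mapLaplacian (x t) (ψ t) q) fun k => by
        have := coordMapLaplacian_apply hXZ hZ hΨC hX' hZ' hI hI' k
        rw [hΨu] at this
        exact this
    rw [← hep, hepw] at h1
    rw [h1, hΨu]
  refine ⟨?_, hself, ?_⟩
  · have hmem : Ioo 0 T ×ˢ (univ : Set M) ∈ 𝓝 (t, eq.symm u) :=
      (isOpen_Ioo.prod isOpen_univ).mem_nhds ⟨ht, mem_univ _⟩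
    have hk := contMDiffAt_prodMk_chart_symm q t hut
    have hg : ContDiffAt ℝ 1 (fun z : ℝ × Euc n => x z.1 (eq.symm z.2)) (t, u) :=
      contMDiffAt_iff_contDiffAt.1
        (ContMDiffAt.comp (t, u) (hx.contMDiffOn.contMDiffAt hmem) hk)
    have hψk := ContMDiffAt.comp (t, u) (hψ.contMDiffOn.contMDiffAt hmem) hk
    have hf : ContDiffAt ℝ 1 (fun z : ℝ × Euc n => ep (ψ z.1 (eq.symm z.2))) (t, u) := by
      have h2 : ContMDiffAt (𝓡 n) (𝓡 n) 1 ep (ψ t (eq.symm u)) := by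
        rw [hequ, ← hp]
        exact ((contMDiffOn_chart (n := ∞)).contMDiffAt (ep.open_source.mem_nhds hps)).of_le
          one_le_infty
      exact contMDiffAt_iff_contDiffAt.1 (ContMDiffAt.comp (t, u) h2 hψk)
    have ha : HasDerivAt (fun s => ep (ψ s (eq.symm u)))
        ((1 / α) • mapLaplacian (x t) (ψ t) q) t := by
      rw [hequ]; exact hψ.evolution t ht q
    have hb : HasDerivAt (fun s => x s (eq.symm u)) (laplacian y y p) t := by
      rw [hequ, ← hmean]; exact hx.evolution t ht q
    -- Differentiability of ψ(s)⁻¹ in s is not part of the hypotheses. The coordinate φ(s) of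
    -- ψ(s)⁻¹(p) is produced by the implicit function theorem from the equation that ψ(s) sends it
    -- to the fixed point p.
    obtain ⟨φ, hφt, hφc, hφe, hφd⟩ := exists_implicit_hasDerivAt hf hg hΨinj hchain ha hb
    rw [map_smul, hmap] at hφd
    refine hφd.congr_of_eventuallyEq ?_
    have hpc : ContinuousAt (fun s => (s, φ s)) t := continuousAt_id.prodMk hφc
    have hψc : ContinuousAt (fun s => ψ s (eq.symm (φ s))) t := by
      have h1 := hψk.continuousAt
      rw [← hφt] at h1
      exact ContinuousAt.comp (f := fun s => (s, φ s)) h1 hpc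
    -- The equation for φ holds only in the chart at p; equality of points follows once ψ(s) of the
    -- moving point lies in the source of that chart, where it is injective.
    have hsrc : ∀ᶠ s in 𝓝 t, ψ s (eq.symm (φ s)) ∈ ep.source :=
      hψc.eventually (ep.open_source.mem_nhds (by
        change ψ t (eq.symm (φ t)) ∈ ep.source
        rw [hφt, hequ, ← hp]; exact hps))
    filter_upwards [hφe, hsrc] with s hs1 hs2
    have h3 : ψ s (eq.symm (φ s)) = p := by
      refine ep.injOn hs2 hps ?_
      rw [hs1, hequ]
    change x s ((ψ s).symm p) = x s (eq.symm (φ s))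
    rw [← h3, Diffeomorph.symm_apply_apply]
  -- DΨ is injective, hence surjective. The vector (∇_M x̂) v therefore lies in the range of the
  -- differential of x(t), to which ν is orthogonal.
  · obtain ⟨w, hw⟩ := (LinearMap.injective_iff_surjective.1 hΨinj) (mapLaplacian (x t) (ψ t) q)
    have h1 : fderiv ℝ (x t ∘ eq.symm) u w =
        WithLp.toLp 2 (tangJac y p *ᵥ (laplacian y (incl M) p).ofLp) := by
      rw [hchain, ← hmap, ← hw]; rfl
    rw [← h1, fderiv_eq_sum_pd, sum_inner]
    exact Finset.sum_eq_zero fun i _ => by rw [real_inner_smul_left, hperp, mul_zero]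

end Flow

end

end DeTurck

end

/-! ### The weak formulation -/

theorem mainTheorem4 (n : ℕ) (M : Set (Euc (n + 1))) [ChartedSpace (Euc n) M]
    [IsManifold (𝓡 n) ∞ M] [CompactSpace M] [ConnectedSpace M]
    (hM : IsEmbeddingOfClass ∞ (incl M))
    (μ : M → Euc (n + 1)) (hμ : ∀ p, IsUnitNormalAt (incl M) p (μ p))
    (α T : ℝ) (hα : 0 < α)
    (x₀ : M → Euc (n + 1)) (x : ℝ → M → Euc (n + 1)) (ν : ℝ → Euc (n + 1) → Euc (n + 1))
    (hx : IsMeanCurvatureFlow T x₀ x ν)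
    (ψ : ℝ → Diffeomorph (𝓡 n) (𝓡 n) M M 2) (hψ : IsHarmonicMapHeatFlow T α x ψ)
    (xhat xhat_t : ℝ → M → Euc (n + 1)) (hxhat : xhat = deTurckFlow x ψ)
    (hxhat_t : ∀ t p, xhat_t t p = deriv (fun s => xhat s p) t)
    (G : ℝ → M → Matrix (Fin (n + 1)) (Fin (n + 1)) ℝ)
    (hG : ∀ t p, G t p = metricRep μ (xhat t) p)
    (v : ℝ → M → Euc (n + 1)) (hv : ∀ t p, v t p = laplacian (xhat t) (incl M) p) :
    ∀ t ∈ Ioo 0 T,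
      (∀ p, HasDerivAt (fun s => xhat s p) (xhat_t t p) t) ∧
      (∀ p, 0 < (G t p).det) ∧
      (∀ (χ : M → Euc (n + 1)) (Dχ : M → Matrix (Fin (n + 1)) (Fin (n + 1)) ℝ),
        IsSobolevH12 χ Dχ →
        Integrable (fun p => inner ℝ (xhat_t t p) (χ p) * √(G t p).det) (surfaceMeasure M) ∧
        Integrable (fun p => inner ℝ (xhat_t t p) (ν t (xhat t p)) *
          inner ℝ (ν t (xhat t p)) (χ p) * √(G t p).det) (surfaceMeasure M) ∧
        Integrable (fun p => contract (G t p)⁻¹ (tangJac (xhat t) p) (Dχ p) * √(G t p).det)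
          (surfaceMeasure M) ∧
        Integrable (fun p => (tangJac (xhat t) p *ᵥ (v t p).ofLp) ⬝ᵥ (χ p).ofLp *
          √(G t p).det) (surfaceMeasure M) ∧
        0 = α * (∫ p, inner ℝ (xhat_t t p) (χ p) * √(G t p).det ∂(surfaceMeasure M))
          + (1 - α) * (∫ p, inner ℝ (xhat_t t p) (ν t (xhat t p)) *
              inner ℝ (ν t (xhat t p)) (χ p) * √(G t p).det ∂(surfaceMeasure M))
          + (∫ p, contract (G t p)⁻¹ (tangJac (xhat t) p) (Dχ p) * √(G t p).det
              ∂(surfaceMeasure M))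
          + (∫ p, (tangJac (xhat t) p *ᵥ (v t p).ofLp) ⬝ᵥ (χ p).ofLp * √(G t p).det
              ∂(surfaceMeasure M))) ∧
      (∀ (ξ : M → Euc (n + 1)) (Dξ : M → Matrix (Fin (n + 1)) (Fin (n + 1)) ℝ),
        IsSobolevH12 ξ Dξ →
        Integrable (fun p => inner ℝ (v t p) (ξ p) * √(G t p).det) (surfaceMeasure M) ∧
        Integrable (fun p => contract (G t p)⁻¹ (tangJac (incl M) p) (Dξ p) * √(G t p).det)
          (surfaceMeasure M) ∧
        0 = (∫ p, inner ℝ (v t p) (ξ p) * √(G t p).det ∂(surfaceMeasure M))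
          + (∫ p, contract (G t p)⁻¹ (tangJac (incl M) p) (Dξ p) * √(G t p).det
              ∂(surfaceMeasure M))) := by
  subst hxhat
  intro t ht
  set y := deTurckFlow x ψ t with hy
  have hyC : ContMDiff (𝓡 n) 𝓘(ℝ, Euc (n + 1)) 2 y := contMDiff_deTurckFlow hx ψ ht
  have hyC1 : ContMDiff (𝓡 n) 𝓘(ℝ, Euc (n + 1)) 1 y := hyC.of_le (by norm_num)
  have hyI : ∀ p, Function.Injective (mfderiv (𝓡 n) 𝓘(ℝ, Euc (n + 1)) y p) :=
    injective_mfderiv_deTurckFlow hx ψ ht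
  have hincl : ContMDiff (𝓡 n) 𝓘(ℝ, Euc (n + 1)) 2 (incl M) := hM.contMDiff.of_le two_le_infty
  have hGt : ∀ p, G t p = metricRep μ y p := hG t
  have hvt : ∀ p, v t p = laplacian y (incl M) p := hv t
  set L : M → Euc (n + 1) := laplacian y y with hL
  set J : M → Euc (n + 1) :=
    fun p => WithLp.toLp 2 (tangJac y p *ᵥ (laplacian y (incl M) p).ofLp) with hJ
  have hflow : ∀ p, HasDerivAt (fun s => deTurckFlow x ψ s p) (L p - (1 / α) • J p) t ∧
      inner ℝ (L p) (ν t (y p)) • ν t (y p) = L p ∧ inner ℝ (J p) (ν t (y p)) = 0 := by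
    intro p
    -- The equation of motion is available at points ψ(t)(q); with q = ψ(t)⁻¹(p) every p is reached,
    -- and x(t)(q) is x̂(t)(p) by definition.
    have h := hasDerivAt_deTurckFlow hM hx hψ ht ((ψ t).symm p)
    rw [Diffeomorph.apply_symm_apply] at h
    exact h
  have hxt : ∀ p, xhat_t t p = L p - (1 / α) • J p := fun p =>
    (hxhat_t t p).trans (hflow p).1.deriv
  have hLc : Continuous L := continuous_laplacian hyC hyI hyC
  have hvc : Continuous (laplacian y (incl M)) := continuous_laplacian hyC hyI hincl
  have hJc : Continuous J :=
    (PiLp.continuous_toLp 2 _).comp ((continuous_tangJac hM hyC1).matrix_mulVec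
      ((PiLp.continuous_ofLp 2 _).comp hvc))
  -- Projection onto ν discards the tangential term and reproduces Δ_ĝ x̂. The field ν, whose
  -- continuity is not assumed, disappears from the integrand, so integrability follows from the
  -- continuity of Δ_ĝ x̂.
  have hnormal : ∀ (χ : M → Euc (n + 1)) p,
      inner ℝ (xhat_t t p) (ν t (y p)) * inner ℝ (ν t (y p)) (χ p) = inner ℝ (L p) (χ p) := by
    intro χ p
    obtain ⟨-, h1, h2⟩ := hflow p
    rw [hxt, inner_sub_left, real_inner_smul_left, h2, mul_zero, sub_zero]
    nth_rewrite 2 [← h1]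
    rw [real_inner_smul_left]
  have hdot : ∀ (χ : M → Euc (n + 1)) p,
      (tangJac y p *ᵥ (v t p).ofLp) ⬝ᵥ (χ p).ofLp = inner ℝ (J p) (χ p) := by
    intro χ p
    rw [hvt, PiLp.inner_apply, dotProduct]
    simp [hJ, mul_comm]
  refine ⟨fun p => by rw [hxt]; exact (hflow p).1, fun p => ?_, fun χ Dχ hχ => ?_,
    fun ξ Dξ hξ => ?_⟩
  · rw [hGt]; exact det_metricRep_pos hM hμ hyC1 hyI p
  · simp only [hnormal, hdot, hGt]
    have hLi := integrable_inner_laplacian hM hμ hyC1 hLc hχ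
    have hJi := integrable_inner_laplacian hM hμ hyC1 hJc hχ
    have hci := integrable_contract_metricRep hM hμ hyC1 hyI hyC1 (hχ.integrable_grad_apply hM)
    have hexp : (fun p => inner ℝ (xhat_t t p) (χ p) * √(metricRep μ y p).det) =
        fun p => inner ℝ (L p) (χ p) * √(metricRep μ y p).det -
          (1 / α) * (inner ℝ (J p) (χ p) * √(metricRep μ y p).det) := by
      funext p
      rw [hxt, inner_sub_left, real_inner_smul_left]
      ring
    have hg := green hM hμ hyC hyI hyC hχ
    rw [hexp]
    refine ⟨hLi.sub (hJi.const_mul _), hLi, hci, hJi, ?_⟩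
    rw [integral_sub hLi (hJi.const_mul _), integral_const_mul]
    have hα' : α * (1 / α) = 1 := mul_one_div_cancel hα.ne'
    -- The terms in L have total coefficient α + (1 - α) = 1 and combine with the Dirichlet term to
    -- Green's formula. Those in J have coefficient -α · α⁻¹ + 1 = 0.
    linear_combination -hg + (∫ p, inner ℝ (J p) (χ p) * √(metricRep μ y p).det
      ∂(surfaceMeasure M)) * hα'
  · simp only [hvt, hGt]
    exact ⟨integrable_inner_laplacian hM hμ hyC1 hvc hξ,
      integrable_contract_metricRep hM hμ hyC1 hyI (hincl.of_le (by norm_num))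
        (hξ.integrable_grad_apply hM), (green hM hμ hyC hyI hincl hξ).symm⟩
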